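/- Let $N\ge 2$ and let $\mathcal M=\mathbb R^N\times\mathbb R_{>0}^N$ be the space of pairs $(b,a)$, with $b=(b_n)$ and $a=(a_n)$ extended $N$-periodically in $n\in\mathbb Z$. The periodic Toda lattice is the system $\dot b_n=a_n^2-a_{n-1}^2$, $\dot a_n=\tfrac12a_n(b_{n+1}-b_n)$ on $\mathcal M$. Let $J=\begin{pmatrix}0&A\\-{}^tA&0\end{pmatrix}$ be the Poisson structure on $\mathcal M$, where the $j$-th column of the $N\times N$ matrix $A$ has entries $\tfrac12a_j$ in row $j$ and $-\tfrac12a_j$ in row $j+1$ (rows modulo $N$) and zeros elsewhere, with bracket $\{F,G\}_J=\langle\nabla_{b,a}F,J\nabla_{b,a}G\rangle$ and Casimir functions $C_1=-\frac1N\sum_{n=1}^Nb_n$, $C_2=\big(\prod_{n=1}^Na_n\big)^{1/N}$. For $\beta\in\mathbb R$, $\alpha>0$ let $\mathcal M_{\beta,\alpha}=\{(b,a)\in\mathcal M:C_1=\beta,\ C_2=\alpha\}$ be the corresponding symplectic leaf, with the Poisson bracket induced by $J$: at a point of the leaf, the bracket of $F|_{\mathcal M_{\beta,\alpha}}$ and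 $G|_{\mathcal M_{\beta,\alpha}}$ is the differential of $F|_{\mathcal M_{\beta,\alpha}}$ applied to the tangent vector $J\nabla_{b,a}G$. For $(b,a)\in\mathcal M$ let $y_1(k,\lambda),y_2(k,\lambda)$ be the solutions of $a_{k-1}y(k-1)+b_ky(k)+a_ky(k+1)=\lambda y(k)$ with $y_1(0)=1,\ y_1(1)=0$ and $y_2(0)=0,\ y_2(1)=1$, let $\Delta(\lambda)=y_1(N,\lambda)+y_2(N+1,\lambda)$, and write $\dot\Delta=\frac{d\Delta}{d\lambda}$. Let $\lambda_1<\lambda_2\le\lambda_3<\dots<\lambda_{2N-2}\le\lambda_{2N-1}<\lambda_{2N}$ be the eigenvalues, with multiplicities, of the symmetric $2N\times2N$ matrix $Q$ with rows and columns indexed modulo $2N$, whose diagonal entries are $b_i$, whose entries at $(i,i+1)$ and $(i+1,i)$ are $a_i$, and whose other entries are $0$. Let $\sqrt[c]{\Delta^2-4}$ be the continuous branch of the square root of $\Delta^2-4$ on $\mathbb C\setminus\big((-\infty,\lambda_1)\cup\bigcup_{n=1}^{N-1}(\lambda_{2n},\lambda_{2n+1})\cup(\lambda_{2N},\infty)\big)$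 with $-i\sqrt[c]{\Delta^2-4}>0$ on $(\lambda_{2N-1},\lambda_{2N})$. For $1\le n\le N-1$ the action variable is $$I_n=\frac1{2\pi}\oint_{\Gamma_n}\lambda\,\frac{\dot\Delta(\lambda)}{\sqrt[c]{\Delta(\lambda)^2-4}}\,d\lambda ,$$ where $\Gamma_n$ is a counterclockwise circle around $[\lambda_{2n},\lambda_{2n+1}]$ that separates it from all other $\lambda_j$ (the circle centred at $\frac12(\lambda_{2n}+\lambda_{2n+1})$ with radius $\frac12(\lambda_{2n+1}-\lambda_{2n})+\frac12\min(\lambda_{2n}-\lambda_{2n-1},\lambda_{2n+2}-\lambda_{2n+1})$). Then for all $\beta\in\mathbb R$ and $\alpha>0$ the functions $I_1,\dots,I_{N-1}$ are real-valued on $\mathcal M_{\beta,\alpha}$ and their restrictions to $\mathcal M_{\beta,\alpha}$ form a maximal set of functionally independent integrals in involution of the periodic Toda lattice. That is, the restrictions of $I_1,\dots,I_{N-1}$ to $\mathcal M_{\beta,\alpha}$ 1. are smooth; 2. are constant along every solution of the periodic Toda lattice on $\mathcal M_{\beta,\alpha}$; 3. have pairwise vanishing Poisson brackets on $\mathcal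 M_{\beta,\alpha}$; 4. have linearly independent differentials at every point of a dense subset of $\mathcal M_{\beta,\alpha}$; and any $k$ functions on $\mathcal M_{\beta,\alpha}$ that satisfy 1–4 number at most $N-1$, that is, $k\le N-1$. -/

import Mathlib

open scoped ContDiff Matrix Polynomial

noncomputable section

namespace PeriodicToda

/-- The ambient space `ℝ^N × ℝ^N` of pairs `(b, a)`. Indices live in `ℤ/N`, so the index `N` is `0`
and the `N`-periodic extension of `b` and `a` to `ℤ` is given by the cast `ℤ → ZMod N`. -/
abbrev Phase (N : ℕ) : Type := (ZMod N → ℝ) × (ZMod N → ℝ)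

variable {N : ℕ} [NeZero N]

/-- The phase space `𝓜 = ℝ^N × ℝ_{>0}^N`. -/
def phaseSpace (N : ℕ) : Set (Phase N) := {x | ∀ n, 0 < x.2 n}

/-! ### Poisson structure, Casimirs, leaves -/

/-- The `N × N` matrix `A`: its `j`-th column has `a_j / 2` in row `j` and `-a_j / 2` in row `j + 1`. -/
def matA (x : Phase N) : Matrix (ZMod N) (ZMod N) ℝ := fun i j =>
  (if i = j then x.2 j / 2 else 0) - (if i = j + 1 then x.2 j / 2 else 0)

/-- The gradient `∇_b F`. -/
def gradB (F : Phase N → ℝ) (x : Phase N) : ZMod N → ℝ :=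
  fun n => fderiv ℝ F x (Pi.single n 1, 0)

/-- The gradient `∇_a F`. -/
def gradA (F : Phase N → ℝ) (x : Phase N) : ZMod N → ℝ :=
  fun n => fderiv ℝ F x (0, Pi.single n 1)

/-- The Hamiltonian vector field `J ∇F`, with `J = [[0, A], [-Aᵀ, 0]]`. -/
def hamiltonianField (F : Phase N → ℝ) (x : Phase N) : Phase N :=
  (matA x *ᵥ gradA F x, -((matA x)ᵀ *ᵥ gradB F x))

/-- The Poisson bracket `{F, G}_J = ⟨∇F, J ∇G⟩`. -/
def poissonBracket (F G : Phase N → ℝ) (x : Phase N) : ℝ :=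
  gradB F x ⬝ᵥ (matA x *ᵥ gradA G x) - gradA F x ⬝ᵥ ((matA x)ᵀ *ᵥ gradB G x)

/-- The Casimir `C₁ = -(1/N) ∑ b_n`. -/
def casimir₁ (x : Phase N) : ℝ := -(1 / (N : ℝ)) * ∑ n, x.1 n

/-- The Casimir `C₂ = (∏ a_n)^(1/N)`. -/
def casimir₂ (x : Phase N) : ℝ := (∏ n, x.2 n) ^ (1 / (N : ℝ))

/-- The symplectic leaf `𝓜_{β,α}`, the level set of `(C₁, C₂)` in the phase space. -/
def leaf (N : ℕ) [NeZero N] (β α : ℝ) : Set (Phase N) :=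
  {x | x ∈ phaseSpace N ∧ casimir₁ x = β ∧ casimir₂ x = α}

/-- The tangent space at `x` of the leaf through `x`: the common kernel of `dC₁` and `dC₂`. -/
def leafTangent (x : Phase N) : Submodule ℝ (Phase N) :=
  LinearMap.ker (fderiv ℝ (casimir₁ (N := N)) x).toLinearMap ⊓
    LinearMap.ker (fderiv ℝ (casimir₂ (N := N)) x).toLinearMap

/-- The differential at `x` of the restriction of `F` to the leaf through `x`. -/
def leafDifferential (F : Phase N → ℝ) (x : Phase N) : leafTangent x →ₗ[ℝ] ℝ :=
  (fderiv ℝ F x).toLinearMap.domRestrict (leafTangent x)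

theorem sum_matA_mulVec (x : Phase N) (v : ZMod N → ℝ) : ∑ i, (matA x *ᵥ v) i = 0 := by
  simp only [Matrix.mulVec, dotProduct]
  rw [Finset.sum_comm]
  refine Finset.sum_eq_zero fun j _ => ?_
  rw [← Finset.sum_mul]
  simp [matA, Finset.sum_sub_distrib]

theorem sum_matA_transpose_mulVec_div {x : Phase N} (hx : x ∈ phaseSpace N) (v : ZMod N → ℝ) :
    ∑ i, ((matA x)ᵀ *ᵥ v) i / x.2 i = 0 := by
  have h : ∀ i, ((matA x)ᵀ *ᵥ v) i / x.2 i = v i / 2 - v (i + 1) / 2 := by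
    intro i
    have hi : x.2 i ≠ 0 := (hx i).ne'
    simp only [Matrix.mulVec, dotProduct, Matrix.transpose_apply, matA, sub_mul, ite_mul, zero_mul,
      Finset.sum_sub_distrib, Finset.sum_ite_eq', Finset.mem_univ, if_true]
    field_simp
  simp only [h, Finset.sum_sub_distrib]
  rw [sub_eq_zero]
  exact (Equiv.sum_comp (Equiv.addRight (1 : ZMod N)) (fun i => v i / 2)).symm

theorem fderiv_casimir₁ (x v : Phase N) :
    fderiv ℝ (casimir₁ (N := N)) x v = -(1 / (N : ℝ)) * ∑ n, v.1 n := by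
  have h : HasFDerivAt (casimir₁ (N := N))
      (-(1 / (N : ℝ)) • ∑ n, (ContinuousLinearMap.proj n).comp
        (ContinuousLinearMap.fst ℝ (ZMod N → ℝ) (ZMod N → ℝ))) x := by
    unfold casimir₁
    refine HasFDerivAt.const_mul ?_ _
    refine HasFDerivAt.fun_sum fun n _ => ?_
    exact ((ContinuousLinearMap.proj (R := ℝ) n).comp
        (ContinuousLinearMap.fst ℝ (ZMod N → ℝ) (ZMod N → ℝ))).hasFDerivAt
  rw [h.fderiv]
  simp

theorem fderiv_casimir₂ {x : Phase N} (hx : x ∈ phaseSpace N) (v : Phase N) :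
    fderiv ℝ (casimir₂ (N := N)) x v = casimir₂ x / N * ∑ n, v.2 n / x.2 n := by
  have hp : ∀ n, HasFDerivAt (fun y : Phase N => y.2 n)
      ((ContinuousLinearMap.proj (R := ℝ) n).comp
        (ContinuousLinearMap.snd ℝ (ZMod N → ℝ) (ZMod N → ℝ))) x := fun n =>
    ((ContinuousLinearMap.proj (R := ℝ) n).comp
        (ContinuousLinearMap.snd ℝ (ZMod N → ℝ) (ZMod N → ℝ))).hasFDerivAt
  have hP : 0 < ∏ n, x.2 n := Finset.prod_pos fun n _ => hx n
  have h := (HasFDerivAt.finsetProd (u := Finset.univ) fun n _ => hp n).rpow_const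
    (p := 1 / (N : ℝ)) (Or.inl hP.ne')
  have h' : fderiv ℝ (casimir₂ (N := N)) x = _ := h.fderiv
  rw [h']
  simp only [smul_apply, sum_apply,
    ContinuousLinearMap.comp_apply, ContinuousLinearMap.coe_snd', ContinuousLinearMap.proj_apply,
    smul_eq_mul, casimir₂]
  rw [Real.rpow_sub_one hP.ne', Finset.mul_sum, Finset.mul_sum]
  refine Finset.sum_congr rfl fun n _ => ?_
  rw [← Finset.mul_prod_erase Finset.univ x.2 (Finset.mem_univ n)]
  have h1 : x.2 n ≠ 0 := (hx n).ne'
  have h2 : ∏ j ∈ Finset.univ.erase n, x.2 j ≠ 0 :=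
    (Finset.prod_pos fun j _ => hx j).ne'
  field_simp

/-- Hamiltonian vector fields are tangent to the leaves. -/
theorem hamiltonianField_mem (G : Phase N → ℝ) {x : Phase N} (hx : x ∈ phaseSpace N) :
    hamiltonianField G x ∈ leafTangent x := by
  refine Submodule.mem_inf.2 ⟨?_, ?_⟩
  · rw [LinearMap.mem_ker]
    change fderiv ℝ (casimir₁ (N := N)) x _ = 0
    rw [fderiv_casimir₁]
    simp [hamiltonianField, sum_matA_mulVec]
  · rw [LinearMap.mem_ker]
    change fderiv ℝ (casimir₂ (N := N)) x _ = 0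
    rw [fderiv_casimir₂ hx]
    simp [hamiltonianField, neg_div, sum_matA_transpose_mulVec_div hx]

/-- The Poisson bracket on the leaf `𝓜_{β,α}` induced by `J`: the differential of the restriction of
`F`, applied to the (tangent) vector `J ∇G`. -/
def leafBracket {β α : ℝ} (F G : Phase N → ℝ) (x : leaf N β α) : ℝ :=
  leafDifferential F x.1 ⟨hamiltonianField G x.1, hamiltonianField_mem G x.2.1⟩

theorem leafBracket_eq_poissonBracket {β α : ℝ} (F G : Phase N → ℝ) (x : leaf N β α) :
    leafBracket F G x = poissonBracket F G x.1 := by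
  have key : ∀ v : Phase N, fderiv ℝ F x.1 v = gradB F x.1 ⬝ᵥ v.1 + gradA F x.1 ⬝ᵥ v.2 := by
    intro v
    have hv : v = (∑ n, v.1 n • ((Pi.single n 1, 0) : Phase N)) +
        ∑ n, v.2 n • ((0, Pi.single n 1) : Phase N) := by
      ext n <;> simp [Prod.fst_sum, Prod.snd_sum, Finset.sum_apply, Pi.single_apply]
    conv_lhs => rw [hv]
    simp only [gradB, gradA, dotProduct, map_add, map_sum, map_smul, smul_eq_mul, mul_comm]
  change fderiv ℝ F x.1 (hamiltonianField G x.1) = _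
  rw [key]
  simp [hamiltonianField, poissonBracket, sub_eq_add_neg]

/-! ### The Toda flow and independent integrals in involution -/

/-- The right-hand side of the Toda equations `ḃ_n = a_n² - a_{n-1}²`,
`ȧ_n = a_n (b_{n+1} - b_n) / 2`. -/
def todaField (x : Phase N) : Phase N :=
  (fun n => x.2 n ^ 2 - x.2 (n - 1) ^ 2, fun n => x.2 n * (x.1 (n + 1) - x.1 n) / 2)

/-- `F` is an integral of the periodic Toda lattice on the leaf: it is constant along every solution
of the Toda equations lying on the leaf. -/
def IsTodaIntegral (β α : ℝ) (F : Phase N → ℝ) : Prop :=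
  ∀ (γ : ℝ → Phase N) (t₀ t₁ : ℝ),
    (∀ t ∈ Set.Ioo t₀ t₁, γ t ∈ leaf N β α ∧ HasDerivAt γ (todaField (γ t)) t) →
    ∀ s ∈ Set.Ioo t₀ t₁, ∀ t ∈ Set.Ioo t₀ t₁, F (γ s) = F (γ t)

/-- The restrictions of `F₁, …, F_m` to the leaf `𝓜_{β,α}` are smooth, functionally independent
integrals in involution of the periodic Toda lattice. Smooth functions on the leaf are represented by
functions that are smooth near it; every smooth function on the leaf is of this form, since the leaf
is a smooth retract of the phase space. -/
structure IndependentIntegralsInInvolution (β α : ℝ) {m : ℕ} (F : Fin m → Phase N → ℝ) : Prop where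
  smooth : ∀ i, ∀ x ∈ leaf N β α, ContDiffAt ℝ ∞ (F i) x
  integral : ∀ i, IsTodaIntegral β α (F i)
  involution : ∀ i j, ∀ x : leaf N β α, leafBracket (F i) (F j) x = 0
  /-- The differentials of the restrictions are linearly independent on a dense subset of the leaf
  (which is relatively open by smoothness). -/
  independent : leaf N β α ⊆
    closure {x | x ∈ leaf N β α ∧ LinearIndependent ℝ fun i => leafDifferential (F i) x}

/-- Maximality: no family of such integrals has more members. -/
def MaximalIndependentIntegralsInInvolution (β α : ℝ) {m : ℕ} (F : Fin m → Phase N → ℝ) : Prop :=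
  IndependentIntegralsInInvolution β α F ∧
    ∀ (k : ℕ) (G : Fin k → Phase N → ℝ), IndependentIntegralsInInvolution β α G → k ≤ m

/-! ### Discriminant, spectrum, canonical root, actions -/

/-- The solution `y(k)`, `k ≥ 0`, of `a_{k-1} y(k-1) + b_k y(k) + a_k y(k+1) = λ y(k)` (`k ≥ 1`) with
`y(0) = p`, `y(1) = q`, as a polynomial in the spectral parameter `λ`. -/
def solution (x : Phase N) (p q : ℝ[X]) : ℕ → ℝ[X]
  | 0 => p
  | 1 => q
  | k + 2 => Polynomial.C (x.2 ((k + 1 : ℕ) : ZMod N))⁻¹ *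
      ((Polynomial.X - Polynomial.C (x.1 ((k + 1 : ℕ) : ZMod N))) * solution x p q (k + 1)
        - Polynomial.C (x.2 ((k : ℕ) : ZMod N)) * solution x p q k)

/-- The discriminant `Δ(λ) = y₁(N, λ) + y₂(N + 1, λ)`. -/
def discriminant (x : Phase N) : ℝ[X] := solution x 1 0 N + solution x 0 1 (N + 1)

/-- The periodic Jacobi matrix `Q` of size `2N`, with rows and columns indexed by `ℤ/2N`: diagonal
entries `b_i`, entries `a_i` at `(i, i+1)` and `(i+1, i)`. -/
def matQ (x : Phase N) : Matrix (ZMod (2 * N)) (ZMod (2 * N)) ℝ := fun i j =>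
  if i = j then x.1 (ZMod.castHom (dvd_mul_left N 2) (ZMod N) i)
  else if j = i + 1 then x.2 (ZMod.castHom (dvd_mul_left N 2) (ZMod N) i)
  else if i = j + 1 then x.2 (ZMod.castHom (dvd_mul_left N 2) (ZMod N) j)
  else 0

/-- `λ_j`, `1 ≤ j ≤ 2N`: the eigenvalues of `Q` in increasing order, with algebraic multiplicities. -/
def lam (x : Phase N) (j : ℕ) : ℝ := ((matQ x).charpoly.roots.sort (· ≤ ·)).getD (j - 1) 0

/-- The (real) cuts `(-∞, λ_1)`, `(λ_{2n}, λ_{2n+1})` for `1 ≤ n ≤ N - 1`, and `(λ_{2N}, ∞)`. -/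
def cuts (x : Phase N) : Set ℂ :=
  {z | z.im = 0 ∧ (z.re < lam x 1 ∨ lam x (2 * N) < z.re ∨
    ∃ n, 1 ≤ n ∧ n ≤ N - 1 ∧ lam x (2 * n) < z.re ∧ z.re < lam x (2 * n + 1))}

/-- `f` is the canonical root of `Δ² - 4`: the continuous branch of the square root off the cuts with
`-i f > 0` on `(λ_{2N-1}, λ_{2N})`. -/
structure IsCanonicalRoot (x : Phase N) (f : ℂ → ℂ) : Prop where
  continuousOn : ContinuousOn f (cuts x)ᶜ
  sq_eq : ∀ z ∈ (cuts x)ᶜ, f z ^ 2 = Polynomial.aeval z (discriminant x) ^ 2 - 4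
  sign : ∀ t ∈ Set.Ioo (lam x (2 * N - 1)) (lam x (2 * N)),
    ∃ r : ℝ, 0 < r ∧ -Complex.I * f (t : ℂ) = (r : ℂ)

/-- The canonical root; off the cuts it is the unique function with the properties above. -/
def canonicalRoot (x : Phase N) : ℂ → ℂ := Classical.epsilon (IsCanonicalRoot x)

/-- The centre `τ_n` of the contour `Γ_n`, the midpoint of the `n`-th gap. -/
def contourCenter (x : Phase N) (n : ℕ) : ℝ := (lam x (2 * n) + lam x (2 * n + 1)) / 2

/-- The radius of the contour `Γ_n`: half the gap length plus half the length of the shorter of the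
two adjacent bands. -/
def contourRadius (x : Phase N) (n : ℕ) : ℝ :=
  (lam x (2 * n + 1) - lam x (2 * n)) / 2 +
    min (lam x (2 * n) - lam x (2 * n - 1)) (lam x (2 * n + 2) - lam x (2 * n + 1)) / 2

/-- `(1/2π) ∮_{Γ_n} λ Δ'(λ) / √(Δ(λ)² - 4) dλ` along the circle `Γ_n` around the `n`-th gap
`[λ_{2n}, λ_{2n+1}]`, with counterclockwise orientation and the canonical root. -/
def actionIntegral (x : Phase N) (n : ℕ) : ℂ :=
  (1 / (2 * (Real.pi : ℂ))) * ∮ z in C((contourCenter x n : ℂ), contourRadius x n),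
    z * (Polynomial.aeval z (Polynomial.derivative (discriminant x)) / canonicalRoot x z)

/-- The action variable `I_n`, `1 ≤ n ≤ N - 1`; the integral defining it is real. -/
def action (n : ℕ) (x : Phase N) : ℝ := (actionIntegral x n).re

end PeriodicToda

end

/-! Everything is expressed through the monodromy matrix, the product of unimodular transfer
matrices over one period: `Δ` is its trace, and changing the base point conjugates it.
Differentiating the trace writes `dΔ(λ)` in the entries of the monodromy matrices at all sites
(`hasDerivAt_discriminant`). For the Toda field, and for the Poisson bracket of `Δ(λ)` with `Δ(μ)`,
the resulting sum over the sites telescopes around the period (`discriminantDeriv_todaField`,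
`discriminantDeriv_sharp`). Hence the coefficients of `Δ` are conserved and in involution.

The eigenvalues of `Q` are the zeros of `Δ² - 4`, with multiplicities (`roots_charpoly_matQ`). So
all these zeros are real; by Laguerre's inequality the bands between the gaps are nondegenerate
(`lam_strict`). Thus the contours exist and the canonical root is determined on them.

For smoothness the contour is frozen near a given point. On a fixed circle the root is a unit of the
Banach algebra of continuous functions, and squaring is a local diffeomorphism at a unit.
Differentiation under the integral and an integration by parts give `dI_n = -(1/2π) ∮ dΔ / √(Δ² - 4)
dλ` (`contDiffAt_action`). So `dI_n` is a combination of the differentials of the coefficients of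
`Δ`, which yields involution; conservation holds because `I_n` depends on the point through `Δ`
alone.

For independence, on a leaf the two top coefficients of `Δ` are constant, so only the monomials of
degree at most `N - 2` count. Their period matrix is invertible: a polynomial whose period around a
gap vanishes has a zero in that closed gap (`exists_root_of_period_eq_zero`), so one with all
periods zero has `N - 1` zeros in disjoint gaps. It remains to see that the coefficients themselves
have independent differentials on a dense set. Along a suitable line in the `b`-directions this is
the nonvanishing of a polynomial determinant (`polyDet_ne_zero`).

Maximality is symplectic linear algebra: the leaf has dimension `2N - 2`, and an isotropic subspace
has at most half that dimension. -/

open scoped ContDiff Matrix Polynomial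

noncomputable section

namespace PeriodicToda

variable {N : ℕ} [NeZero N]

set_option linter.unusedSectionVars false

/-! ### Transfer matrices -/

/-- The matrix that sends `(a_k y(k+1), y(k))` to `(a_{k+1} y(k+2), y(k+1))`. -/
def transfer (x : Phase N) (l : ℝ) (k : ZMod N) : Matrix (Fin 2) (Fin 2) ℝ :=
  !![(l - x.1 (k + 1)) / x.2 k, -x.2 k; 1 / x.2 k, 0]

/-- The product of `n` consecutive transfer matrices, the first one being at `j`. -/
def transferProd (x : Phase N) (l : ℝ) (j : ZMod N) : ℕ → Matrix (Fin 2) (Fin 2) ℝ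
  | 0 => 1
  | n + 1 => transfer x l (j + n) * transferProd x l j n

/-- The monodromy matrix with base point `j`. -/
def monodromy (x : Phase N) (l : ℝ) (j : ZMod N) : Matrix (Fin 2) (Fin 2) ℝ :=
  transferProd x l j N

theorem transferProd_add (x : Phase N) (l : ℝ) (j : ZMod N) (n m : ℕ) :
    transferProd x l j (n + m) = transferProd x l (j + n) m * transferProd x l j n := by
  induction m with
  | zero => simp [transferProd]
  | succ m ih =>
    rw [← add_assoc, transferProd, transferProd, ih, mul_assoc]
    push_cast
    rw [add_assoc]

theorem det_transfer {x : Phase N} (hx : x ∈ phaseSpace N) (l : ℝ) (k : ZMod N) :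
    (transfer x l k).det = 1 := by
  have := (hx k).ne'
  simp [transfer, Matrix.det_fin_two]
  field_simp

theorem det_transferProd {x : Phase N} (hx : x ∈ phaseSpace N) (l : ℝ) (j : ZMod N) (n : ℕ) :
    (transferProd x l j n).det = 1 := by
  induction n with
  | zero => simp [transferProd]
  | succ n ih => rw [transferProd, Matrix.det_mul, ih, det_transfer hx, one_mul]

/-- A product of `N + 1` consecutive transfer matrices can be split at either end, and the indices
are periodic. -/
theorem monodromy_succ_mul (x : Phase N) (l : ℝ) (j : ZMod N) :
    monodromy x l (j + 1) * transfer x l j = transfer x l j * monodromy x l j := by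
  have h1 := transferProd_add x l j N 1
  have h2 := transferProd_add x l j 1 N
  rw [add_comm 1 N] at h2
  rw [h1] at h2
  simpa [transferProd, monodromy] using h2.symm

/-- Conjugation by a transfer matrix, in coordinates. The gradient of `Δ` involves only the
traceless part of the monodromy, so this recursion is all that the later telescoping sums need. -/
theorem monodromy_succ {x : Phase N} (hx : x ∈ phaseSpace N) (l : ℝ) (j : ZMod N) :
    monodromy x l (j + 1) 0 1 = (l - x.1 (j + 1)) * (monodromy x l j 0 0 - monodromy x l j 1 1)
        - x.2 j ^ 2 * monodromy x l j 1 0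
        + (l - x.1 (j + 1)) ^ 2 * (monodromy x l j 0 1 / x.2 j ^ 2) ∧
    monodromy x l (j + 1) 1 0 = -(monodromy x l j 0 1 / x.2 j ^ 2) ∧
    monodromy x l (j + 1) 0 0 - monodromy x l (j + 1) 1 1 =
      -(monodromy x l j 0 0 - monodromy x l j 1 1)
        - 2 * (l - x.1 (j + 1)) * (monodromy x l j 0 1 / x.2 j ^ 2) := by
  have ha := (hx j).ne'
  have hdet := det_transfer hx l j
  have h : monodromy x l (j + 1) = transfer x l j * monodromy x l j * (transfer x l j).adjugate := by
    rw [← monodromy_succ_mul, mul_assoc, Matrix.mul_adjugate, hdet, one_smul, mul_one]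
  rw [h, Matrix.adjugate_fin_two]
  generalize monodromy x l j = X
  simp [transfer, Matrix.mul_apply, Matrix.vecMul, dotProduct, Fin.sum_univ_two]
  refine ⟨?_, ?_, ?_⟩ <;> field_simp <;> ring

theorem sum_range_cast {M : Type*} [AddCommMonoid M] (f : ZMod N → M) :
    ∑ m ∈ Finset.range N, f (m : ZMod N) = ∑ k, f k := by
  refine Finset.sum_bij (fun m _ => (m : ZMod N)) (fun _ _ => Finset.mem_univ _) ?_ ?_
    (fun _ _ => rfl)
  · intro m hm n hn h
    rw [Finset.mem_range] at hm hn
    have h' := congrArg ZMod.val h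
    rwa [ZMod.val_cast_of_lt hm, ZMod.val_cast_of_lt hn] at h'
  · exact fun k _ => ⟨k.val, Finset.mem_range.2 (ZMod.val_lt k), ZMod.natCast_zmod_val k⟩

theorem transferProd_mulVec_solution {x : Phase N} (hx : x ∈ phaseSpace N) (l : ℝ) (p q : ℝ[X])
    (n : ℕ) : transferProd x l 0 n *ᵥ ![x.2 0 * q.eval l, p.eval l] =
      ![x.2 n * (solution x p q (n + 1)).eval l, (solution x p q n).eval l] := by
  induction n with
  | zero => simp [transferProd, solution]
  | succ n ih =>
    have h1 := (hx n).ne'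
    have h2 := (hx (n + 1)).ne'
    rw [transferProd, ← Matrix.mulVec_mulVec, ih]
    ext i
    fin_cases i
    · simp [transfer, Matrix.mulVec, dotProduct, Fin.sum_univ_two, solution]
      field_simp
      ring
    · simp [transfer, Matrix.mulVec, dotProduct, Fin.sum_univ_two]
      field_simp

/-- In the coordinates `(a_0 y(1), y(0))` the solutions `y₁` and `y₂` start at `(0, 1)` and `(a_0,
0)`. The normalisation by `a` is harmless because `a_N = a_0`. -/
theorem eval_discriminant {x : Phase N} (hx : x ∈ phaseSpace N) (l : ℝ) :
    (discriminant x).eval l = (monodromy x l 0).trace := by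
  have h0 := (hx 0).ne'
  have h1 := congrFun (transferProd_mulVec_solution hx l 1 0 N) 1
  have h2 := congrFun (transferProd_mulVec_solution hx l 0 1 N) 0
  simp [Matrix.mulVec, dotProduct, Fin.sum_univ_two] at h1 h2
  rw [discriminant, Polynomial.eval_add, ← h1, Matrix.trace_fin_two, monodromy]
  have h3 : (solution x 0 1 (N + 1)).eval l = transferProd x l 0 N 0 0 :=
    mul_left_cancel₀ h0 (by rw [← h2]; ring)
  rw [h3, add_comm]

/-! ### The differential of the discriminant -/

/-- The logarithmic derivative of the transfer matrix in the direction `v`. -/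
def transferLogDeriv (x v : Phase N) (k : ZMod N) : Matrix (Fin 2) (Fin 2) ℝ :=
  !![-v.2 k / x.2 k, 0; v.1 (k + 1) / x.2 k ^ 2, v.2 k / x.2 k]

theorem hasDerivAt_transfer {γ : ℝ → Phase N} {v : Phase N} {t : ℝ} (hγ : HasDerivAt γ v t)
    (hx : γ t ∈ phaseSpace N) (l : ℝ) (k : ZMod N) (i j : Fin 2) :
    HasDerivAt (fun s => transfer (γ s) l k i j)
      ((transfer (γ t) l k * transferLogDeriv (γ t) v k) i j) t := by
  have h1 : ∀ n, HasDerivAt (fun s => (γ s).1 n) (v.1 n) t := fun n =>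
    ((ContinuousLinearMap.proj (R := ℝ) n).comp
      (ContinuousLinearMap.fst ℝ (ZMod N → ℝ) (ZMod N → ℝ))).hasFDerivAt.comp_hasDerivAt t hγ
  have h2 : ∀ n, HasDerivAt (fun s => (γ s).2 n) (v.2 n) t := fun n =>
    ((ContinuousLinearMap.proj (R := ℝ) n).comp
      (ContinuousLinearMap.snd ℝ (ZMod N → ℝ) (ZMod N → ℝ))).hasFDerivAt.comp_hasDerivAt t hγ
  have ha := (hx k).ne'
  fin_cases i <;> fin_cases j <;>
    simp [transfer, transferLogDeriv, Matrix.mul_apply, Fin.sum_univ_two]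
  · refine (((h1 (k + 1)).const_sub l).fun_div (h2 k) ha).congr_deriv ?_
    field_simp
    ring
  · exact (h2 k).fun_neg.congr_deriv (by field_simp)
  · refine ((h2 k).fun_inv ha).congr_deriv ?_
    field_simp
  · exact hasDerivAt_const t 0

theorem hasDerivAt_transferProd {γ : ℝ → Phase N} {v : Phase N} {t : ℝ} (hγ : HasDerivAt γ v t)
    (hx : γ t ∈ phaseSpace N) (l : ℝ) (k : ZMod N) (n : ℕ) (i j : Fin 2) :
    HasDerivAt (fun s => transferProd (γ s) l k n i j)
      ((∑ m ∈ Finset.range n, transferProd (γ t) l (k + m) (n - m) *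
        (transferLogDeriv (γ t) v (k + m) * transferProd (γ t) l k m)) i j) t := by
  induction n generalizing i j with
  | zero => simpa [transferProd] using hasDerivAt_const t _
  | succ n ih =>
    have hstep : (∑ m ∈ Finset.range (n + 1), transferProd (γ t) l (k + m) (n + 1 - m) *
        (transferLogDeriv (γ t) v (k + m) * transferProd (γ t) l k m)) =
        (transfer (γ t) l (k + n) * transferLogDeriv (γ t) v (k + n)) * transferProd (γ t) l k n +
        transfer (γ t) l (k + n) * ∑ m ∈ Finset.range n, transferProd (γ t) l (k + m) (n - m) *
        (transferLogDeriv (γ t) v (k + m) * transferProd (γ t) l k m) := by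
      rw [Finset.sum_range_succ, add_comm, Finset.mul_sum]
      congr 1
      · simp [transferProd, mul_assoc]
      · refine Finset.sum_congr rfl fun m hm => ?_
        have hm' : m ≤ n := (Finset.mem_range.1 hm).le
        rw [Nat.sub_add_comm hm', transferProd, mul_assoc]
        congr 2
        rw [add_assoc, ← Nat.cast_add, Nat.add_sub_cancel' hm']
    rw [hstep]
    simp only [transferProd]
    rw [Matrix.add_apply, funext fun s => Matrix.mul_apply]
    refine (HasDerivAt.fun_sum fun r _ => (hasDerivAt_transfer hγ hx l (k + n) i r).fun_mul
      (ih r j)).congr_deriv ?_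
    rw [Finset.sum_add_distrib, Matrix.mul_apply, Matrix.mul_apply]

/-- The derivative of `Δ(l)` along a curve with velocity `v`. -/
def discriminantDeriv (x v : Phase N) (l : ℝ) : ℝ :=
  ∑ k, (monodromy x l k 0 1 / x.2 k ^ 2 * v.1 (k + 1)
    - (monodromy x l k 0 0 - monodromy x l k 1 1) / x.2 k * v.2 k)

/-- The `m`-th term of the Leibniz rule interrupts the product at site `m`. By cyclicity of the
trace the two remaining pieces combine into the monodromy with base point `m`. -/
theorem hasDerivAt_discriminant {γ : ℝ → Phase N} {v : Phase N} {t : ℝ} (hγ : HasDerivAt γ v t)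
    (hγt : ∀ᶠ s in nhds t, γ s ∈ phaseSpace N) (l : ℝ) :
    HasDerivAt (fun s => (discriminant (γ s)).eval l) (discriminantDeriv (γ t) v l) t := by
  have hx := hγt.self_of_nhds
  have h := (hasDerivAt_transferProd hγ hx l 0 N 0 0).fun_add
    (hasDerivAt_transferProd hγ hx l 0 N 1 1)
  refine (h.congr_of_eventuallyEq (hγt.mono fun s hs => ?_)).congr_deriv ?_
  · simp only [eval_discriminant hs, Matrix.trace_fin_two, monodromy]
  · rw [← Matrix.trace_fin_two, Matrix.trace_sum, discriminantDeriv,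
      ← sum_range_cast fun k => (monodromy (γ t) l k 0 1 / (γ t).2 k ^ 2 * v.1 (k + 1)
        - (monodromy (γ t) l k 0 0 - monodromy (γ t) l k 1 1) / (γ t).2 k * v.2 k)]
    refine Finset.sum_congr rfl fun m hm => ?_
    have hm' : m ≤ N := (Finset.mem_range.1 hm).le
    have hX : monodromy (γ t) l m =
        transferProd (γ t) l 0 m * transferProd (γ t) l (0 + m) (N - m) := by
      have := transferProd_add (γ t) l m (N - m) m
      rw [Nat.sub_add_cancel hm', ← Nat.cast_add, Nat.add_sub_cancel' hm'] at this
      simpa [monodromy] using this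
    rw [Matrix.trace_mul_comm, mul_assoc, ← hX, zero_add]
    simp [transferLogDeriv, Matrix.trace_fin_two, Matrix.vecMul, dotProduct, Fin.sum_univ_two]
    ring

/-! ### Coefficients of the discriminant -/

/-- The recursion has order two, so the induction carries two consecutive indices. -/
theorem solution_zero_one_coeff_eq_zero (x : Phase N) (k : ℕ) :
    (∀ m, k ≤ m → (solution x 0 1 k).coeff m = 0) ∧
      ∀ m, k + 1 ≤ m → (solution x 0 1 (k + 1)).coeff m = 0 := by
  induction k with
  | zero =>
    refine ⟨by simp [solution], fun m hm => ?_⟩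
    simp only [solution, Polynomial.coeff_one]
    exact if_neg (by omega)
  | succ k ih =>
    refine ⟨ih.2, fun m hm => ?_⟩
    obtain ⟨m, rfl⟩ : ∃ r, m = r + 1 := ⟨m - 1, by omega⟩
    simp only [solution, Polynomial.coeff_C_mul, sub_mul, Polynomial.coeff_sub,
      Polynomial.coeff_X_mul]
    rw [ih.2 m (by omega), ih.2 (m + 1) (by omega), ih.1 (m + 1) (by omega)]
    simp

theorem solution_one_zero_coeff_eq_zero (x : Phase N) (k : ℕ) :
    (∀ m, k ≤ m → (solution x 1 0 (k + 1)).coeff m = 0) ∧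
      ∀ m, k + 1 ≤ m → (solution x 1 0 (k + 2)).coeff m = 0 := by
  induction k with
  | zero =>
    refine ⟨by simp [solution], fun m hm => ?_⟩
    simp only [solution, Polynomial.coeff_C_mul, mul_zero, zero_sub, Polynomial.coeff_neg,
      mul_one, Polynomial.coeff_C]
    rw [if_neg (by omega)]
    simp
  | succ k ih =>
    refine ⟨ih.2, fun m hm => ?_⟩
    obtain ⟨m, rfl⟩ : ∃ r, m = r + 1 := ⟨m - 1, by omega⟩
    rw [show k + 1 + 2 = (k + 1) + 2 from rfl, solution]
    simp only [Polynomial.coeff_C_mul, sub_mul, Polynomial.coeff_sub, Polynomial.coeff_X_mul]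
    rw [ih.2 m (by omega), ih.2 (m + 1) (by omega), ih.1 (m + 1) (by omega)]
    simp

theorem solution_zero_one_coeff_top (x : Phase N) (k : ℕ) :
    (solution x 0 1 (k + 1)).coeff k = ∏ j ∈ Finset.range k, (x.2 (j + 1 : ℕ))⁻¹ := by
  induction k with
  | zero => simp [solution]
  | succ k ih =>
    simp only [solution, Polynomial.coeff_C_mul, sub_mul, Polynomial.coeff_sub,
      Polynomial.coeff_X_mul]
    rw [(solution_zero_one_coeff_eq_zero x k).2 _ le_rfl,
      (solution_zero_one_coeff_eq_zero x k).1 _ (by omega), ih, Finset.prod_range_succ]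
    simp [mul_comm]

theorem solution_zero_one_coeff_top_sub_one (x : Phase N) (k : ℕ) :
    (solution x 0 1 (k + 2)).coeff k = -(∑ j ∈ Finset.range (k + 1), x.1 (j + 1 : ℕ)) *
      ∏ j ∈ Finset.range (k + 1), (x.2 (j + 1 : ℕ))⁻¹ := by
  induction k with
  | zero => simp [solution]; ring
  | succ k ih =>
    rw [show k + 1 + 2 = (k + 1) + 2 from rfl, solution]
    simp only [Polynomial.coeff_C_mul, sub_mul, Polynomial.coeff_sub, Polynomial.coeff_X_mul]
    rw [(solution_zero_one_coeff_eq_zero x k).2 _ le_rfl, solution_zero_one_coeff_top x (k + 1),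
      ih, Finset.prod_range_succ _ (k + 1), Finset.sum_range_succ _ (k + 1)]
    ring

theorem sum_range_cast_succ {M : Type*} [AddCommMonoid M] (f : ZMod N → M) :
    ∑ m ∈ Finset.range N, f ((m + 1 : ℕ) : ZMod N) = ∑ k, f k := by
  have h := sum_range_cast fun k : ZMod N => f (k + 1)
  rw [Equiv.sum_comp (Equiv.addRight (1 : ZMod N)) f |>.symm]
  simpa using h

theorem prod_range_cast_succ {M : Type*} [CommMonoid M] (f : ZMod N → M) :
    ∏ m ∈ Finset.range N, f ((m + 1 : ℕ) : ZMod N) = ∏ k, f k :=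
  sum_range_cast_succ (M := Additive M) f

theorem discriminant_coeff_eq_zero (hN : 2 ≤ N) (x : Phase N) {m : ℕ} (hm : N < m) :
    (discriminant x).coeff m = 0 := by
  obtain ⟨n, hn⟩ : ∃ n, N = n + 2 := ⟨N - 2, by omega⟩
  have h1 := (solution_one_zero_coeff_eq_zero x n).2 m (by omega)
  rw [← hn] at h1
  rw [discriminant, Polynomial.coeff_add, h1,
    (solution_zero_one_coeff_eq_zero x N).2 m (by omega), add_zero]

/-- This coefficient and the next lower one are determined by the Casimirs, hence do not contribute
to differentials on a leaf. -/
theorem discriminant_coeff_top (hN : 2 ≤ N) (x : Phase N) :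
    (discriminant x).coeff N = (∏ n, x.2 n)⁻¹ := by
  obtain ⟨n, hn⟩ : ∃ n, N = n + 2 := ⟨N - 2, by omega⟩
  have h1 := (solution_one_zero_coeff_eq_zero x n).2 N (by omega)
  rw [← hn] at h1
  rw [discriminant, Polynomial.coeff_add, h1, solution_zero_one_coeff_top, zero_add,
    ← Finset.prod_inv_distrib]
  exact prod_range_cast_succ fun k => (x.2 k)⁻¹

theorem discriminant_coeff_top_sub_one (hN : 2 ≤ N) (x : Phase N) :
    (discriminant x).coeff (N - 1) = -(∑ n, x.1 n) * (∏ n, x.2 n)⁻¹ := by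
  obtain ⟨n, hn⟩ : ∃ n, N = n + 2 := ⟨N - 2, by omega⟩
  have h1 := (solution_one_zero_coeff_eq_zero x n).2 (N - 1) (by omega)
  have h2 := solution_zero_one_coeff_top_sub_one x (N - 1)
  rw [← hn] at h1
  rw [show N - 1 + 2 = N + 1 by omega, show N - 1 + 1 = N by omega] at h2
  rw [discriminant, Polynomial.coeff_add, h1, h2, zero_add, sum_range_cast_succ x.1,
    ← Finset.prod_inv_distrib]
  congr 1
  exact prod_range_cast_succ fun k => (x.2 k)⁻¹

theorem natDegree_discriminant_le (hN : 2 ≤ N) (x : Phase N) : (discriminant x).natDegree ≤ N :=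
  Polynomial.natDegree_le_iff_coeff_eq_zero.2 fun _ hm => discriminant_coeff_eq_zero hN x hm

theorem isOpen_phaseSpace : IsOpen (phaseSpace N) := by
  have : phaseSpace N = ⋂ n, {x : Phase N | 0 < x.2 n} := by ext; simp [phaseSpace]
  rw [this]
  exact isOpen_iInter_of_finite fun n => isOpen_lt continuous_const (by fun_prop)

theorem contDiffAt_solution_coeff {x : Phase N} (hx : x ∈ phaseSpace N) (n : WithTop ℕ∞)
    (p q : ℝ[X]) (k : ℕ) :
    (∀ m, ContDiffAt ℝ n (fun y : Phase N => (solution y p q k).coeff m) x) ∧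
      ∀ m, ContDiffAt ℝ n (fun y : Phase N => (solution y p q (k + 1)).coeff m) x := by
  have hb : ∀ i, ContDiffAt ℝ n (fun y : Phase N => y.1 i) x := fun i =>
    ((ContinuousLinearMap.proj (R := ℝ) i).comp
      (ContinuousLinearMap.fst ℝ (ZMod N → ℝ) (ZMod N → ℝ))).contDiff.contDiffAt
  have ha : ∀ i, ContDiffAt ℝ n (fun y : Phase N => y.2 i) x := fun i =>
    ((ContinuousLinearMap.proj (R := ℝ) i).comp
      (ContinuousLinearMap.snd ℝ (ZMod N → ℝ) (ZMod N → ℝ))).contDiff.contDiffAt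
  induction k with
  | zero => exact ⟨fun m => by simpa [solution] using contDiffAt_const,
      fun m => by simpa [solution] using contDiffAt_const⟩
  | succ k ih =>
    refine ⟨ih.2, fun m => ?_⟩
    have hi := (ha (k + 1 : ℕ)).inv (hx _).ne'
    rcases m with _ | m
    · simp only [solution, sub_mul, Polynomial.coeff_sub,
        Polynomial.mul_coeff_zero, Polynomial.coeff_X_zero, zero_mul, Polynomial.coeff_C_zero]
      exact hi.mul ((contDiffAt_const.sub ((hb _).mul (ih.2 0))).sub ((ha _).mul (ih.1 0)))
    · simp only [solution, Polynomial.coeff_C_mul, sub_mul, Polynomial.coeff_sub,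
        Polynomial.coeff_X_mul]
      exact hi.mul (((ih.2 m).sub ((hb _).mul (ih.2 _))).sub ((ha _).mul (ih.1 _)))

theorem contDiffAt_discriminant_coeff {x : Phase N} (hx : x ∈ phaseSpace N) (n : WithTop ℕ∞)
    (m : ℕ) : ContDiffAt ℝ n (fun y : Phase N => (discriminant y).coeff m) x := by
  simp only [discriminant, Polynomial.coeff_add]
  exact ((contDiffAt_solution_coeff hx n 1 0 N).1 m).add
    ((contDiffAt_solution_coeff hx n 0 1 N).2 m)

theorem eval_discriminant_eq_sum (hN : 2 ≤ N) (x : Phase N) (l : ℝ) :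
    (discriminant x).eval l = ∑ m ∈ Finset.range (N + 1), (discriminant x).coeff m * l ^ m :=
  Polynomial.eval_eq_sum_range' (by have := natDegree_discriminant_le hN x; omega) l

/-- The differential of the `m`-th coefficient of the discriminant. -/
def coeffDifferential (x : Phase N) (m : ℕ) : Phase N →L[ℝ] ℝ :=
  fderiv ℝ (fun y : Phase N => (discriminant y).coeff m) x

theorem hasFDerivAt_discriminant_coeff {x : Phase N} (hx : x ∈ phaseSpace N) (m : ℕ) :
    HasFDerivAt (fun y : Phase N => (discriminant y).coeff m) (coeffDifferential x m) x :=
  ((contDiffAt_discriminant_coeff hx 1 m).differentiableAt one_ne_zero).hasFDerivAt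

/-- Both sides are the derivative at `0` of `Δ(l)` along the line `x + s v`, which links the
coefficients with the trace formula. -/
theorem sum_coeffDifferential (hN : 2 ≤ N) {x : Phase N} (hx : x ∈ phaseSpace N) (v : Phase N)
    (l : ℝ) :
    ∑ m ∈ Finset.range (N + 1), coeffDifferential x m v * l ^ m = discriminantDeriv x v l := by
  have hγ : HasDerivAt (fun s : ℝ => x + s • v) v 0 := by
    simpa using ((hasDerivAt_id (0 : ℝ)).smul_const v).const_add x
  have hγ0 : x + (0 : ℝ) • v = x := by simp
  have hmem : ∀ᶠ s : ℝ in nhds 0, x + s • v ∈ phaseSpace N :=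
    hγ.continuousAt.eventually (isOpen_phaseSpace.mem_nhds (by simpa using hx))
  have h1 := hasDerivAt_discriminant hγ hmem l
  rw [hγ0] at h1
  have h2 : HasDerivAt (fun s : ℝ => (discriminant (x + s • v)).eval l)
      (∑ m ∈ Finset.range (N + 1), coeffDifferential x m v * l ^ m) 0 := by
    simp only [eval_discriminant_eq_sum hN]
    refine HasDerivAt.fun_sum fun m _ => HasDerivAt.mul_const ?_ _
    have h3 := hasFDerivAt_discriminant_coeff hx m
    refine HasFDerivAt.comp_hasDerivAt (l := fun y : Phase N => (discriminant y).coeff m)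
      (0 : ℝ) ?_ hγ
    simpa only [hγ0] using h3
  exact h2.unique h1

theorem coeffDifferential_top_eq_zero (hN : 2 ≤ N) {x : Phase N} (hx : x ∈ phaseSpace N)
    {v : Phase N} (h2 : ∑ n, v.2 n / x.2 n = 0) :
    coeffDifferential x N v = 0 := by
  have hp : ∀ n, HasFDerivAt (fun y : Phase N => y.2 n)
      ((ContinuousLinearMap.proj (R := ℝ) n).comp
        (ContinuousLinearMap.snd ℝ (ZMod N → ℝ) (ZMod N → ℝ))) x := fun n =>
    ((ContinuousLinearMap.proj (R := ℝ) n).comp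
        (ContinuousLinearMap.snd ℝ (ZMod N → ℝ) (ZMod N → ℝ))).hasFDerivAt
  have hP : 0 < ∏ n, x.2 n := Finset.prod_pos fun n _ => hx n
  have h := (HasFDerivAt.finsetProd (u := Finset.univ) fun n _ => hp n)
  have h' := (hasDerivAt_inv hP.ne').comp_hasFDerivAt x h
  have h'' := (hasFDerivAt_discriminant_coeff hx N).unique
    (h'.congr_of_eventuallyEq (Filter.Eventually.of_forall fun y => by
      simp [discriminant_coeff_top hN]))
  have hs : ∑ n, (∏ j ∈ Finset.univ.erase n, x.2 j) * v.2 n = 0 := by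
    have : ∀ n, (∏ j ∈ Finset.univ.erase n, x.2 j) * v.2 n = (∏ j, x.2 j) * (v.2 n / x.2 n) := by
      intro n
      have := (hx n).ne'
      rw [← Finset.mul_prod_erase Finset.univ x.2 (Finset.mem_univ n)]
      field_simp
    simp only [this, ← Finset.mul_sum, h2, mul_zero]
  rw [h'']
  simp [hs]

theorem coeffDifferential_top_sub_one (hN : 2 ≤ N) {x : Phase N} (hx : x ∈ phaseSpace N)
    {v : Phase N} (h2 : ∑ n, v.2 n / x.2 n = 0) :
    coeffDifferential x (N - 1) v = -(∑ n, v.1 n) * (∏ n, x.2 n)⁻¹ := by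
  have hs : HasFDerivAt (fun y : Phase N => -∑ n, y.1 n)
      (-∑ n, (ContinuousLinearMap.proj (R := ℝ) n).comp
        (ContinuousLinearMap.fst ℝ (ZMod N → ℝ) (ZMod N → ℝ))) x :=
    (HasFDerivAt.fun_sum fun n _ => ((ContinuousLinearMap.proj (R := ℝ) n).comp
        (ContinuousLinearMap.fst ℝ (ZMod N → ℝ) (ZMod N → ℝ))).hasFDerivAt).fun_neg
  have h' := (hasFDerivAt_discriminant_coeff hx (N - 1)).unique
    ((hs.mul (hasFDerivAt_discriminant_coeff hx N)).congr_of_eventuallyEq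
      (Filter.Eventually.of_forall fun y => by
        simp [discriminant_coeff_top hN, discriminant_coeff_top_sub_one hN]))
  rw [h']
  simp [coeffDifferential_top_eq_zero hN hx h2, discriminant_coeff_top hN]
  ring

theorem mem_leafTangent_iff {x : Phase N} (hx : x ∈ phaseSpace N) {v : Phase N} :
    v ∈ leafTangent x ↔ ∑ n, v.1 n = 0 ∧ ∑ n, v.2 n / x.2 n = 0 := by
  have hN : (N : ℝ) ≠ 0 := Nat.cast_ne_zero.2 (NeZero.ne N)
  have hc : casimir₂ x ≠ 0 := (Real.rpow_pos_of_pos (Finset.prod_pos fun n _ => hx n) _).ne'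
  rw [leafTangent, Submodule.mem_inf, LinearMap.mem_ker, LinearMap.mem_ker]
  change fderiv ℝ (casimir₁ (N := N)) x v = 0 ∧ fderiv ℝ (casimir₂ (N := N)) x v = 0 ↔ _
  rw [fderiv_casimir₁, fderiv_casimir₂ hx]
  simp [hN, hc]

/-! ### Invariance under the flow and involution -/

theorem sum_succ {M : Type*} [AddCommMonoid M] (f : ZMod N → M) : ∑ k, f (k + 1) = ∑ k, f k :=
  Equiv.sum_comp (Equiv.addRight (1 : ZMod N)) f

/-- By the recursion for the monodromy, each term of the sum is the difference of one and the same
function at `k + 1` and at `k`; the sum over a period vanishes. -/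
theorem discriminantDeriv_todaField {x : Phase N} (hx : x ∈ phaseSpace N) (l : ℝ) :
    discriminantDeriv x (todaField x) l = 0 := by
  have key : ∀ k, monodromy x l k 0 1 / x.2 k ^ 2 * (todaField x).1 (k + 1)
      - (monodromy x l k 0 0 - monodromy x l k 1 1) / x.2 k * (todaField x).2 k =
      (-(x.2 (k + 1) ^ 2 * monodromy x l (k + 1) 1 0) + monodromy x l (k + 1) 0 1
        + (l - x.1 (k + 1)) * (monodromy x l (k + 1) 0 0 - monodromy x l (k + 1) 1 1) / 2)
      - (-(x.2 k ^ 2 * monodromy x l k 1 0) + monodromy x l k 0 1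
        + (l - x.1 k) * (monodromy x l k 0 0 - monodromy x l k 1 1) / 2) := by
    intro k
    obtain ⟨h1, h2, h3⟩ := monodromy_succ hx l k
    have ha := (hx k).ne'
    rw [h1, h2, h3]
    simp only [todaField, add_sub_cancel_right]
    field_simp
    ring
  simp only [discriminantDeriv, key]
  rw [Finset.sum_sub_distrib, sum_succ fun k => -(x.2 k ^ 2 * monodromy x l k 1 0)
    + monodromy x l k 0 1 + (l - x.1 k) * (monodromy x l k 0 0 - monodromy x l k 1 1) / 2, sub_self]

/-- The vector `J φ` at `x`, for a covector `φ`. -/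
def sharp (x : Phase N) (φ : Phase N →ₗ[ℝ] ℝ) : Phase N :=
  (matA x *ᵥ fun n => φ (0, Pi.single n 1), -((matA x)ᵀ *ᵥ fun n => φ (Pi.single n 1, 0)))

theorem sharp_fst (x : Phase N) (φ : Phase N →ₗ[ℝ] ℝ) (k : ZMod N) :
    (sharp x φ).1 (k + 1) =
      (x.2 (k + 1) * φ (0, Pi.single (k + 1) 1) - x.2 k * φ (0, Pi.single k 1)) / 2 := by
  simp only [sharp, Matrix.mulVec, dotProduct, matA, sub_mul, ite_mul, zero_mul,
    Finset.sum_sub_distrib, add_left_inj, Finset.sum_ite_eq, Finset.mem_univ, if_true]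
  ring

theorem sharp_snd (x : Phase N) (φ : Phase N →ₗ[ℝ] ℝ) (k : ZMod N) :
    (sharp x φ).2 k =
      x.2 k * (φ (Pi.single (k + 1) 1, 0) - φ (Pi.single k 1, 0)) / 2 := by
  simp only [sharp, Pi.neg_apply, Matrix.mulVec, dotProduct, matA, sub_mul, ite_mul, zero_mul,
    Matrix.transpose_apply,
    Finset.sum_sub_distrib, Finset.sum_ite_eq', Finset.mem_univ, if_true]
  ring

theorem discriminantDeriv_single_fst (x : Phase N) (l : ℝ) (k : ZMod N) :
    discriminantDeriv x (Pi.single (k + 1) 1, 0) l = monodromy x l k 0 1 / x.2 k ^ 2 := by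
  rw [discriminantDeriv, Finset.sum_eq_single k] <;> simp +contextual

theorem discriminantDeriv_single_snd (x : Phase N) (l : ℝ) (k : ZMod N) :
    discriminantDeriv x (0, Pi.single k 1) l =
      -((monodromy x l k 0 0 - monodromy x l k 1 1) / x.2 k) := by
  rw [discriminantDeriv, Finset.sum_eq_single k] <;> simp +contextual

/-- This is `{Δ(l), Δ(μ)} = 0`. The summand is again a difference of a function of the site at `k +
1` and `k`; the condition `l ≠ μ` is needed to divide by `l - μ`. -/
theorem discriminantDeriv_sharp {x : Phase N} (hx : x ∈ phaseSpace N) {l μ : ℝ} (hl : l ≠ μ)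
    (φ : Phase N →ₗ[ℝ] ℝ) (hφ : ∀ v, φ v = discriminantDeriv x v μ) :
    discriminantDeriv x (sharp x φ) l = 0 := by
  -- The recursion turns the `b`-gradient, an entry at site `k - 1`, into an entry at site `k`, so
  -- that both gradients refer to the same monodromy.
  have hb : ∀ k, φ (Pi.single k 1, 0) = -monodromy x μ k 1 0 := by
    intro k
    obtain ⟨k, rfl⟩ : ∃ j, k = j + 1 := ⟨k - 1, by ring⟩
    rw [hφ, discriminantDeriv_single_fst, (monodromy_succ hx μ k).2.1, neg_neg]
  -- The trace of the product of the traceless parts of the monodromies at `l` and `μ`. It would be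
  -- invariant under conjugation by one common matrix; its change from `k` to `k + 1` comes from the
  -- difference of the two transfer matrices and so carries a factor `l - μ`.
  set τ : ZMod N → ℝ := fun k => monodromy x l k 0 1 * monodromy x μ k 1 0 + monodromy x l k 1 0 * monodromy x μ k 0 1
    + (monodromy x l k 0 0 - monodromy x l k 1 1) * (monodromy x μ k 0 0 - monodromy x μ k 1 1) / 2
  set σ : ZMod N → ℝ := fun k => (monodromy x l k 0 0 - monodromy x l k 1 1) * monodromy x μ k 1 0 / 2
  have key : ∀ k, monodromy x l k 0 1 / x.2 k ^ 2 * (sharp x φ).1 (k + 1)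
      - (monodromy x l k 0 0 - monodromy x l k 1 1) / x.2 k * (sharp x φ).2 k =
      (τ (k + 1) - τ k) / (l - μ) + (σ (k + 1) - σ k) := by
    intro k
    obtain ⟨h1, h2, h3⟩ := monodromy_succ hx l k
    obtain ⟨h4, h5, h6⟩ := monodromy_succ hx μ k
    have ha := (hx k).ne'
    have ha' := (hx (k + 1)).ne'
    have hl' := sub_ne_zero.2 hl
    rw [sharp_fst, sharp_snd, hb, hb, hφ, hφ, discriminantDeriv_single_snd,
      discriminantDeriv_single_snd]
    simp only [τ, σ]
    have e1 : x.2 (k + 1) * -((monodromy x μ (k + 1) 0 0 - monodromy x μ (k + 1) 1 1) / x.2 (k + 1)) =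
      -(monodromy x μ (k + 1) 0 0 - monodromy x μ (k + 1) 1 1) := by field_simp
    rw [e1, h1, h2, h3, h4, h5, h6]
    field_simp
    ring
  rw [discriminantDeriv]
  rw [Finset.sum_congr rfl fun k _ => key k, Finset.sum_add_distrib, ← Finset.sum_div,
    Finset.sum_sub_distrib, Finset.sum_sub_distrib, sum_succ, sum_succ]
  simp

/-! ### The spectrum of `Q` -/

/-- The reduction map on indices. -/
abbrev redIndex (N : ℕ) : ZMod (2 * N) →+* ZMod N := ZMod.castHom (dvd_mul_left N 2) (ZMod N)

theorem one_add_one_ne_zero_zmod (hN : 2 ≤ N) : (1 + 1 : ZMod (2 * N)) ≠ 0 := by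
  intro h
  have h' : ((2 : ℕ) : ZMod (2 * N)) = 0 := by rw [← h]; norm_num
  have := Nat.le_of_dvd two_pos ((ZMod.natCast_eq_zero_iff 2 (2 * N)).1 h')
  omega

theorem one_ne_zero_zmod (hN : 2 ≤ N) : (1 : ZMod (2 * N)) ≠ 0 := by
  intro h
  exact one_add_one_ne_zero_zmod hN (by rw [h, add_zero])

/-- For `N ≥ 2` the indices `i`, `i + 1` and `i - 1` are distinct modulo `2N`, so the nested cases
turn into a sum. -/
theorem matQ_apply (hN : 2 ≤ N) (x : Phase N) (i j : ZMod (2 * N)) :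
    matQ x i j = (if j = i then x.1 (redIndex N i) else 0) +
      (if j = i + 1 then x.2 (redIndex N i) else 0) +
      (if j = i - 1 then x.2 (redIndex N (i - 1)) else 0) := by
  have h1 := one_ne_zero_zmod hN
  have h2 := one_add_one_ne_zero_zmod hN
  rw [matQ]
  by_cases hij : i = j
  · subst hij
    simp [h1, sub_eq_add_neg]
  · rw [if_neg hij, if_neg (Ne.symm hij)]
    by_cases h3 : j = i + 1
    · have h4 : j ≠ i - 1 := by
        rintro h
        apply h2
        have : i + 1 = i - 1 := h3.symm.trans h
        calc (1 + 1 : ZMod (2 * N)) = (i + 1) - (i - 1) := by ring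
          _ = 0 := by rw [this, sub_self]
      rw [if_pos h3, if_pos h3, if_neg h4, zero_add, add_zero]
    · rw [if_neg h3, if_neg h3]
      by_cases h5 : j = i - 1
      · subst h5
        simp
      · have h6 : i ≠ j + 1 := fun h => h5 (by rw [h]; ring)
        simp [h5, h6]

theorem matQ_isHermitian (hN : 2 ≤ N) (x : Phase N) : (matQ x).IsHermitian := by
  refine Matrix.IsHermitian.ext fun i j => ?_
  rw [star_trivial, matQ_apply hN, matQ_apply hN]
  have e1 : i = j ↔ j = i := eq_comm
  have e2 : i = j + 1 ↔ j = i - 1 := by rw [eq_sub_iff_add_eq, eq_comm]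
  have e3 : i = j - 1 ↔ j = i + 1 := by rw [eq_sub_iff_add_eq, eq_comm]
  simp only [e1, e2, e3]
  rw [add_right_comm]
  congr 1
  · congr 1
    all_goals
      split_ifs with h
      · simp [h, -map_sub]
      · rfl
  · split_ifs with h
    · rw [h]
    · rfl

theorem matQ_mulVec (hN : 2 ≤ N) (x : Phase N) (v : ZMod (2 * N) → ℝ) (i : ZMod (2 * N)) :
    (matQ x *ᵥ v) i = x.1 (redIndex N i) * v i + x.2 (redIndex N i) * v (i + 1) +
      x.2 (redIndex N (i - 1)) * v (i - 1) := by
  simp [Matrix.mulVec, dotProduct, matQ_apply hN, add_mul, Finset.sum_add_distrib, -map_sub]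

/-- The initial data of the periodic solution that belongs to a vector `v`. -/
def initialData (x : Phase N) : (ZMod (2 * N) → ℝ) →ₗ[ℝ] (Fin 2 → ℝ) where
  toFun v := ![x.2 0 * v 1, v 0]
  map_add' u v := by ext i; fin_cases i <;> simp [mul_add]
  map_smul' c v := by ext i; fin_cases i <;> simp; ring

theorem transferProd_mulVec_initialData (hN : 2 ≤ N) {x : Phase N} (hx : x ∈ phaseSpace N) {l : ℝ}
    {v : ZMod (2 * N) → ℝ} (hv : matQ x *ᵥ v = l • v) (n : ℕ) :
    transferProd x l 0 n *ᵥ initialData x v = ![x.2 n * v (n + 1), v n] := by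
  induction n with
  | zero => simp [transferProd, initialData]
  | succ n ih =>
    have h1 := (hx n).ne'
    have h := congrFun hv (n + 1)
    rw [matQ_mulVec hN, add_sub_cancel_right] at h
    simp only [map_add, map_natCast, map_one, Pi.smul_apply, smul_eq_mul] at h
    rw [transferProd, ← Matrix.mulVec_mulVec, ih]
    ext i
    fin_cases i
    · simp [transfer, Matrix.mulVec, dotProduct, Fin.sum_univ_two]
      field_simp
      linarith
    · simp [transfer, Matrix.mulVec, dotProduct, Fin.sum_univ_two]
      field_simp

theorem initialData_injOn (hN : 2 ≤ N) {x : Phase N} (hx : x ∈ phaseSpace N) {l : ℝ}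
    {v : ZMod (2 * N) → ℝ} (hv : matQ x *ᵥ v = l • v) (h0 : initialData x v = 0) : v = 0 := by
  funext i
  have h := congrFun (transferProd_mulVec_initialData hN hx hv i.val) 1
  rw [h0, Matrix.mulVec_zero] at h
  simpa using h.symm

/-- A `2N`-periodic solution returns to its initial data after two periods of the coefficients. The
square of the monodromy thus covers the periodic and the antiperiodic eigenvectors alike. -/
theorem monodromy_sq_mulVec (hN : 2 ≤ N) {x : Phase N} (hx : x ∈ phaseSpace N) {l : ℝ}
    {v : ZMod (2 * N) → ℝ} (hv : matQ x *ᵥ v = l • v) :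
    (monodromy x l 0 * monodromy x l 0) *ᵥ initialData x v = initialData x v := by
  have h := transferProd_mulVec_initialData hN hx hv (N + N)
  have hM := transferProd_add x l 0 N N
  rw [zero_add, ZMod.natCast_self] at hM
  have hc : ((N + N : ℕ) : ZMod (2 * N)) = 0 := by rw [← two_mul]; exact ZMod.natCast_self _
  rw [hM, hc] at h
  rw [monodromy, h]
  simp [initialData]

theorem exists_hasDerivAt_transferProd (x : Phase N) (l : ℝ) (k : ZMod N) (n : ℕ) (i j : Fin 2) :
    DifferentiableAt ℝ (fun s => transferProd x s k n i j) l := by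
  induction n generalizing i j with
  | zero => simp [transferProd]
  | succ n ih =>
    simp only [transferProd, Matrix.mul_apply, Fin.sum_univ_two]
    refine ((DifferentiableAt.mul ?_ (ih 0 j)).add (DifferentiableAt.mul ?_ (ih 1 j)))
    all_goals
      fin_cases i <;> simp [transfer]

/-- By Cayley–Hamilton, `M² = (tr M) M - 1`. The trace cannot vanish, as then `M² = -1`; so `M` is
scalar, with square `1`. -/
theorem sl2_eq_one_or_neg_one {M : Matrix (Fin 2) (Fin 2) ℝ} (hdet : M.det = 1) (hM : M * M = 1) :
    M 0 1 = 0 ∧ M 1 0 = 0 ∧ M 0 0 = M 1 1 ∧ M 0 0 ^ 2 = 1 := by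
  rw [Matrix.det_fin_two] at hdet
  have h00 := congrFun (congrFun hM 0) 0
  have h01 := congrFun (congrFun hM 0) 1
  have h10 := congrFun (congrFun hM 1) 0
  have h11 := congrFun (congrFun hM 1) 1
  simp [Matrix.mul_apply, Fin.sum_univ_two] at h00 h01 h10 h11
  have htr : M 0 0 + M 1 1 ≠ 0 := by
    intro h
    have : M 1 1 = -M 0 0 := by linarith
    rw [this] at hdet
    nlinarith
  have e1 : M 0 1 = 0 := by
    have : M 0 1 * (M 0 0 + M 1 1) = 0 := by linarith
    exact (mul_eq_zero.1 this).resolve_right htr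
  have e2 : M 1 0 = 0 := by
    have : M 1 0 * (M 0 0 + M 1 1) = 0 := by linarith
    exact (mul_eq_zero.1 this).resolve_right htr
  rw [e1] at h00 hdet
  have e3 : M 0 0 ^ 2 = 1 := by nlinarith
  refine ⟨e1, e2, ?_, e3⟩
  have h0 : M 0 0 ≠ 0 := by
    intro h
    rw [h] at e3
    norm_num at e3
  exact mul_left_cancel₀ h0 (by nlinarith)

/-- The polynomial `Δ² - 4`. -/
def spectralPoly (x : Phase N) : ℝ[X] := discriminant x ^ 2 - Polynomial.C 4

theorem spectralPoly_coeff_top (hN : 2 ≤ N) (x : Phase N) :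
    (spectralPoly x).coeff (2 * N) = ((∏ n, x.2 n)⁻¹) ^ 2 := by
  rw [spectralPoly, Polynomial.coeff_sub,
    Polynomial.coeff_pow_of_natDegree_le (natDegree_discriminant_le hN x),
    discriminant_coeff_top hN, Polynomial.coeff_C, if_neg (by omega), sub_zero]

theorem natDegree_spectralPoly_le (hN : 2 ≤ N) (x : Phase N) :
    (spectralPoly x).natDegree ≤ 2 * N := by
  rw [spectralPoly, Polynomial.natDegree_sub_C]
  exact Polynomial.natDegree_pow_le.trans (Nat.mul_le_mul_left 2 (natDegree_discriminant_le hN x))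

theorem leadingCoeff_pos {x : Phase N} (hx : x ∈ phaseSpace N) : 0 < ((∏ n, x.2 n)⁻¹) ^ 2 :=
  pow_pos (inv_pos.2 (Finset.prod_pos fun n _ => hx n)) 2

theorem spectralPoly_ne_zero (hN : 2 ≤ N) {x : Phase N} (hx : x ∈ phaseSpace N) :
    spectralPoly x ≠ 0 := by
  intro h
  have := spectralPoly_coeff_top hN x
  rw [h, Polynomial.coeff_zero] at this
  exact (leadingCoeff_pos hx).ne this

/-- If `det M = 1`, then `det (M² - 1) = 4 - (tr M)²`. -/
theorem eval_spectralPoly_eq_zero {x : Phase N} (hx : x ∈ phaseSpace N) {l : ℝ} {w : Fin 2 → ℝ}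
    (hw : w ≠ 0) (h : (monodromy x l 0 * monodromy x l 0) *ᵥ w = w) :
    (spectralPoly x).eval l = 0 := by
  have hdet : (monodromy x l 0).det = 1 := det_transferProd hx l 0 N
  have h0 : (monodromy x l 0 * monodromy x l 0 - 1) *ᵥ w = 0 := by
    rw [Matrix.sub_mulVec, h, Matrix.one_mulVec, sub_self]
  have h1 := Matrix.exists_mulVec_eq_zero_iff.1 ⟨w, hw, h0⟩
  simp [spectralPoly, eval_discriminant hx]
  rw [Matrix.trace_fin_two]
  rw [Matrix.det_fin_two] at h1 hdet
  simp [Matrix.mul_apply, Fin.sum_univ_two] at h1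
  generalize monodromy x l 0 = M at h1 hdet
  linear_combination -h1 + (M 0 0 * M 1 1 - M 0 1 * M 1 0 + 3) * hdet

/-- Here the monodromy is `1` or `-1`, and at such a point differentiating `det M = 1` gives `tr M'
= 0`. -/
theorem eval_derivative_discriminant_eq_zero {x : Phase N} (hx : x ∈ phaseSpace N) {l : ℝ}
    (h : monodromy x l 0 * monodromy x l 0 = 1) :
    (Polynomial.derivative (discriminant x)).eval l = 0 := by
  have hdet : ∀ s, (monodromy x s 0).det = 1 := fun s => det_transferProd hx s 0 N
  obtain ⟨h01, h10, h00, hsq⟩ := sl2_eq_one_or_neg_one (hdet l) h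
  have hd : ∀ i j, HasDerivAt (fun s => monodromy x s 0 i j)
      (deriv (fun s => monodromy x s 0 i j) l) l := fun i j =>
    (exists_hasDerivAt_transferProd x l 0 N i j).hasDerivAt
  have h1 := ((hd 0 0).fun_mul (hd 1 1)).fun_sub ((hd 0 1).fun_mul (hd 1 0))
  have h2 := h1.unique ((hasDerivAt_const l (1 : ℝ)).congr_of_eventuallyEq
    (Filter.Eventually.of_forall fun s => by
      rw [← hdet s, Matrix.det_fin_two]))
  have h3 := ((discriminant x).hasDerivAt l).unique
    (((hd 0 0).fun_add (hd 1 1)).congr_of_eventuallyEq (Filter.Eventually.of_forall fun s => by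
      simp only [eval_discriminant hx, Matrix.trace_fin_two]))
  rw [h3]
  rw [h01, h10, ← h00] at h2
  have h0 : monodromy x l 0 0 0 ≠ 0 := by
    intro h
    rw [h] at hsq
    norm_num at hsq
  refine mul_left_cancel₀ h0 ?_
  linarith

/-- Since `Q` is symmetric, the multiplicity of an eigenvalue is at most the dimension of its
eigenspace, which embeds by initial data into the plane. A nonzero eigenspace makes `l` a zero of
`Δ² - 4`. If it has dimension two, the squared monodromy is the identity, whence `Δ'(l) = 0` and the
zero is at least double. -/
theorem count_roots_charpoly_le (hN : 2 ≤ N) {x : Phase N} (hx : x ∈ phaseSpace N) (l : ℝ) :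
    (matQ x).charpoly.roots.count l ≤ (spectralPoly x).roots.count l := by
  classical
  have hQ := matQ_isHermitian hN x
  set K : Submodule ℝ (ZMod (2 * N) → ℝ) :=
    LinearMap.ker ((matQ x).mulVecLin - l • LinearMap.id) with hK
  have hmem : ∀ v, v ∈ K ↔ matQ x *ᵥ v = l • v := by
    intro v
    rw [hK, LinearMap.mem_ker]
    simp [sub_eq_zero]
  set W := (initialData x).domRestrict K
  have hW : Function.Injective W := by
    rw [← LinearMap.ker_eq_bot, LinearMap.ker_eq_bot']
    intro v hv
    exact Subtype.ext (initialData_injOn hN hx ((hmem _).1 v.2) hv)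
  have hle2 : Module.finrank ℝ K ≤ 2 := by
    simpa using LinearMap.finrank_le_finrank_of_injective hW
  have hcount : (matQ x).charpoly.roots.count l ≤ Module.finrank ℝ K := by
    rw [hQ.roots_charpoly_eq_eigenvalues, Multiset.count_map]
    have hind : LinearIndependent ℝ (fun i : {i // l = hQ.eigenvalues i} =>
        (⟨(hQ.eigenvectorBasis i.1).ofLp, (hmem _).2 (by
          rw [hQ.mulVec_eigenvectorBasis, ← i.2])⟩ : K)) := by
      have h1 : LinearIndependent ℝ fun i : {i // l = hQ.eigenvalues i} =>
          hQ.eigenvectorBasis i.1 :=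
        hQ.eigenvectorBasis.orthonormal.linearIndependent.comp _ Subtype.val_injective
      have h2 := h1.map' (WithLp.linearEquiv 2 ℝ (ZMod (2 * N) → ℝ)).toLinearMap
        (LinearEquiv.ker _)
      exact LinearIndependent.of_comp K.subtype h2
    have h := hind.fintype_card_le_finrank
    rw [Fintype.card_subtype] at h
    exact h
  have hE := spectralPoly_ne_zero hN hx
  refine hcount.trans ?_
  rw [Polynomial.count_roots]
  rcases Nat.eq_zero_or_pos (Module.finrank ℝ K) with h0 | hpos
  · omega
  have hroot : (spectralPoly x).IsRoot l := by
    obtain ⟨v, hv⟩ := Module.finrank_pos_iff_exists_ne_zero.1 hpos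
    refine eval_spectralPoly_eq_zero hx (w := W v) ?_
      (monodromy_sq_mulVec hN hx ((hmem _).1 v.2))
    intro h
    exact hv (hW (by rw [h, map_zero]))
  rcases (show Module.finrank ℝ K = 1 ∨ Module.finrank ℝ K = 2 by omega) with h1 | h2
  · rw [h1]
    exact (Polynomial.rootMultiplicity_pos hE).2 hroot
  · have hsurj : Function.Surjective W := by
      rw [← LinearMap.range_eq_top]
      apply Submodule.eq_top_of_finrank_eq
      rw [LinearMap.finrank_range_of_inj hW, h2]
      simp
    have hM : monodromy x l 0 * monodromy x l 0 = 1 := by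
      refine Matrix.ext_iff_mulVec.2 ?_
      intro w
      obtain ⟨v, rfl⟩ := hsurj w
      rw [Matrix.one_mulVec]
      exact monodromy_sq_mulVec hN hx ((hmem _).1 v.2)
    rw [h2]
    refine (Polynomial.one_lt_rootMultiplicity_iff_isRoot hE).2 ⟨hroot, ?_⟩
    simp [spectralPoly, Polynomial.derivative_pow, eval_derivative_discriminant_eq_zero hx hM]

/-- There are `2N` eigenvalues and the degree of `Δ² - 4` is at most `2N`, so the inclusion of
multisets is an equality. -/
theorem roots_charpoly_matQ (hN : 2 ≤ N) {x : Phase N} (hx : x ∈ phaseSpace N) :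
    (matQ x).charpoly.roots = (spectralPoly x).roots := by
  classical
  refine Multiset.eq_of_le_of_card_le (Multiset.le_iff_count.2 (count_roots_charpoly_le hN hx)) ?_
  have hQ := matQ_isHermitian hN x
  rw [hQ.roots_charpoly_eq_eigenvalues]
  simpa [ZMod.card] using (Polynomial.card_roots' _).trans (natDegree_spectralPoly_le hN x)

theorem card_roots_spectralPoly (hN : 2 ≤ N) {x : Phase N} (hx : x ∈ phaseSpace N) :
    Multiset.card (spectralPoly x).roots = 2 * N := by
  rw [← roots_charpoly_matQ hN hx, (matQ_isHermitian hN x).roots_charpoly_eq_eigenvalues]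
  simp [ZMod.card]

/-! ### The ordered eigenvalues -/

theorem prod_range_getD {M : Type*} [CommMonoid M] (f : ℝ → M) (L : List ℝ) :
    ∏ j ∈ Finset.range L.length, f (L.getD j 0) = (L.map f).prod := by
  induction L with
  | nil => simp
  | cons a L ih => rw [List.length_cons, Finset.prod_range_succ', List.map_cons, List.prod_cons,
      mul_comm, ← ih]; simp

theorem lam_eq (hN : 2 ≤ N) {x : Phase N} (hx : x ∈ phaseSpace N) (j : ℕ) :
    lam x (j + 1) = ((spectralPoly x).roots.sort (· ≤ ·)).getD j 0 := by
  rw [lam, roots_charpoly_matQ hN hx, Nat.add_sub_cancel]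

theorem length_sort_roots (hN : 2 ≤ N) {x : Phase N} (hx : x ∈ phaseSpace N) :
    ((spectralPoly x).roots.sort (· ≤ ·)).length = 2 * N := by
  rw [Multiset.length_sort, card_roots_spectralPoly hN hx]

theorem lam_mono (hN : 2 ≤ N) {x : Phase N} (hx : x ∈ phaseSpace N) {i j : ℕ} (hi : 1 ≤ i)
    (hij : i ≤ j) (hj : j ≤ 2 * N) : lam x i ≤ lam x j := by
  obtain ⟨i, rfl⟩ : ∃ r, i = r + 1 := ⟨i - 1, by omega⟩
  obtain ⟨j, rfl⟩ : ∃ r, j = r + 1 := ⟨j - 1, by omega⟩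
  rcases hij.eq_or_lt with h | h
  · rw [h]
  have hlen := length_sort_roots hN hx
  rw [lam_eq hN hx, lam_eq hN hx, List.getD_eq_getElem _ _ (by omega),
    List.getD_eq_getElem _ _ (by omega)]
  exact List.pairwise_iff_getElem.1 (Multiset.pairwise_sort _ _) i j _ _ (by omega)

theorem natDegree_spectralPoly (hN : 2 ≤ N) {x : Phase N} (hx : x ∈ phaseSpace N) :
    (spectralPoly x).natDegree = 2 * N :=
  le_antisymm (natDegree_spectralPoly_le hN x)
    ((card_roots_spectralPoly hN hx).symm.le.trans (Polynomial.card_roots' _))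

theorem spectralPoly_splits (hN : 2 ≤ N) {x : Phase N} (hx : x ∈ phaseSpace N) :
    (spectralPoly x).Splits :=
  Polynomial.splits_iff_card_roots.2
    (by rw [card_roots_spectralPoly hN hx, natDegree_spectralPoly hN hx])

theorem spectralPoly_eq_prod (hN : 2 ≤ N) {x : Phase N} (hx : x ∈ phaseSpace N) :
    spectralPoly x = Polynomial.C (((∏ n, x.2 n)⁻¹) ^ 2) *
      ∏ j ∈ Finset.range (2 * N), (Polynomial.X - Polynomial.C (lam x (j + 1))) := by
  have h := Polynomial.C_leadingCoeff_mul_prod_multiset_X_sub_C (p := spectralPoly x)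
    (by rw [card_roots_spectralPoly hN hx, natDegree_spectralPoly hN hx])
  rw [Polynomial.leadingCoeff, natDegree_spectralPoly hN hx, spectralPoly_coeff_top hN] at h
  rw [← h]
  congr 1
  conv_lhs => rw [← Multiset.sort_eq (spectralPoly x).roots (· ≤ ·)]
  rw [Multiset.map_coe, Multiset.prod_coe, ← prod_range_getD, length_sort_roots hN hx]
  simp only [lam_eq hN hx]

theorem eval_spectralPoly (hN : 2 ≤ N) {x : Phase N} (hx : x ∈ phaseSpace N) (t : ℝ) :
    (discriminant x).eval t ^ 2 - 4 = ((∏ n, x.2 n)⁻¹) ^ 2 *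
      ∏ j ∈ Finset.range (2 * N), (t - lam x (j + 1)) := by
  have h := congrArg (Polynomial.eval t) (spectralPoly_eq_prod hN hx)
  simpa [spectralPoly, Polynomial.eval_prod] using h

theorem aeval_spectralPoly (hN : 2 ≤ N) {x : Phase N} (hx : x ∈ phaseSpace N) (z : ℂ) :
    Polynomial.aeval z (discriminant x) ^ 2 - 4 = ((((∏ n, x.2 n)⁻¹) ^ 2 : ℝ) : ℂ) *
      ∏ j ∈ Finset.range (2 * N), (z - lam x (j + 1)) := by
  have h := congrArg (Polynomial.aeval z) (spectralPoly_eq_prod hN hx)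
  simp only [spectralPoly, map_sub, map_pow, map_mul, Polynomial.aeval_C, map_prod,
    Polynomial.aeval_X] at h
  simpa using h

/-! ### Continuity of the eigenvalues -/

theorem lam_eq_of_monotone (hN : 2 ≤ N) {x : Phase N} (hx : x ∈ phaseSpace N)
    {v : Fin (2 * N) → ℝ} (hv : Monotone v)
    (h : ∀ t, (spectralPoly x).eval t = ((∏ n, x.2 n)⁻¹) ^ 2 * ∏ j, (t - v j))
    (j : Fin (2 * N)) : lam x (j + 1) = v j := by
  have hE : spectralPoly x = Polynomial.C (((∏ n, x.2 n)⁻¹) ^ 2) *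
      ((Finset.univ.val.map v).map fun a => Polynomial.X - Polynomial.C a).prod := by
    refine Polynomial.funext fun t => ?_
    rw [h, Polynomial.eval_mul, Polynomial.eval_C, Multiset.map_map, Finset.prod_map_val,
      Polynomial.eval_prod]
    simp
  have hr : (spectralPoly x).roots = (List.ofFn v : Multiset ℝ) := by
    rw [hE, Polynomial.roots_C_mul _ (leadingCoeff_pos hx).ne',
      Polynomial.roots_multiset_prod_X_sub_C, Fin.univ_val_map]
  have hs : ((spectralPoly x).roots.sort (· ≤ ·)) = List.ofFn v := by
    rw [hr, Multiset.coe_sort]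
    apply List.mergeSort_of_pairwise
    simp_rw [decide_eq_true_eq, List.pairwise_ofFn]
    exact fun i j hij => hv hij.le
  rw [lam_eq hN hx, hs, List.getD_eq_getElem _ _ (by simp)]
  simp

/-- Compare both sides of the eigenvalue equation at an entry of the eigenvector of largest modulus.
The crude bound by the sum of all entries suffices, as it is continuous in `x`. -/
theorem abs_le_of_mem_roots_charpoly (hN : 2 ≤ N) (x : Phase N) {l : ℝ}
    (hl : l ∈ (matQ x).charpoly.roots) : |l| ≤ ∑ i, ∑ j, |matQ x i j| := by
  have hQ := matQ_isHermitian hN x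
  rw [hQ.roots_charpoly_eq_eigenvalues, Multiset.mem_map] at hl
  obtain ⟨k, -, rfl⟩ := hl
  have hv := hQ.mulVec_eigenvectorBasis k
  have hne : (hQ.eigenvectorBasis k).ofLp ≠ 0 := by
    intro h0
    exact hQ.eigenvectorBasis.toBasis.ne_zero k (by simpa using congrArg (WithLp.toLp 2) h0)
  generalize (hQ.eigenvectorBasis k).ofLp = v at hv hne
  obtain ⟨i, hi⟩ := Finite.exists_max fun j => |v j|
  have hi0 : 0 < |v i| := by
    refine (abs_nonneg _).lt_of_ne fun h0 => hne (funext fun j => ?_)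
    exact abs_nonpos_iff.1 ((hi j).trans h0.symm.le)
  have h1 : |hQ.eigenvalues k| * |v i| ≤ (∑ j, |matQ x i j|) * |v i| := by
    rw [← abs_mul]
    have := congrFun hv i
    simp only [Pi.smul_apply, smul_eq_mul] at this
    rw [← this, Matrix.mulVec, dotProduct, Finset.sum_mul]
    refine (Finset.abs_sum_le_sum_abs _ _).trans (Finset.sum_le_sum fun j _ => ?_)
    rw [abs_mul]
    exact mul_le_mul_of_nonneg_left (hi j) (abs_nonneg _)
  refine (le_of_mul_le_mul_right h1 hi0).trans ?_
  exact Finset.single_le_sum (f := fun i => ∑ j, |matQ x i j|)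
    (fun i _ => Finset.sum_nonneg fun j _ => abs_nonneg _) (Finset.mem_univ i)

theorem abs_lam_le (hN : 2 ≤ N) {x : Phase N} (hx : x ∈ phaseSpace N) (j : Fin (2 * N)) :
    |lam x (j + 1)| ≤ ∑ i, ∑ j, |matQ x i j| := by
  refine abs_le_of_mem_roots_charpoly hN x ?_
  rw [roots_charpoly_matQ hN hx, lam_eq hN hx,
    List.getD_eq_getElem _ _ (by rw [length_sort_roots hN hx]; exact j.2),
    ← Multiset.mem_sort (· ≤ ·)]
  exact List.getElem_mem _

theorem continuous_matQ (i j : ZMod (2 * N)) : Continuous fun x : Phase N => matQ x i j := by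
  unfold matQ
  split_ifs <;> fun_prop

theorem continuousAt_eval_discriminant (hN : 2 ≤ N) {x : Phase N} (hx : x ∈ phaseSpace N) (t : ℝ) :
    ContinuousAt (fun y : Phase N => (discriminant y).eval t) x := by
  simp only [eval_discriminant_eq_sum hN]
  exact tendsto_finsetSum _ fun m _ =>
    (contDiffAt_discriminant_coeff hx 0 m).continuousAt.mul continuousAt_const

theorem continuousAt_leadingCoeff {x : Phase N} (hx : x ∈ phaseSpace N) :
    ContinuousAt (fun y : Phase N => ((∏ n, y.2 n)⁻¹) ^ 2) x := by
  have : ContinuousAt (fun y : Phase N => ∏ n, y.2 n) x := by fun_prop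
  exact (this.inv₀ (Finset.prod_pos fun n _ => hx n).ne').pow 2

/-- The ordered spectra of nearby points stay in a compact box. Any limit of them along an
ultrafilter is ordered and, by continuity of `Δ`, factors `Δ² - 4` at `x`; so it is the ordered
spectrum at `x`. -/
theorem continuousAt_lam (hN : 2 ≤ N) {x : Phase N} (hx : x ∈ phaseSpace N) {j : ℕ} (hj : 1 ≤ j)
    (hj' : j ≤ 2 * N) : ContinuousAt (fun y => lam y j) x := by
  set f : Phase N → Fin (2 * N) → ℝ := fun y i => lam y (i + 1) with hf
  suffices ContinuousAt f x by
    have h := (continuous_apply (⟨j - 1, by omega⟩ : Fin (2 * N))).continuousAt.comp this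
    simpa [hf, Function.comp_def, Nat.sub_add_cancel hj] using h
  refine (Filter.tendsto_iff_ultrafilter _ _ _).2 fun g hg => ?_
  have hS : ContinuousAt (fun y : Phase N => ∑ i, ∑ j, |matQ y i j|) x := by
    refine Continuous.continuousAt ?_
    exact continuous_finsetSum _ fun i _ => continuous_finsetSum _ fun j _ =>
      (continuous_matQ i j).abs
  set B := (∑ i, ∑ j, |matQ x i j|) + 1
  have hmem : ∀ᶠ y in g, y ∈ phaseSpace N := hg (isOpen_phaseSpace.mem_nhds hx)
  have hB : ∀ᶠ y in g, f y ∈ Set.Icc (fun _ => -B) (fun _ => B) := by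
    filter_upwards [hmem, hg (hS.eventually (gt_mem_nhds (lt_add_one _)))] with y hy hyB
    have h := fun i => abs_le.1 ((abs_lam_le hN hy i).trans (le_of_lt hyB))
    exact ⟨fun i => (h i).1, fun i => (h i).2⟩
  obtain ⟨v, -, hv⟩ := (isCompact_Icc (a := fun _ : Fin (2 * N) => -B)
    (b := fun _ => B)).ultrafilter_le_nhds (g.map f) (Filter.le_principal_iff.2 hB)
  have hv' : Filter.Tendsto f g (nhds v) := hv
  have hvi : ∀ i : Fin (2 * N), Filter.Tendsto (fun y => lam y ((i : ℕ) + 1)) (g : Filter (Phase N))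
      (nhds (v i)) :=
    fun i =>
    (tendsto_pi_nhds.1 hv') i
  have hmono : Monotone v := fun i j hij =>
    le_of_tendsto_of_tendsto (hvi i) (hvi j) (hmem.mono fun y hy =>
      lam_mono hN hy (by omega) (by simpa using hij) (by omega))
  have hfv : f x = v := by
    funext i
    refine lam_eq_of_monotone hN hx hmono (fun t => ?_) i
    have h1 : Filter.Tendsto (fun y => (discriminant y).eval t ^ 2 - 4) (g : Filter (Phase N))
        (nhds ((discriminant x).eval t ^ 2 - 4)) :=
      (((continuousAt_eval_discriminant hN hx t).tendsto.mono_left hg).pow 2).sub_const 4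
    have h2 : Filter.Tendsto (fun y : Phase N => ((∏ n, y.2 n)⁻¹) ^ 2 *
        ∏ j : Fin (2 * N), (t - lam y (j + 1))) (g : Filter (Phase N))
        (nhds (((∏ n, x.2 n)⁻¹) ^ 2 * ∏ j, (t - v j))) :=
      ((continuousAt_leadingCoeff hx).tendsto.mono_left hg).mul
        (tendsto_finsetProd _ fun i _ => (hvi i).const_sub t)
    have h3 := tendsto_nhds_unique (h1.congr' (hmem.mono fun y hy => by
      rw [eval_spectralPoly hN hy, Finset.prod_range])) h2
    rw [← h3]
    simp [spectralPoly]
  rw [hfv]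
  exact hv'

/-! ### Nondegeneracy of the bands -/

/-- This is `-(p'/p)' = ∑ 1/(t - a)² > 0` without denominators. A new factor `X - a` multiplies the
old expression by `(t - a)²` and adds `q(t)²`, which is positive. -/
theorem laguerre {p : ℝ[X]} (hp : p.Splits) (hd : 0 < p.natDegree) {t : ℝ} (ht : p.eval t ≠ 0) :
    0 < p.derivative.eval t ^ 2 - p.eval t * p.derivative.derivative.eval t := by
  have key : ∀ s : Multiset ℝ, (s.map fun a => Polynomial.X - Polynomial.C a).prod.eval t ≠ 0 →
      0 ≤ (s.map fun a => Polynomial.X - Polynomial.C a).prod.derivative.eval t ^ 2 -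
        (s.map fun a => Polynomial.X - Polynomial.C a).prod.eval t *
        (s.map fun a => Polynomial.X - Polynomial.C a).prod.derivative.derivative.eval t ∧
      (s ≠ 0 → 0 < (s.map fun a => Polynomial.X - Polynomial.C a).prod.derivative.eval t ^ 2 -
        (s.map fun a => Polynomial.X - Polynomial.C a).prod.eval t *
        (s.map fun a => Polynomial.X - Polynomial.C a).prod.derivative.derivative.eval t) := by
    intro s
    induction s using Multiset.induction_on with
    | empty => simp
    | cons a s ih =>
      intro h
      rw [Multiset.map_cons, Multiset.prod_cons] at h ⊢
      generalize (s.map fun a => Polynomial.X - Polynomial.C a).prod = q at ih h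
      rw [Polynomial.eval_mul] at h
      have hq := right_ne_zero_of_mul h
      have h1 := (ih hq).1
      have h2 : 0 < q.eval t ^ 2 := by positivity
      have e : (Polynomial.derivative ((Polynomial.X - Polynomial.C a) * q)).eval t ^ 2 -
          ((Polynomial.X - Polynomial.C a) * q).eval t *
          (Polynomial.derivative (Polynomial.derivative ((Polynomial.X - Polynomial.C a) * q))).eval t =
          q.eval t ^ 2 + (t - a) ^ 2 * (q.derivative.eval t ^ 2 -
            q.eval t * q.derivative.derivative.eval t) := by
        simp
        ring
      rw [e]
      have h3 := mul_nonneg (sq_nonneg (t - a)) h1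
      exact ⟨by linarith, fun _ => by linarith⟩
  have hfac := hp.eq_prod_roots
  have hc : p.leadingCoeff ≠ 0 := by
    rw [Ne, Polynomial.leadingCoeff_eq_zero]
    rintro rfl
    simp at hd
  have hroots : p.roots ≠ 0 := by
    intro h0
    have := Polynomial.splits_iff_card_roots.1 hp
    rw [h0, Multiset.card_zero] at this
    omega
  have hev : (p.roots.map fun a => Polynomial.X - Polynomial.C a).prod.eval t ≠ 0 := by
    intro h0
    rw [hfac, Polynomial.eval_mul, h0, mul_zero] at ht
    exact ht rfl
  have h := (key _ hev).2 hroots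
  have hc2 : 0 < p.leadingCoeff ^ 2 := by positivity
  rw [hfac]
  simp only [Polynomial.derivative_C_mul, Polynomial.eval_C_mul]
  have := mul_pos hc2 h
  refine this.trans_le (le_of_eq ?_)
  ring

theorem prod_sub_eq_neg_one_pow {R ι : Type*} [CommRing R] (s : Finset ι) (f : ι → R) (t : R) :
    ∏ j ∈ s, (t - f j) = (-1) ^ s.card * ∏ j ∈ s, (f j - t) := by
  rw [← Finset.prod_const, ← Finset.prod_mul_distrib]
  exact Finset.prod_congr rfl fun j _ => by ring

/-- Suppose a band collapses to `μ`. Then `Δ² - 4 = (X - μ)² R` with `R(μ) ≥ 0`, so `Δ(μ) = ±2`,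
`Δ'(μ) = 0` and `Δ(μ) Δ''(μ) = R(μ) ≥ 0`. But `Δ ± 2` divides `Δ² - 4`, hence is real-rooted, and
Laguerre's inequality for the factor that does not vanish at `μ` gives `Δ(μ) Δ''(μ) < 0`. -/
theorem lam_strict (hN : 2 ≤ N) {x : Phase N} (hx : x ∈ phaseSpace N) {m : ℕ} (hm : m < N) :
    lam x (2 * m + 1) < lam x (2 * m + 2) := by
  refine (lam_mono hN hx (by omega) (by omega) (by omega)).lt_of_ne fun heq => ?_
  set μ := lam x (2 * m + 1) with hμ
  set P := discriminant x with hP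
  set R : ℝ[X] := Polynomial.C (((∏ n, x.2 n)⁻¹) ^ 2) *
    ((∏ j ∈ Finset.range (2 * m), (Polynomial.X - Polynomial.C (lam x (j + 1)))) *
      ∏ j ∈ Finset.Ico (2 * m + 2) (2 * N), (Polynomial.X - Polynomial.C (lam x (j + 1)))) with hR
  have hfac : P ^ 2 - Polynomial.C 4 = (Polynomial.X - Polynomial.C μ) ^ 2 * R := by
    have h := spectralPoly_eq_prod hN hx
    rw [spectralPoly, ← Finset.prod_range_mul_prod_Ico _ (show 2 * m + 2 ≤ 2 * N by omega),
      Finset.prod_range_succ, Finset.prod_range_succ, ← hμ, ← heq] at h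
    rw [hP, h, hR]
    ring
  have hRpos : 0 ≤ R.eval μ := by
    rw [hR, Polynomial.eval_mul, Polynomial.eval_C, Polynomial.eval_mul, Polynomial.eval_prod,
      Polynomial.eval_prod]
    simp only [Polynomial.eval_sub, Polynomial.eval_X, Polynomial.eval_C]
    rw [prod_sub_eq_neg_one_pow (Finset.Ico _ _), Nat.card_Ico,
      -- An even number of zeros lies to the right of the collapsed band, so their signs cancel.
      (show Even (2 * N - (2 * m + 2)) from ⟨N - m - 1, by omega⟩).neg_one_pow, one_mul]
    refine mul_nonneg (leadingCoeff_pos hx).le (mul_nonneg ?_ ?_)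
    · refine Finset.prod_nonneg fun j hj => sub_nonneg.2 (lam_mono hN hx (by omega) ?_ (by omega))
      have := Finset.mem_range.1 hj
      omega
    · refine Finset.prod_nonneg fun j hj => sub_nonneg.2 ?_
      have := Finset.mem_Ico.1 hj
      exact lam_mono hN hx (by omega) (by omega) (by omega)
  have h0 := congrArg (Polynomial.eval μ) hfac
  have h1 := congrArg (fun p => (Polynomial.derivative p).eval μ) hfac
  have h2 := congrArg (fun p => (Polynomial.derivative (Polynomial.derivative p)).eval μ) hfac
  simp [Polynomial.derivative_pow] at h0 h1 h2
  have hP2 : P.eval μ ^ 2 = 4 := by linarith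
  have hPne : P.eval μ ≠ 0 := fun h => by rw [h] at hP2; norm_num at hP2
  have hP' : P.derivative.eval μ = 0 := h1.resolve_left hPne
  have hEs : ((P - Polynomial.C 2) * (P + Polynomial.C 2)).Splits := by
    convert spectralPoly_splits hN hx using 1
    rw [spectralPoly, ← hP, show (Polynomial.C 4 : ℝ[X]) = Polynomial.C 2 ^ 2 by
      rw [← Polynomial.C_pow]; norm_num]
    ring
  have hne : (P - Polynomial.C 2) * (P + Polynomial.C 2) ≠ 0 := by
    convert spectralPoly_ne_zero hN hx using 1
    rw [spectralPoly, ← hP, show (Polynomial.C 4 : ℝ[X]) = Polynomial.C 2 ^ 2 by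
      rw [← Polynomial.C_pow]; norm_num]
    ring
  have hdeg : 0 < P.natDegree := by
    refine (show 0 < N by omega).trans_le (Polynomial.le_natDegree_of_ne_zero ?_)
    rw [discriminant_coeff_top hN]
    exact inv_ne_zero (Finset.prod_pos fun n _ => hx n).ne'
  have hcases : (P.eval μ - 2) * (P.eval μ + 2) = 0 := by linarith
  rcases mul_eq_zero.1 hcases with h | h
  · have hl := laguerre (hEs.of_dvd hne (Dvd.intro_left _ rfl))
      (by rwa [Polynomial.natDegree_add_C]) (t := μ) (by simp; linarith)
    simp [hP'] at hl h2
    have : P.eval μ = 2 := by linarith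
    rw [this] at h2 hl
    nlinarith
  · have hl := laguerre (hEs.of_dvd hne (Dvd.intro _ rfl))
      (by rwa [Polynomial.natDegree_sub_C]) (t := μ) (by simp; linarith)
    simp [hP'] at hl h2
    have : P.eval μ = -2 := by linarith
    rw [this] at h2 hl
    nlinarith

/-! ### The canonical root -/

/-- A continuous function whose restriction to the closed upper half plane is the square root with
values in the closed first quadrant. -/
def upperSqrt (z : ℂ) : ℂ :=
  (√((‖z‖ + z.re) / 2) : ℂ) + (√((‖z‖ - z.re) / 2) : ℂ) * Complex.I

theorem continuous_upperSqrt : Continuous upperSqrt := by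
  unfold upperSqrt
  fun_prop

theorem upperSqrt_sq {z : ℂ} (hz : 0 ≤ z.im) : upperSqrt z ^ 2 = z := by
  have h1 : 0 ≤ (‖z‖ + z.re) / 2 := by
    have := neg_le_of_abs_le (Complex.abs_re_le_norm z)
    linarith
  have h2 : 0 ≤ (‖z‖ - z.re) / 2 := by
    have := le_of_abs_le (Complex.abs_re_le_norm z)
    linarith
  have h3 : √((‖z‖ + z.re) / 2) * √((‖z‖ - z.re) / 2) = z.im / 2 := by
    rw [← Real.sqrt_mul h1, Real.sqrt_eq_iff_mul_self_eq (mul_nonneg h1 h2) (by linarith)]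
    have := Complex.sq_norm z
    rw [Complex.normSq_apply] at this
    linarith
  have h4 := Real.sq_sqrt h1
  have h5 := Real.sq_sqrt h2
  rw [upperSqrt]
  generalize √((‖z‖ + z.re) / 2) = u at h3 h4
  generalize √((‖z‖ - z.re) / 2) = v at h3 h5
  apply Complex.ext
  · simp [pow_two]
    linarith
  · simp [pow_two]
    linarith

theorem upperSqrt_of_nonneg {t : ℝ} (ht : 0 ≤ t) : upperSqrt t = (√t : ℂ) := by
  simp [upperSqrt, abs_of_nonneg ht]

theorem upperSqrt_of_nonpos {t : ℝ} (ht : t ≤ 0) : upperSqrt t = (√(-t) : ℂ) * Complex.I := by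
  have h : (|t| - t) / 2 = -t := by rw [abs_of_nonpos ht]; ring
  have h' : (|t| + t) / 2 = 0 := by rw [abs_of_nonpos ht]; ring
  rw [upperSqrt, Complex.ofReal_re, Complex.norm_real, Real.norm_eq_abs, h, h']
  simp

/-- The root of `Δ² - 4` on the closed upper half plane. -/
def upperRoot (x : Phase N) (z : ℂ) : ℂ :=
  (((∏ n, x.2 n)⁻¹ : ℝ) : ℂ) * ∏ j ∈ Finset.range (2 * N), upperSqrt (z - lam x (j + 1))

theorem continuous_upperRoot (x : Phase N) : Continuous (upperRoot x) := by
  unfold upperRoot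
  exact continuous_const.mul (continuous_finsetProd _ fun j _ =>
    continuous_upperSqrt.comp (continuous_id.sub continuous_const))

theorem continuousAt_upperRoot (hN : 2 ≤ N) {x : Phase N} (hx : x ∈ phaseSpace N) (z : ℂ) :
    ContinuousAt (fun y => upperRoot y z) x := by
  unfold upperRoot
  refine ContinuousAt.mul ?_ (tendsto_finsetProd _ fun j hj => ?_)
  · have h : ContinuousAt (fun y : Phase N => ∏ n, y.2 n) x := by fun_prop
    exact Complex.continuous_ofReal.continuousAt.comp
      (h.inv₀ (Finset.prod_pos fun n _ => hx n).ne')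
  · have hj := Finset.mem_range.1 hj
    have h := continuousAt_lam hN hx (j := j + 1) (by omega) (by omega)
    exact continuous_upperSqrt.continuousAt.comp
      (continuousAt_const.sub (Complex.continuous_ofReal.continuousAt.comp h))

/-- The zeros are real, so every factor `z - λ_j` stays in the closed upper half plane. -/
theorem upperRoot_sq (hN : 2 ≤ N) {x : Phase N} (hx : x ∈ phaseSpace N) {z : ℂ} (hz : 0 ≤ z.im) :
    upperRoot x z ^ 2 = Polynomial.aeval z (discriminant x) ^ 2 - 4 := by
  rw [aeval_spectralPoly hN hx, upperRoot, mul_pow, ← Finset.prod_pow, Complex.ofReal_pow]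
  congr 1
  refine Finset.prod_congr rfl fun j _ => upperSqrt_sq ?_
  simpa using hz

theorem eval_spectralPoly_nonpos (hN : 2 ≤ N) {x : Phase N} (hx : x ∈ phaseSpace N) {m : ℕ}
    (hm : m < N) {t : ℝ} (h1 : lam x (2 * m + 1) ≤ t) (h2 : t ≤ lam x (2 * m + 2)) :
    (discriminant x).eval t ^ 2 - 4 ≤ 0 := by
  rw [eval_spectralPoly hN hx,
    ← Finset.prod_range_mul_prod_Ico _ (show 2 * m + 1 ≤ 2 * N by omega),
    prod_sub_eq_neg_one_pow (Finset.Ico _ _), Nat.card_Ico,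
    (show Odd (2 * N - (2 * m + 1)) from ⟨N - m - 1, by omega⟩).neg_one_pow]
  have hA : 0 ≤ ∏ j ∈ Finset.range (2 * m + 1), (t - lam x (j + 1)) := by
    refine Finset.prod_nonneg fun j hj => sub_nonneg.2 ((lam_mono hN hx ?_ ?_ ?_).trans h1)
    all_goals
      have := Finset.mem_range.1 hj
      omega
  have hB : 0 ≤ ∏ j ∈ Finset.Ico (2 * m + 1) (2 * N), (lam x (j + 1) - t) := by
    refine Finset.prod_nonneg fun j hj => sub_nonneg.2 (h2.trans (lam_mono hN hx ?_ ?_ ?_))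
    all_goals
      have := Finset.mem_Ico.1 hj
      omega
  nlinarith [mul_nonneg (leadingCoeff_pos hx).le (mul_nonneg hA hB)]

theorem exists_band_of_notMem_cuts {x : Phase N} {t : ℝ} (ht : (t : ℂ) ∉ cuts x) :
    ∃ m < N, lam x (2 * m + 1) ≤ t ∧ t ≤ lam x (2 * m + 2) := by
  simp only [cuts, Set.mem_ofPred_eq, Complex.ofReal_im, Complex.ofReal_re, true_and, not_or,
    not_lt, not_exists, not_and] at ht
  obtain ⟨h1, h2, h3⟩ := ht
  have key : ∀ k, k + 1 ≤ N → t ≤ lam x (2 * k + 2) →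
      ∃ m < k + 1, lam x (2 * m + 1) ≤ t ∧ t ≤ lam x (2 * m + 2) := by
    intro k
    induction k with
    | zero => exact fun _ h => ⟨0, one_pos, h1, h⟩
    | succ k ih =>
      intro hk h
      by_cases h4 : lam x (2 * (k + 1) + 1) ≤ t
      · exact ⟨k + 1, by omega, h4, h⟩
      · have h5 : t ≤ lam x (2 * k + 2) := by
          by_contra h6
          exact absurd (not_le.1 h4) (not_lt.2 (h3 (k + 1) (by omega) (by omega) (not_le.1 h6)))
        obtain ⟨m, hm, h⟩ := ih (by omega) h5
        exact ⟨m, by omega, h⟩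
  have hN := Nat.pos_of_ne_zero (NeZero.ne N)
  obtain ⟨m, hm, h⟩ := key (N - 1) (by omega) (by rwa [show 2 * (N - 1) + 2 = 2 * N by omega])
  exact ⟨m, by omega, h⟩

theorem aeval_ofReal (p : ℝ[X]) (t : ℝ) : Polynomial.aeval (t : ℂ) p = ((p.eval t : ℝ) : ℂ) :=
  Polynomial.aeval_algebraMap_apply_eq_algebraMap_eval (A := ℂ) t p

theorem aeval_conj (p : ℝ[X]) (z : ℂ) :
    Polynomial.aeval (starRingEnd ℂ z) p = starRingEnd ℂ (Polynomial.aeval z p) :=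
  Polynomial.aeval_conj p z

/-- The canonical root, by gluing along the real axis. -/
def gluedRoot (x : Phase N) (z : ℂ) : ℂ :=
  if 0 ≤ z.im then upperRoot x z else -starRingEnd ℂ (upperRoot x (starRingEnd ℂ z))

/-- A real point off the cuts lies in a closed band. There `Δ² - 4 ≤ 0`, so the root `w` is purely
imaginary and `-conj w = w`: the two halves agree on the bands and glue continuously. -/
theorem isCanonicalRoot_gluedRoot (hN : 2 ≤ N) {x : Phase N} (hx : x ∈ phaseSpace N) :
    IsCanonicalRoot x (gluedRoot x) where
  continuousOn := by
    unfold gluedRoot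
    refine ContinuousOn.if ?_ (continuous_upperRoot x).continuousOn
      (Complex.continuous_conj.comp ((continuous_upperRoot x).comp
        Complex.continuous_conj)).neg.continuousOn
    rintro z ⟨hz, hz'⟩
    rw [Complex.frontier_setOfPred_le_im] at hz'
    obtain ⟨t, rfl⟩ : ∃ t : ℝ, z = t := ⟨z.re, Complex.ext rfl (by simpa using hz')⟩
    obtain ⟨m, hm, h1, h2⟩ := exists_band_of_notMem_cuts hz
    have hE := eval_spectralPoly_nonpos hN hx hm h1 h2
    have hsq := upperRoot_sq hN hx (z := (t : ℂ)) (by simp)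
    rw [aeval_ofReal] at hsq
    rw [Complex.conj_ofReal]
    generalize upperRoot x t = w at hsq
    have hre := congrArg Complex.re hsq
    have him := congrArg Complex.im hsq
    norm_cast at hre him
    simp [pow_two] at hre him
    have hre0 : w.re = 0 := by
      by_contra h
      have h' : w.im = 0 := by
        have : w.re * w.im = 0 := by linarith
        exact (mul_eq_zero.1 this).resolve_left h
      rw [h'] at hre
      have : 0 < w.re * w.re := mul_self_pos.2 h
      nlinarith
    apply Complex.ext <;> simp [hre0]
  sq_eq z _ := by
    rw [gluedRoot]
    split_ifs with h
    · exact upperRoot_sq hN hx h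
    · have := congrArg (starRingEnd ℂ) (upperRoot_sq hN hx (z := starRingEnd ℂ z)
        (by simp only [Complex.conj_im]; linarith [not_le.1 h]))
      rw [aeval_conj] at this
      simpa [map_ofNat (starRingEnd ℂ) 4] using this
  sign t ht := by
    obtain ⟨n, hn⟩ : ∃ n, N = n + 1 := ⟨N - 1, by omega⟩
    have h1 : 2 * N = 2 * n + 1 + 1 := by omega
    rw [h1, show 2 * n + 1 + 1 - 1 = 2 * n + 1 by omega] at ht
    refine ⟨(∏ n, x.2 n)⁻¹ * ((∏ j ∈ Finset.range (2 * n + 1), √(t - lam x (j + 1))) *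
      √(lam x (2 * n + 1 + 1) - t)), ?_, ?_⟩
    · refine mul_pos (inv_pos.2 (Finset.prod_pos fun n _ => hx n)) (mul_pos
        (Finset.prod_pos fun j hj => Real.sqrt_pos.2 (sub_pos.2 ?_))
        (Real.sqrt_pos.2 (sub_pos.2 ht.2)))
      have := Finset.mem_range.1 hj
      exact (lam_mono hN hx (by omega) (by omega) (by omega)).trans_lt ht.1
    -- On the last band only the last factor has a negative argument, so the product has exactly one
    -- factor `i`.
    · rw [gluedRoot, if_pos (by simp), upperRoot, h1, Finset.prod_range_succ,
        ← Complex.ofReal_sub t (lam x (2 * n + 1 + 1)),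
        upperSqrt_of_nonpos (sub_nonpos.2 ht.2.le), neg_sub]
      have : ∏ j ∈ Finset.range (2 * n + 1), upperSqrt (t - lam x (j + 1)) =
          ∏ j ∈ Finset.range (2 * n + 1), (√(t - lam x (j + 1)) : ℂ) := by
        refine Finset.prod_congr rfl fun j hj => ?_
        have := Finset.mem_range.1 hj
        rw [← Complex.ofReal_sub, upperSqrt_of_nonneg (sub_nonneg.2
          ((lam_mono hN hx (by omega) (by omega) (by omega)).trans_lt ht.1).le)]
      rw [this]
      push_cast
      linear_combination (-((∏ n, (x.2 n : ℂ))⁻¹ * ((∏ j ∈ Finset.range (2 * n + 1),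
        (√(t - lam x (j + 1)) : ℂ)) * (√(lam x (2 * n + 1 + 1) - t) : ℂ)))) * Complex.I_sq

theorem isCanonicalRoot_canonicalRoot (hN : 2 ≤ N) {x : Phase N} (hx : x ∈ phaseSpace N) :
    IsCanonicalRoot x (canonicalRoot x) :=
  Classical.epsilon_spec ⟨_, isCanonicalRoot_gluedRoot hN hx⟩

/-! ### The domain of holomorphy -/

/-- The complement in `ℂ` of the closures of the cuts. -/
def bandDomain (x : Phase N) : Set ℂ :=
  {z | z.im ≠ 0 ∨ ∃ m < N, lam x (2 * m + 1) < z.re ∧ z.re < lam x (2 * m + 2)}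

theorem isOpen_bandDomain (x : Phase N) : IsOpen (bandDomain x) := by
  have : bandDomain x = {z : ℂ | z.im ≠ 0} ∪
      ⋃ m, ⋃ (_ : m < N), {z : ℂ | lam x (2 * m + 1) < z.re} ∩ {z : ℂ | z.re < lam x (2 * m + 2)} := by
    ext z
    simp [bandDomain, and_left_comm]
  rw [this]
  refine (isOpen_ne_fun Complex.continuous_im continuous_const).union
    (isOpen_iUnion fun m => isOpen_iUnion fun _ => ?_)
  exact (isOpen_lt continuous_const Complex.continuous_re).inter
    (isOpen_lt Complex.continuous_re continuous_const)

theorem aeval_ne_zero_of_mem_bandDomain (hN : 2 ≤ N) {x : Phase N} (hx : x ∈ phaseSpace N) {z : ℂ}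
    (hz : z ∈ bandDomain x) : Polynomial.aeval z (discriminant x) ^ 2 - 4 ≠ 0 := by
  rw [aeval_spectralPoly hN hx]
  refine mul_ne_zero (Complex.ofReal_ne_zero.2 (leadingCoeff_pos hx).ne')
    (Finset.prod_ne_zero_iff.2 fun j hj h => ?_)
  have hj := Finset.mem_range.1 hj
  rw [sub_eq_zero] at h
  rcases hz with h1 | ⟨m, hm, h1, h2⟩
  · exact h1 (by rw [h, Complex.ofReal_im])
  · rw [h, Complex.ofReal_re] at h1 h2
    rcases le_or_gt (j + 1) (2 * m + 1) with h3 | h3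
    · exact absurd h1 (not_lt.2 (lam_mono hN hx (by omega) h3 (by omega)))
    · exact absurd h2 (not_lt.2 (lam_mono hN hx (by omega) h3 (by omega)))

theorem bandDomain_subset (hN : 2 ≤ N) {x : Phase N} (hx : x ∈ phaseSpace N) :
    bandDomain x ⊆ (cuts x)ᶜ := by
  rintro z hz ⟨h0, hc⟩
  rcases hz with h1 | ⟨m, hm, h1, h2⟩
  · exact h1 h0
  · rcases hc with h3 | h3 | ⟨n, hn, hn', h3, h4⟩
    · exact absurd (h1.trans h3) (not_lt.2 (lam_mono hN hx (by omega) (by omega) (by omega)))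
    · exact absurd (h3.trans h2) (not_lt.2 (lam_mono hN hx (by omega) (by omega) (by omega)))
    · rcases le_or_gt n m with h5 | h5
      · exact absurd (h1.trans h4) (not_lt.2 (lam_mono hN hx (by omega) (by omega) (by omega)))
      · exact absurd (h3.trans h2) (not_lt.2 (lam_mono hN hx (by omega) (by omega) (by omega)))

/-- Each half of the domain lies between an open half plane and its closure, hence is connected, and
the halves meet in the first band. -/
theorem isPreconnected_bandDomain (hN : 2 ≤ N) {x : Phase N} (hx : x ∈ phaseSpace N) :
    IsPreconnected (bandDomain x) := by
  have hU : IsPreconnected (bandDomain x ∩ {z | 0 ≤ z.im}) := by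
    refine IsPreconnected.subset_closure (convex_halfSpace_im_gt 0).isPreconnected ?_ ?_
    · exact fun z hz => ⟨Or.inl (ne_of_gt hz), (show 0 ≤ z.im from le_of_lt hz)⟩
    · rw [Complex.closure_setOfPred_lt_im]
      exact Set.inter_subset_right
  have hL : IsPreconnected (bandDomain x ∩ {z | z.im ≤ 0}) := by
    refine IsPreconnected.subset_closure (convex_halfSpace_im_lt 0).isPreconnected ?_ ?_
    · exact fun z hz => ⟨Or.inl (ne_of_lt hz), (show z.im ≤ 0 from le_of_lt hz)⟩
    · rw [Complex.closure_setOfPred_im_lt]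
      exact Set.inter_subset_right
  obtain ⟨t, h1, h2⟩ := exists_between (lam_strict hN hx (m := 0) (by omega))
  have ht : (t : ℂ) ∈ bandDomain x := Or.inr ⟨0, by omega, by simpa using h1, by simpa using h2⟩
  have := IsPreconnected.union (t : ℂ) (s := bandDomain x ∩ {z | 0 ≤ z.im})
    (t := bandDomain x ∩ {z | z.im ≤ 0}) ⟨ht, by simp⟩ ⟨ht, by simp⟩ hU hL
  rw [← Set.inter_union_distrib_left] at this
  convert this using 1
  refine (Set.inter_eq_left.2 fun z _ => ?_).symm
  exact le_total 0 z.im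

/-- Two continuous roots of a nonvanishing function on a connected set agree once they agree at one
point, here in the last band. So the choice hidden in `canonicalRoot` does not matter on this
domain. -/
theorem IsCanonicalRoot.eqOn (hN : 2 ≤ N) {x : Phase N} (hx : x ∈ phaseSpace N) {f g : ℂ → ℂ}
    (hf : IsCanonicalRoot x f) (hg : IsCanonicalRoot x g) : Set.EqOn f g (bandDomain x) := by
  have hsub := bandDomain_subset hN hx
  have hsq : Set.EqOn (f ^ 2) (g ^ 2) (bandDomain x) := fun z hz => by
    simp only [Pi.pow_apply, hf.sq_eq z (hsub hz), hg.sq_eq z (hsub hz)]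
  have hg0 : ∀ {z}, z ∈ bandDomain x → g z ≠ 0 := fun {z} hz h => by
    have := hg.sq_eq z (hsub hz)
    rw [h] at this
    exact aeval_ne_zero_of_mem_bandDomain hN hx hz (by rw [← this]; simp)
  have hs := lam_strict hN hx (m := N - 1) (by omega)
  rw [show 2 * (N - 1) + 1 = 2 * N - 1 by omega, show 2 * (N - 1) + 2 = 2 * N by omega] at hs
  obtain ⟨t, ht⟩ := exists_between hs
  have htm : (t : ℂ) ∈ bandDomain x := Or.inr ⟨N - 1, by omega, by
    rw [show 2 * (N - 1) + 1 = 2 * N - 1 by omega, show 2 * (N - 1) + 2 = 2 * N by omega]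
    simpa using ht⟩
  refine (isPreconnected_bandDomain hN hx).eq_of_sq_eq (hf.continuousOn.mono hsub)
    (hg.continuousOn.mono hsub) hsq hg0 htm ?_
  obtain ⟨r, hr, hr'⟩ := hf.sign t ht
  obtain ⟨s, hs, hs'⟩ := hg.sign t ht
  have h1 := congrArg (fun w => w ^ 2) hr'
  have h2 := congrArg (fun w => w ^ 2) hs'
  have h3 : f t ^ 2 = g t ^ 2 := hsq htm
  simp only [mul_pow, h3] at h1 h2
  rw [h1] at h2
  norm_cast at h2
  have h4 : r = s := (sq_eq_sq₀ hr.le hs.le).1 h2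
  rw [h4, ← hs'] at hr'
  exact mul_left_cancel₀ (neg_ne_zero.2 Complex.I_ne_zero) hr'

theorem canonicalRoot_eq_upperRoot (hN : 2 ≤ N) {x : Phase N} (hx : x ∈ phaseSpace N) {z : ℂ}
    (hz : 0 < z.im) : canonicalRoot x z = upperRoot x z := by
  rw [(isCanonicalRoot_canonicalRoot hN hx).eqOn hN hx (isCanonicalRoot_gluedRoot hN hx)
    (Or.inl hz.ne'), gluedRoot, if_pos hz.le]

/-- The reflected function `-conj f(conj z)` again satisfies the defining conditions, so uniqueness
applies. -/
theorem canonicalRoot_conj (hN : 2 ≤ N) {x : Phase N} (hx : x ∈ phaseSpace N) {z : ℂ}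
    (hz : z ∈ bandDomain x) :
    canonicalRoot x (starRingEnd ℂ z) = -starRingEnd ℂ (canonicalRoot x z) := by
  have hf := isCanonicalRoot_canonicalRoot hN hx
  have hc : ∀ {w}, w ∈ (cuts x)ᶜ → starRingEnd ℂ w ∈ (cuts x)ᶜ := fun {w} hw => by
    simpa [cuts] using hw
  have hg : IsCanonicalRoot x fun w => -starRingEnd ℂ (canonicalRoot x (starRingEnd ℂ w)) := by
    refine ⟨?_, fun w hw => ?_, fun t ht => ?_⟩
    · exact (Complex.continuous_conj.comp_continuousOn (hf.continuousOn.comp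
        Complex.continuous_conj.continuousOn fun w hw => hc hw)).neg
    · have := congrArg (starRingEnd ℂ) (hf.sq_eq _ (hc hw))
      rw [aeval_conj] at this
      simpa [map_ofNat (starRingEnd ℂ) 4] using this
    · obtain ⟨r, hr, h⟩ := hf.sign t ht
      refine ⟨r, hr, ?_⟩
      have := congrArg (starRingEnd ℂ) h
      simp only [map_mul, map_neg, Complex.conj_I, neg_neg, Complex.conj_ofReal] at this
      rw [Complex.conj_ofReal, ← this]
      ring
  have := hf.eqOn hN hx hg hz
  rw [this]
  simp

theorem canonicalRoot_ne_zero (hN : 2 ≤ N) {x : Phase N} (hx : x ∈ phaseSpace N) {z : ℂ}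
    (hz : z ∈ bandDomain x) : canonicalRoot x z ≠ 0 := fun h => by
  have := (isCanonicalRoot_canonicalRoot hN hx).sq_eq z (bandDomain_subset hN hx hz)
  rw [h] at this
  exact aeval_ne_zero_of_mem_bandDomain hN hx hz (by rw [← this]; simp)

/-- The difference quotient of `f` is that of `g = f²` divided by `f(w) + f(z)`, which tends to `2
f(z) ≠ 0`. -/
theorem hasDerivAt_of_sq_eq {f g : ℂ → ℂ} {g' z : ℂ} (hf : ContinuousAt f z) (h0 : f z ≠ 0)
    (hsq : ∀ᶠ w in nhds z, f w ^ 2 = g w) (hg : HasDerivAt g g' z) :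
    HasDerivAt f (g' / (2 * f z)) z := by
  rw [hasDerivAt_iff_tendsto_slope] at hg ⊢
  have h2 : f z + f z ≠ 0 := by rw [← two_mul]; exact mul_ne_zero two_ne_zero h0
  have hsum : Filter.Tendsto (fun w => f w + f z) (nhds z) (nhds (f z + f z)) :=
    hf.tendsto.add_const _
  have h3 := hg.div (hsum.mono_left nhdsWithin_le_nhds) h2
  rw [two_mul]
  refine h3.congr' ?_
  filter_upwards [(hsum.eventually_ne h2).filter_mono nhdsWithin_le_nhds,
    hsq.filter_mono nhdsWithin_le_nhds] with w hw hw'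
  rw [Pi.div_apply, slope_def_field, slope_def_field, ← hw', ← hsq.self_of_nhds, div_div,
    mul_comm (w - z), ← div_div]
  congr 1
  rw [div_eq_iff hw]
  ring

theorem hasDerivAt_canonicalRoot (hN : 2 ≤ N) {x : Phase N} (hx : x ∈ phaseSpace N) {z : ℂ}
    (hz : z ∈ bandDomain x) :
    HasDerivAt (canonicalRoot x) (Polynomial.aeval z (discriminant x) *
      Polynomial.aeval z (discriminant x).derivative / canonicalRoot x z) z := by
  have hf := isCanonicalRoot_canonicalRoot hN hx
  have hsub := bandDomain_subset hN hx
  have hmem := (isOpen_bandDomain x).mem_nhds hz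
  have h := hasDerivAt_of_sq_eq ((hf.continuousOn.mono hsub).continuousAt hmem)
    (canonicalRoot_ne_zero hN hx hz) (Filter.mem_of_superset hmem fun w hw => hf.sq_eq w (hsub hw))
    ((((discriminant x).hasDerivAt_aeval z).fun_pow 2).sub_const 4)
  convert h using 1
  have := canonicalRoot_ne_zero hN hx hz
  field_simp
  push_cast
  ring

/-! ### Deformation of contours -/

/-- Pull `g dz` back by the linear homotopy `H(s, θ)`. The result is a closed form on the rectangle,
so Green's theorem applies, and the sides `θ = a` and `θ = b` cancel since the curves are closed.
The second derivatives of the curves enter because `∂H/∂θ` is differentiated once more. -/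
theorem integral_eq_of_linear_homotopy {V : Set ℂ} (hV : IsOpen V) {g : ℂ → ℂ}
    (hg : DifferentiableOn ℂ g V) {a b : ℝ} {e₀ e₁ d₀ d₁ c₀ c₁ : ℝ → ℂ}
    (he₀ : ∀ θ, HasDerivAt e₀ (d₀ θ) θ) (he₁ : ∀ θ, HasDerivAt e₁ (d₁ θ) θ)
    (hd₀ : ∀ θ, HasDerivAt d₀ (c₀ θ) θ) (hd₁ : ∀ θ, HasDerivAt d₁ (c₁ θ) θ)
    (hp₀ : e₀ a = e₀ b) (hp₁ : e₁ a = e₁ b)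
    (hmem : ∀ s ∈ Set.Icc (0 : ℝ) 1, ∀ θ, e₀ θ + s * (e₁ θ - e₀ θ) ∈ V) :
    ∫ θ in a..b, d₀ θ * g (e₀ θ) = ∫ θ in a..b, d₁ θ * g (e₁ θ) := by
  set H : ℝ × ℝ → ℂ := fun p => e₀ p.2 + p.1 * (e₁ p.2 - e₀ p.2) with hH
  set K : ℝ × ℝ → ℂ := fun p => d₀ p.2 + p.1 * (d₁ p.2 - d₀ p.2) with hK
  have hfst : ∀ p : ℝ × ℝ, HasFDerivAt (fun q : ℝ × ℝ => (q.1 : ℂ))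
      (Complex.ofRealCLM.comp (ContinuousLinearMap.fst ℝ ℝ ℝ)) p := fun p =>
    (Complex.ofRealCLM.comp (ContinuousLinearMap.fst ℝ ℝ ℝ)).hasFDerivAt
  have hsnd : ∀ {e : ℝ → ℂ} {e' : ℂ} {p : ℝ × ℝ}, HasDerivAt e e' p.2 →
      HasFDerivAt (fun q : ℝ × ℝ => e q.2)
        ((ContinuousLinearMap.toSpanSingleton ℝ e').comp (ContinuousLinearMap.snd ℝ ℝ ℝ)) p :=
    fun {e e' p} h => h.hasFDerivAt.comp p hasFDerivAt_snd
  have hHd := fun p : ℝ × ℝ => (hsnd (he₀ p.2)).fun_add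
    ((hfst p).mul ((hsnd (he₁ p.2)).fun_sub (hsnd (he₀ p.2))))
  have hKd := fun p : ℝ × ℝ => (hsnd (hd₀ p.2)).fun_add
    ((hfst p).mul ((hsnd (hd₁ p.2)).fun_sub (hsnd (hd₀ p.2))))
  have hSd := fun p : ℝ × ℝ => (hsnd (he₁ p.2)).fun_sub (hsnd (he₀ p.2))
  have hgd : ∀ p : ℝ × ℝ, p.1 ∈ Set.Icc (0 : ℝ) 1 →
      HasDerivAt g (deriv g (H p)) (H p) := fun p hp =>
    ((hg _ (hmem _ hp _)).differentiableAt (hV.mem_nhds (hmem _ hp _))).hasDerivAt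
  have hgH := fun (p : ℝ × ℝ) hp => (hgd p hp).comp_hasFDerivAt p (hHd p)
  have hF := fun (p : ℝ × ℝ) hp => (hKd p).mul (hgH p hp)
  have hG := fun (p : ℝ × ℝ) hp => ((hSd p).mul (hgH p hp)).fun_neg
  have hmem' : ∀ p : ℝ × ℝ, p ∈ Set.uIcc (0 : ℝ) 1 ×ˢ Set.uIcc a b → p.1 ∈ Set.Icc (0 : ℝ) 1 :=
    fun p hp => by simpa using hp.1
  have hmem'' : ∀ p : ℝ × ℝ,
      p ∈ Set.Ioo (min (0 : ℝ) 1) (max 0 1) ×ˢ Set.Ioo (min a b) (max a b) →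
      p.1 ∈ Set.Icc (0 : ℝ) 1 := fun p hp => Set.Ioo_subset_Icc_self (by simpa using hp.1)
  have hdiv := MeasureTheory.integral2_divergence_prod_of_hasFDerivAt _ _ _ _ 0 a 1 b
    (fun p hp => (hF p (hmem' p hp)).continuousAt.continuousWithinAt)
    (fun p hp => (hG p (hmem' p hp)).continuousAt.continuousWithinAt)
    (fun p hp => hF p (hmem'' p hp)) (fun p hp => hG p (hmem'' p hp)) ?_
  · have hR := hdiv.symm.trans (show _ = (0 : ℂ) from by
      refine (intervalIntegral.integral_congr (g := fun _ => (0 : ℂ)) fun s _ => ?_).trans (by simp)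
      refine (intervalIntegral.integral_congr (g := fun _ => (0 : ℂ)) fun θ _ => ?_).trans (by simp)
      simp
      ring)
    simp [H, hp₀, hp₁] at hR
    exact (sub_eq_zero.1 hR).symm
  · refine MeasureTheory.integrableOn_zero.congr_fun (fun p _ => ?_)
      (measurableSet_uIcc.prod measurableSet_uIcc)
    simp
    ring

/-- The ellipse `θ ↦ τ + A cos θ + i B sin θ`. -/
def ellipse (τ A B θ : ℝ) : ℂ := τ + A * Complex.cos θ + Complex.I * (B * Complex.sin θ)

/-- The velocity of the ellipse. -/
def ellipseDeriv (A B θ : ℝ) : ℂ := -(A * Complex.sin θ) + Complex.I * (B * Complex.cos θ)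

theorem hasDerivAt_ellipse (τ A B θ : ℝ) :
    HasDerivAt (ellipse τ A B) (ellipseDeriv A B θ) θ := by
  have hc := (Complex.hasDerivAt_cos (θ : ℂ)).comp_ofReal
  have hs := (Complex.hasDerivAt_sin (θ : ℂ)).comp_ofReal
  refine (((hc.const_mul (A : ℂ)).const_add (τ : ℂ)).fun_add
    ((hs.const_mul (B : ℂ)).const_mul Complex.I)).congr_deriv ?_
  rw [ellipseDeriv]
  ring

theorem hasDerivAt_ellipseDeriv (A B θ : ℝ) :
    HasDerivAt (ellipseDeriv A B) (-(ellipse 0 A B θ)) θ := by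
  have hc := (Complex.hasDerivAt_cos (θ : ℂ)).comp_ofReal
  have hs := (Complex.hasDerivAt_sin (θ : ℂ)).comp_ofReal
  refine ((hs.const_mul (A : ℂ)).fun_neg.fun_add
    ((hc.const_mul (B : ℂ)).const_mul Complex.I)).congr_deriv ?_
  rw [ellipse]
  push_cast
  ring

theorem ellipse_re (τ A B θ : ℝ) : (ellipse τ A B θ).re = τ + A * Real.cos θ := by
  simp [ellipse, ← Complex.ofReal_cos, ← Complex.ofReal_sin]

theorem ellipse_im (τ A B θ : ℝ) : (ellipse τ A B θ).im = B * Real.sin θ := by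
  simp [ellipse, ← Complex.ofReal_cos, ← Complex.ofReal_sin]

theorem ellipse_eq_circleMap (τ R θ : ℝ) : ellipse τ R R θ = circleMap τ R θ := by
  rw [circleMap, ellipse, Complex.exp_mul_I]
  ring

theorem circleIntegral_eq_ellipse (τ R : ℝ) (g : ℂ → ℂ) :
    (∮ z in C(τ, R), g z) =
      ∫ θ in (0 : ℝ)..2 * Real.pi, ellipseDeriv R R θ * g (ellipse τ R R θ) := by
  rw [circleIntegral]
  refine intervalIntegral.integral_congr fun θ _ => ?_
  simp only [smul_eq_mul, ellipse_eq_circleMap]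
  congr 1
  rw [deriv_circleMap, circleMap_zero, ellipseDeriv, Complex.exp_mul_I]
  linear_combination (R * Complex.sin θ) * Complex.I_sq

/-- The ellipse crosses the real axis in the bands adjacent to the `n`-th gap. -/
structure Encloses (x : Phase N) (n : ℕ) (τ A B : ℝ) : Prop where
  pos : 0 < B
  left_lt : lam x (2 * n - 1) < τ - A
  lt_left : τ - A < lam x (2 * n)
  right_lt : lam x (2 * n + 1) < τ + A
  lt_right : τ + A < lam x (2 * n + 2)

theorem Encloses.mem_bandDomain {x : Phase N} {n : ℕ} (hn : 1 ≤ n) (hn' : n < N) {τ A B : ℝ}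
    (h : Encloses x n τ A B) (θ : ℝ) : ellipse τ A B θ ∈ bandDomain x := by
  by_cases hs : Real.sin θ = 0
  · right
    rw [ellipse_re]
    rcases (Real.sin_eq_zero_iff_cos_eq).1 hs with hc | hc
    · refine ⟨n, hn', ?_, ?_⟩ <;> rw [hc] <;> linarith [h.right_lt, h.lt_right]
    · refine ⟨n - 1, by omega, ?_, ?_⟩ <;> rw [hc]
      · rw [show 2 * (n - 1) + 1 = 2 * n - 1 by omega]
        linarith [h.left_lt]
      · rw [show 2 * (n - 1) + 2 = 2 * n by omega]
        linarith [h.lt_left]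
  · left
    rw [ellipse_im]
    exact mul_ne_zero h.pos.ne' hs

/-- The linear homotopy between two such ellipses runs through ellipses, and the enclosing
conditions are convex in the parameters. -/
theorem Encloses.integral_eq {x : Phase N} {n : ℕ} (hn : 1 ≤ n) (hn' : n < N)
    {τ A B τ' A' B' : ℝ} (h : Encloses x n τ A B) (h' : Encloses x n τ' A' B') {g : ℂ → ℂ}
    (hg : DifferentiableOn ℂ g (bandDomain x)) :
    ∫ θ in (0 : ℝ)..2 * Real.pi, ellipseDeriv A B θ * g (ellipse τ A B θ) =
      ∫ θ in (0 : ℝ)..2 * Real.pi, ellipseDeriv A' B' θ * g (ellipse τ' A' B' θ) := by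
  refine integral_eq_of_linear_homotopy (isOpen_bandDomain x) hg (hasDerivAt_ellipse τ A B)
    (hasDerivAt_ellipse τ' A' B') (hasDerivAt_ellipseDeriv A B) (hasDerivAt_ellipseDeriv A' B')
    (by simp [ellipse]) (by simp [ellipse]) fun s hs θ => ?_
  have e : ellipse τ A B θ + s * (ellipse τ' A' B' θ - ellipse τ A B θ) =
      ellipse ((1 - s) * τ + s * τ') ((1 - s) * A + s * A') ((1 - s) * B + s * B') θ := by
    simp only [ellipse]
    push_cast
    ring
  rw [e]
  obtain ⟨hs0, hs1⟩ := hs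
  have hconv : ∀ {u v w : ℝ}, u < w → v < w → (1 - s) * u + s * v < w := by
    intro u v w hu hv
    rcases hs0.eq_or_lt with h0 | h0
    · rw [← h0]; linarith
    · nlinarith
  have hconv' : ∀ {u v w : ℝ}, w < u → w < v → w < (1 - s) * u + s * v := by
    intro u v w hu hv
    have := hconv (neg_lt_neg hu) (neg_lt_neg hv)
    linarith
  refine Encloses.mem_bandDomain hn hn' ⟨hconv' h.pos h'.pos, ?_, ?_, ?_, ?_⟩ θ
  · linarith [hconv' h.left_lt h'.left_lt]
  · linarith [hconv h.lt_left h'.lt_left]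
  · linarith [hconv' h.right_lt h'.right_lt]
  · linarith [hconv h.lt_right h'.lt_right]

theorem contour_encloses (hN : 2 ≤ N) {x : Phase N} (hx : x ∈ phaseSpace N) {n : ℕ} (hn : 1 ≤ n)
    (hn' : n < N) :
    Encloses x n (contourCenter x n) (contourRadius x n) (contourRadius x n) := by
  have h1 := lam_strict hN hx (m := n - 1) (by omega)
  have h2 := lam_strict hN hx (m := n) hn'
  rw [show 2 * (n - 1) + 1 = 2 * n - 1 by omega, show 2 * (n - 1) + 2 = 2 * n by omega] at h1
  have h3 := lam_mono hN hx (i := 2 * n) (j := 2 * n + 1) (by omega) (by omega) (by omega)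
  have h4 := min_le_left (lam x (2 * n) - lam x (2 * n - 1)) (lam x (2 * n + 2) - lam x (2 * n + 1))
  have h5 := min_le_right (lam x (2 * n) - lam x (2 * n - 1))
    (lam x (2 * n + 2) - lam x (2 * n + 1))
  have h6 := lt_min (sub_pos.2 h1) (sub_pos.2 h2)
  constructor <;> rw [contourRadius] <;> try rw [contourCenter]
  all_goals linarith

/-- Conjugation reflects the circle and reverses its orientation; the sign this causes is cancelled
by the one in the hypothesis. -/
theorem conj_circleIntegral {τ R : ℝ} {g : ℂ → ℂ}
    (hg : ∀ θ : ℝ, g (starRingEnd ℂ (circleMap τ R θ)) = -starRingEnd ℂ (g (circleMap τ R θ))) :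
    starRingEnd ℂ (∮ z in C(τ, R), g z) = ∮ z in C(τ, R), g z := by
  have hcm : ∀ θ : ℝ, starRingEnd ℂ (circleMap τ R θ) = circleMap τ R (-θ) := by
    intro θ
    simp [circleMap, ← Complex.exp_conj]
  have hper : Function.Periodic (fun θ : ℝ => deriv (circleMap τ R) θ • g (circleMap τ R θ))
      (2 * Real.pi) := by
    intro θ
    simp only [deriv_circleMap, periodic_circleMap _ _ θ]
  rw [circleIntegral, ← intervalIntegral.intervalIntegral_conj]
  have h1 : ∀ θ : ℝ, starRingEnd ℂ (deriv (circleMap τ R) θ • g (circleMap τ R θ)) =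
      deriv (circleMap τ R) (-θ) • g (circleMap τ R (-θ)) := by
    intro θ
    rw [← hcm, hg, deriv_circleMap, deriv_circleMap]
    simp [circleMap, ← Complex.exp_conj]
  simp only [h1]
  rw [intervalIntegral.integral_comp_neg
    fun θ => deriv (circleMap τ R) θ • g (circleMap τ R θ)]
  have := hper.intervalIntegral_add_eq (-(2 * Real.pi)) 0
  simpa using this

/-! ### Periods of the differentials `q dλ / √(Δ² - 4)` -/

theorem complex_sqrt_sq (z : ℂ) : Complex.sqrt z ^ 2 = z := by
  simp [Complex.sqrt]

theorem differentiableOn_div_canonicalRoot (hN : 2 ≤ N) {x : Phase N} (hx : x ∈ phaseSpace N)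
    {g : ℂ → ℂ} (hg : Differentiable ℂ g) :
    DifferentiableOn ℂ (fun z => g z / canonicalRoot x z) (bandDomain x) := fun z hz =>
  ((hg z).div (hasDerivAt_canonicalRoot hN hx hz).differentiableAt
    (canonicalRoot_ne_zero hN hx hz)).differentiableWithinAt

/-- The vertical strip over the `n`-th gap and its adjacent bands. -/
def gapStrip (x : Phase N) (n : ℕ) : Set ℂ :=
  {z | lam x (2 * n - 1) < z.re ∧ z.re < lam x (2 * n + 2)}

/-- A root of `-(Δ² - 4) / ((z - λ_{2n}) (z - λ_{2n+1}))` on the strip over the `n`-th gap. -/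
def gapRoot (x : Phase N) (n : ℕ) (z : ℂ) : ℂ :=
  (((∏ n, x.2 n)⁻¹ : ℝ) : ℂ) * ((∏ j ∈ Finset.range (2 * n - 1), Complex.sqrt (z - lam x (j + 1))) *
    ∏ j ∈ Finset.Ico (2 * n + 1) (2 * N), Complex.sqrt (lam x (j + 1) - z))

theorem re_pos_of_mem_gapStrip (hN : 2 ≤ N) {x : Phase N} (hx : x ∈ phaseSpace N) {n : ℕ}
    (hn' : n < N) {z : ℂ} (hz : z ∈ gapStrip x n) :
    (∀ j ∈ Finset.range (2 * n - 1), 0 < (z - lam x (j + 1)).re) ∧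
      ∀ j ∈ Finset.Ico (2 * n + 1) (2 * N), 0 < (lam x (j + 1) - z).re := by
  refine ⟨fun j hj => ?_, fun j hj => ?_⟩
  · have := Finset.mem_range.1 hj
    have h := (lam_mono hN hx (i := j + 1) (j := 2 * n - 1) (by omega) (by omega)
      (by omega)).trans_lt hz.1
    simpa using h
  · have := Finset.mem_Ico.1 hj
    have h := hz.2.trans_le (lam_mono hN hx (i := 2 * n + 2) (j := j + 1) (by omega) (by omega)
      (by omega))
    simpa using h

theorem continuousOn_gapRoot (hN : 2 ≤ N) {x : Phase N} (hx : x ∈ phaseSpace N) {n : ℕ}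
    (hn' : n < N) : ContinuousOn (gapRoot x n) (gapStrip x n) := by
  intro z hz
  obtain ⟨h1, h2⟩ := re_pos_of_mem_gapStrip hN hx hn' hz
  refine (ContinuousAt.mul continuousAt_const (ContinuousAt.mul
    (tendsto_finsetProd _ fun j hj => ?_)
    (tendsto_finsetProd _ fun j hj => ?_))).continuousWithinAt
  · exact (Complex.continuousAt_sqrt (Or.inl (h1 j hj).le)).comp (f := fun z => z - _)
      (by fun_prop)
  · exact (Complex.continuousAt_sqrt (Or.inl (h2 j hj).le)).comp (f := fun z => _ - z)
      (by fun_prop)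

theorem gapRoot_ne_zero (hN : 2 ≤ N) {x : Phase N} (hx : x ∈ phaseSpace N) {n : ℕ}
    (hn' : n < N) {z : ℂ} (hz : z ∈ gapStrip x n) : gapRoot x n z ≠ 0 := by
  obtain ⟨h1, h2⟩ := re_pos_of_mem_gapStrip hN hx hn' hz
  have hs : ∀ w : ℂ, 0 < w.re → Complex.sqrt w ≠ 0 := by
    intro w hw h
    have := complex_sqrt_sq w
    rw [h] at this
    rw [← this] at hw
    simp at hw
  refine mul_ne_zero (Complex.ofReal_ne_zero.2
    (inv_ne_zero (Finset.prod_pos fun n _ => hx n).ne')) (mul_ne_zero ?_ ?_)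
  · exact Finset.prod_ne_zero_iff.2 fun j hj => hs _ (h1 j hj)
  · exact Finset.prod_ne_zero_iff.2 fun j hj => hs _ (h2 j hj)

theorem gapRoot_sq (hN : 2 ≤ N) {x : Phase N} (hx : x ∈ phaseSpace N) {n : ℕ} (hn : 1 ≤ n)
    (hn' : n < N) (z : ℂ) :
    Polynomial.aeval z (discriminant x) ^ 2 - 4 =
      -((z - lam x (2 * n)) * (z - lam x (2 * n + 1)) * gapRoot x n z ^ 2) := by
  obtain ⟨k, rfl⟩ : ∃ k, n = k + 1 := ⟨n - 1, by omega⟩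
  rw [aeval_spectralPoly hN hx,
    ← Finset.prod_range_mul_prod_Ico _ (show 2 * (k + 1) + 1 ≤ 2 * N by omega),
    prod_sub_eq_neg_one_pow (Finset.Ico _ _), Nat.card_Ico,
    (show Odd (2 * N - (2 * (k + 1) + 1)) from ⟨N - k - 2, by omega⟩).neg_one_pow, gapRoot,
    mul_pow, mul_pow, ← Finset.prod_pow, ← Finset.prod_pow]
  simp only [complex_sqrt_sq]
  rw [show 2 * (k + 1) + 1 = (2 * k + 1) + 1 + 1 by ring,
    show 2 * (k + 1) - 1 = 2 * k + 1 by omega, show 2 * (k + 1) = 2 * k + 1 + 1 by ring,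
    Finset.prod_range_succ, Finset.prod_range_succ]
  push_cast
  ring

theorem gapRoot_ofReal (hN : 2 ≤ N) {x : Phase N} (hx : x ∈ phaseSpace N) {n : ℕ}
    (hn' : n < N) {t : ℝ} (ht : (t : ℂ) ∈ gapStrip x n) :
    ∃ r : ℝ, 0 < r ∧ gapRoot x n t = r := by
  obtain ⟨h1, h2⟩ := re_pos_of_mem_gapStrip hN hx hn' ht
  have hs : ∀ r : ℝ, 0 < r → Complex.sqrt r = (√r : ℂ) := fun r hr => by
    have := RCLike.sqrt_of_nonneg (𝕜 := ℂ) (a := (r : ℂ)) (by exact_mod_cast hr.le)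
    simpa using this
  refine ⟨(∏ n, x.2 n)⁻¹ * ((∏ j ∈ Finset.range (2 * n - 1), √(t - lam x (j + 1))) *
    ∏ j ∈ Finset.Ico (2 * n + 1) (2 * N), √(lam x (j + 1) - t)), ?_, ?_⟩
  · refine mul_pos (inv_pos.2 (Finset.prod_pos fun n _ => hx n)) (mul_pos
      (Finset.prod_pos fun j hj => Real.sqrt_pos.2 (by simpa using h1 j hj))
      (Finset.prod_pos fun j hj => Real.sqrt_pos.2 (by simpa using h2 j hj)))
  · rw [gapRoot]
    push_cast
    congr 2
    · exact Finset.prod_congr rfl fun j hj => by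
        rw [← Complex.ofReal_sub, hs _ (by simpa using h1 j hj)]
    · exact Finset.prod_congr rfl fun j hj => by
        rw [← Complex.ofReal_sub, hs _ (by simpa using h2 j hj)]

/-- Half the length of the `n`-th gap. -/
def gapHalf (x : Phase N) (n : ℕ) : ℝ := (lam x (2 * n + 1) - lam x (2 * n)) / 2

/-- The ellipse with foci the end points of the `n`-th gap and semi-minor axis `B`. -/
def confocal (x : Phase N) (n : ℕ) (B θ : ℝ) : ℂ :=
  ellipse (contourCenter x n) (√(B ^ 2 + gapHalf x n ^ 2)) B θ

theorem continuous_confocal (x : Phase N) (n : ℕ) :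
    Continuous fun p : ℝ × ℝ => confocal x n p.1 p.2 := by
  unfold confocal ellipse
  fun_prop

/-- With `A² - B² = δ²`, where `δ` is half the gap length, `(e - τ)² - δ² = -(e')²` along the
ellipse `e`. This is why the confocal family is used: the singular factor of the root is the
velocity of the curve. -/
theorem confocal_sq (x : Phase N) (n : ℕ) (B θ : ℝ) :
    (confocal x n B θ - lam x (2 * n)) * (confocal x n B θ - lam x (2 * n + 1)) =
      (-Complex.I * ellipseDeriv (√(B ^ 2 + gapHalf x n ^ 2)) B θ) ^ 2 := by
  have h := Real.sq_sqrt (show 0 ≤ B ^ 2 + gapHalf x n ^ 2 by positivity)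
  have h' : ((√(B ^ 2 + gapHalf x n ^ 2) : ℝ) : ℂ) ^ 2 = B ^ 2 + (gapHalf x n : ℂ) ^ 2 := by
    exact_mod_cast h
  rw [confocal, ellipse, ellipseDeriv]
  generalize ((√(B ^ 2 + gapHalf x n ^ 2) : ℝ) : ℂ) = A at h'
  have e : (contourCenter x n : ℂ) = lam x (2 * n) + gapHalf x n := by
    rw [contourCenter, gapHalf]; push_cast; ring
  have e' : (lam x (2 * n + 1) : ℂ) = lam x (2 * n) + 2 * gapHalf x n := by
    rw [gapHalf]; push_cast; ring
  rw [e, e']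
  have hcs := Complex.sin_sq_add_cos_sq (θ : ℂ)
  have hI := Complex.I_sq
  generalize Complex.sin θ = s at *
  generalize Complex.cos θ = c at *
  generalize Complex.I = i at *
  generalize (gapHalf x n : ℂ) = d at *
  generalize (lam x (2 * n) : ℂ) = l at *
  linear_combination (A ^ 2 - B ^ 2) * hcs + h' +
    (B ^ 2 * s ^ 2 - A ^ 2 * s ^ 2 + 2 * i * A * B * s * c - (i ^ 2 - 1) * B ^ 2 * c ^ 2) * hI

theorem gapHalf_nonneg (hN : 2 ≤ N) {x : Phase N} (hx : x ∈ phaseSpace N) {n : ℕ} (hn : 1 ≤ n)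
    (hn' : n < N) : 0 ≤ gapHalf x n := by
  have := lam_mono hN hx (i := 2 * n) (j := 2 * n + 1) (by omega) (by omega) (by omega)
  rw [gapHalf]
  linarith

theorem lam_eq_center_sub (x : Phase N) (n : ℕ) :
    lam x (2 * n) = contourCenter x n - gapHalf x n := by
  rw [contourCenter, gapHalf]; ring

theorem lam_eq_center_add (x : Phase N) (n : ℕ) :
    lam x (2 * n + 1) = contourCenter x n + gapHalf x n := by
  rw [contourCenter, gapHalf]; ring

/-- The semi-minor axis of the largest ellipse of the confocal family inside the contour `Γ_n`. -/
def confocalMax (x : Phase N) (n : ℕ) : ℝ := √(contourRadius x n ^ 2 - gapHalf x n ^ 2)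

theorem gapHalf_lt_contourRadius (hN : 2 ≤ N) {x : Phase N} (hx : x ∈ phaseSpace N) {n : ℕ}
    (hn : 1 ≤ n) (hn' : n < N) : gapHalf x n < contourRadius x n := by
  have := (contour_encloses hN hx hn hn').right_lt
  rw [lam_eq_center_add] at this
  linarith

theorem confocalMax_pos (hN : 2 ≤ N) {x : Phase N} (hx : x ∈ phaseSpace N) {n : ℕ}
    (hn : 1 ≤ n) (hn' : n < N) : 0 < confocalMax x n :=
  Real.sqrt_pos.2 (by
    nlinarith [gapHalf_nonneg hN hx hn hn', gapHalf_lt_contourRadius hN hx hn hn'])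

theorem sqrt_le_contourRadius (hN : 2 ≤ N) {x : Phase N} (hx : x ∈ phaseSpace N) {n : ℕ}
    (hn : 1 ≤ n) (hn' : n < N) {B : ℝ} (h0 : 0 ≤ B) (h1 : B ≤ confocalMax x n) :
    √(B ^ 2 + gapHalf x n ^ 2) ≤ contourRadius x n := by
  refine Real.sqrt_le_iff.2 ⟨(contour_encloses hN hx hn hn').pos.le, ?_⟩
  have h2 : B ^ 2 ≤ confocalMax x n ^ 2 := by gcongr
  rw [confocalMax, Real.sq_sqrt (by
    nlinarith [gapHalf_nonneg hN hx hn hn', gapHalf_lt_contourRadius hN hx hn hn'])] at h2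
  linarith

theorem confocal_encloses (hN : 2 ≤ N) {x : Phase N} (hx : x ∈ phaseSpace N) {n : ℕ}
    (hn : 1 ≤ n) (hn' : n < N) {B : ℝ} (hB : B ∈ Set.Ioc 0 (confocalMax x n)) :
    Encloses x n (contourCenter x n) (√(B ^ 2 + gapHalf x n ^ 2)) B := by
  have h2 := sqrt_le_contourRadius hN hx hn hn' hB.1.le hB.2
  have h3 : gapHalf x n < √(B ^ 2 + gapHalf x n ^ 2) :=
    Real.lt_sqrt_of_sq_lt (by nlinarith [hB.1])
  have hR := contour_encloses hN hx hn hn'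
  have e1 := lam_eq_center_sub x n
  have e2 := lam_eq_center_add x n
  refine ⟨hB.1, ?_, ?_, ?_, ?_⟩
  · linarith [hR.left_lt]
  · linarith
  · linarith
  · linarith [hR.lt_right]

theorem confocal_mem_gapStrip (hN : 2 ≤ N) {x : Phase N} (hx : x ∈ phaseSpace N) {n : ℕ}
    (hn : 1 ≤ n) (hn' : n < N) {B : ℝ} (hB : B ∈ Set.Icc 0 (confocalMax x n)) (θ : ℝ) :
    confocal x n B θ ∈ gapStrip x n := by
  have hR := contour_encloses hN hx hn hn'
  have h2 := sqrt_le_contourRadius hN hx hn hn' hB.1 hB.2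
  have h3 : 0 ≤ √(B ^ 2 + gapHalf x n ^ 2) := Real.sqrt_nonneg _
  have h4 := Real.neg_one_le_cos θ
  have h5 := Real.cos_le_one θ
  constructor <;> rw [confocal, ellipse_re]
  · nlinarith [hR.left_lt]
  · nlinarith [hR.lt_right]

theorem confocal_mem_bandDomain (hN : 2 ≤ N) {x : Phase N} (hx : x ∈ phaseSpace N) {n : ℕ}
    (hn : 1 ≤ n) (hn' : n < N) {B : ℝ} (hB : B ∈ Set.Ioc 0 (confocalMax x n)) (θ : ℝ) :
    confocal x n B θ ∈ bandDomain x :=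
  (confocal_encloses hN hx hn hn' hB).mem_bandDomain hn hn' θ

theorem ellipseDeriv_confocal_ne_zero (hN : 2 ≤ N) {x : Phase N} (hx : x ∈ phaseSpace N) {n : ℕ}
    (hn : 1 ≤ n) (hn' : n < N) {B : ℝ} (hB : B ∈ Set.Ioc 0 (confocalMax x n)) (θ : ℝ) :
    ellipseDeriv (√(B ^ 2 + gapHalf x n ^ 2)) B θ ≠ 0 := by
  intro h
  have h1 := aeval_ne_zero_of_mem_bandDomain hN hx (confocal_mem_bandDomain hN hx hn hn' hB θ)
  rw [gapRoot_sq hN hx hn hn', confocal_sq, h] at h1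
  simp at h1

theorem canonicalRoot_confocal_sq (hN : 2 ≤ N) {x : Phase N} (hx : x ∈ phaseSpace N) {n : ℕ}
    (hn : 1 ≤ n) (hn' : n < N) {B : ℝ} (hB : B ∈ Set.Ioc 0 (confocalMax x n)) (θ : ℝ) :
    canonicalRoot x (confocal x n B θ) ^ 2 =
      (ellipseDeriv (√(B ^ 2 + gapHalf x n ^ 2)) B θ * gapRoot x n (confocal x n B θ)) ^ 2 := by
  rw [(isCanonicalRoot_canonicalRoot hN hx).sq_eq _
    (bandDomain_subset hN hx (confocal_mem_bandDomain hN hx hn hn' hB θ)),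
    gapRoot_sq hN hx hn hn', confocal_sq, mul_pow, mul_pow, neg_pow_two, Complex.I_sq]
  ring

/-- Both sides have the same square and do not vanish on the connected parameter set, so one sign
`ε` serves the whole family. Consequently `dλ / √(Δ² - 4)` pulls back to `dθ / (ε · gapRoot)`, which
remains regular as the ellipse shrinks onto the gap. -/
theorem canonicalRoot_confocal (hN : 2 ≤ N) {x : Phase N} (hx : x ∈ phaseSpace N) {n : ℕ}
    (hn : 1 ≤ n) (hn' : n < N) : ∃ ε : ℂ, ε ≠ 0 ∧ ∀ B ∈ Set.Ioc 0 (confocalMax x n), ∀ θ,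
      canonicalRoot x (confocal x n B θ) =
        ε * (ellipseDeriv (√(B ^ 2 + gapHalf x n ^ 2)) B θ * gapRoot x n (confocal x n B θ)) := by
  have hc1 : ContinuousOn (fun p : ℝ × ℝ => canonicalRoot x (confocal x n p.1 p.2))
      (Set.Ioc 0 (confocalMax x n) ×ˢ Set.univ) :=
    ((isCanonicalRoot_canonicalRoot hN hx).continuousOn.mono (bandDomain_subset hN hx)).comp
      (continuous_confocal x n).continuousOn
      fun p hp => confocal_mem_bandDomain hN hx hn hn' hp.1 p.2
  have hc2 : ContinuousOn (fun p : ℝ × ℝ => ellipseDeriv (√(p.1 ^ 2 + gapHalf x n ^ 2)) p.1 p.2 *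
      gapRoot x n (confocal x n p.1 p.2)) (Set.Ioc 0 (confocalMax x n) ×ˢ Set.univ) := by
    refine ContinuousOn.mul (Continuous.continuousOn ?_) ((continuousOn_gapRoot hN hx hn').comp
      (continuous_confocal x n).continuousOn
      fun p hp => confocal_mem_gapStrip hN hx hn hn' ⟨hp.1.1.le, hp.1.2⟩ p.2)
    unfold ellipseDeriv
    fun_prop
  rcases ((isPreconnected_Ioc (a := 0) (b := confocalMax x n)).prod
    (isPreconnected_univ (α := ℝ))).eq_or_eq_neg_of_sq_eq hc1 hc2
    (fun p hp => canonicalRoot_confocal_sq hN hx hn hn' hp.1 p.2)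
    (fun {p} hp => mul_ne_zero (ellipseDeriv_confocal_ne_zero hN hx hn hn' hp.1 p.2)
      (gapRoot_ne_zero hN hx hn' (confocal_mem_gapStrip hN hx hn hn' ⟨hp.1.1.le, hp.1.2⟩ p.2)))
    with h | h
  · exact ⟨1, one_ne_zero, fun B hB θ => by
      simpa using h (x := (B, θ)) ⟨hB, Set.mem_univ _⟩⟩
  · exact ⟨-1, by simp, fun B hB θ => by
      simpa using h (x := (B, θ)) ⟨hB, Set.mem_univ _⟩⟩

/-- The pull back of `q / gapRoot` to the confocal family, extended to all parameters. -/
def confocalQuot (x : Phase N) (n : ℕ) (q : ℝ[X]) (B θ : ℝ) : ℂ :=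
  Polynomial.aeval (confocal x n (max 0 (min B (confocalMax x n))) θ) q /
    gapRoot x n (confocal x n (max 0 (min B (confocalMax x n))) θ)

theorem continuous_clamp {f : ℝ → ℝ → ℂ} {M : ℝ} (hM : 0 ≤ M)
    (hf : ContinuousOn (fun p : ℝ × ℝ => f p.1 p.2) (Set.Icc 0 M ×ˢ Set.univ)) :
    Continuous fun p : ℝ × ℝ => f (max 0 (min p.1 M)) p.2 := by
  have hmax : Continuous fun p : ℝ × ℝ => (max 0 (min p.1 M), p.2) := by fun_prop
  exact hf.comp_continuous hmax fun p =>
    ⟨⟨le_max_left _ _, max_le hM (min_le_right _ _)⟩, Set.mem_univ _⟩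

theorem continuous_confocalQuot (hN : 2 ≤ N) {x : Phase N} (hx : x ∈ phaseSpace N) {n : ℕ}
    (hn : 1 ≤ n) (hn' : n < N) (q : ℝ[X]) :
    Continuous (fun p : ℝ × ℝ => confocalQuot x n q p.1 p.2) := by
  have hc : ContinuousOn (fun p : ℝ × ℝ =>
      Polynomial.aeval (confocal x n p.1 p.2) q / gapRoot x n (confocal x n p.1 p.2))
      (Set.Icc 0 (confocalMax x n) ×ˢ Set.univ) := by
    refine ((Polynomial.continuous_aeval (A := ℂ) q).comp
      (continuous_confocal x n)).continuousOn.div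
      ((continuousOn_gapRoot hN hx hn').comp (continuous_confocal x n).continuousOn
      fun p hp => ?_) fun p hp => gapRoot_ne_zero hN hx hn' ?_
    · exact confocal_mem_gapStrip hN hx hn hn' hp.1 _
    · exact confocal_mem_gapStrip hN hx hn hn' hp.1 _
  exact continuous_clamp (f := fun B θ =>
    Polynomial.aeval (confocal x n B θ) q / gapRoot x n (confocal x n B θ))
    (confocalMax_pos hN hx hn hn').le hc

/-- The contour deforms into each nondegenerate confocal ellipse, where the velocity cancels against
the root. -/
theorem integral_confocalQuot_eq_zero (hN : 2 ≤ N) {x : Phase N} (hx : x ∈ phaseSpace N) {n : ℕ}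
    (hn : 1 ≤ n) (hn' : n < N) {q : ℝ[X]}
    (hJ : (∮ z in C((contourCenter x n : ℂ), contourRadius x n),
      Polynomial.aeval z q / canonicalRoot x z) = 0) {B : ℝ}
    (hB : B ∈ Set.Ioc 0 (confocalMax x n)) :
    ∫ θ in (0 : ℝ)..2 * Real.pi, confocalQuot x n q B θ = 0 := by
  obtain ⟨ε, hε, h⟩ := canonicalRoot_confocal hN hx hn hn'
  have hcl : max 0 (min B (confocalMax x n)) = B := by rw [min_eq_left hB.2, max_eq_right hB.1.le]
  rw [circleIntegral_eq_ellipse, (contour_encloses hN hx hn hn').integral_eq hn hn'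
    (confocal_encloses hN hx hn hn' hB) (differentiableOn_div_canonicalRoot hN hx
      (g := fun z => Polynomial.aeval z q) (Polynomial.differentiable_aeval q))] at hJ
  have e : (fun θ => confocalQuot x n q B θ) = fun θ : ℝ =>
      ε * (ellipseDeriv (√(B ^ 2 + gapHalf x n ^ 2)) B θ *
        (Polynomial.aeval (confocal x n B θ) q / canonicalRoot x (confocal x n B θ))) := by
    funext θ
    rw [confocalQuot, hcl, h B hB θ]
    have h1 := ellipseDeriv_confocal_ne_zero hN hx hn hn' hB θ
    have h2 := gapRoot_ne_zero hN hx hn'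
      (confocal_mem_gapStrip hN hx hn hn' ⟨hB.1.le, hB.2⟩ θ)
    field_simp
  rw [e, intervalIntegral.integral_const_mul]
  exact mul_eq_zero_of_right _ hJ

/-- At `B = 0` the ellipse degenerates to `τ + δ cos θ`, with `δ` half the gap length: it runs over
the gap twice, or stays at a point if the gap is collapsed. There `gapRoot` is positive. -/
theorem confocalQuot_zero (hN : 2 ≤ N) {x : Phase N} (hx : x ∈ phaseSpace N) {n : ℕ}
    (hn : 1 ≤ n) (hn' : n < N) {q : ℝ[X]}
    (hq : ∀ t ∈ Set.Icc (lam x (2 * n)) (lam x (2 * n + 1)), q.eval t ≠ 0) (θ : ℝ) :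
    ∃ r : ℝ, r ≠ 0 ∧ confocalQuot x n q 0 θ = r := by
  have hB := (confocalMax_pos hN hx hn hn').le
  have hδ := gapHalf_nonneg hN hx hn hn'
  have hc : confocal x n 0 θ = ((contourCenter x n + gapHalf x n * Real.cos θ : ℝ) : ℂ) := by
    rw [confocal, ellipse]
    simp [Real.sqrt_sq hδ]
  have hmem := confocal_mem_gapStrip hN hx hn hn' ⟨le_rfl, hB⟩ θ
  rw [confocalQuot, min_eq_left hB, max_self]
  rw [hc] at hmem ⊢
  obtain ⟨r, hr, hr'⟩ := gapRoot_ofReal hN hx hn' hmem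
  rw [hr', aeval_ofReal]
  refine ⟨q.eval (contourCenter x n + gapHalf x n * Real.cos θ) / r,
    div_ne_zero (hq _ ⟨?_, ?_⟩) hr.ne', by push_cast; rfl⟩
  · rw [lam_eq_center_sub]; nlinarith [Real.neg_one_le_cos θ]
  · rw [lam_eq_center_add]; nlinarith [Real.cos_le_one θ]

/-- By continuity the integral vanishes also at `B = 0`, where the integrand is real, continuous and
without zeros, hence of constant sign. -/
theorem false_of_integral_eq_zero {Ψ : ℝ → ℝ → ℂ} (hΨ : Continuous fun p : ℝ × ℝ => Ψ p.1 p.2)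
    {M : ℝ} (hM : 0 < M)
    (hz : ∀ B ∈ Set.Ioc 0 M, ∫ θ in (0 : ℝ)..2 * Real.pi, Ψ B θ = 0)
    (hreal : ∀ θ, ∃ r : ℝ, r ≠ 0 ∧ Ψ 0 θ = r) : False := by
  have hint : Continuous fun B => ∫ θ in (0 : ℝ)..2 * Real.pi, Ψ B θ :=
    intervalIntegral.continuous_parametric_intervalIntegral_of_continuous' hΨ _ _
  have hzero0 : ∫ θ in (0 : ℝ)..2 * Real.pi, Ψ 0 θ = 0 := by
    have hcl : IsClosed {B | ∫ θ in (0 : ℝ)..2 * Real.pi, Ψ B θ = 0} :=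
      isClosed_eq hint continuous_const
    have h1 := hcl.closure_subset_iff.2 (show Set.Ioc 0 M ⊆ _ from fun B hB => hz B hB)
    rw [closure_Ioc hM.ne] at h1
    exact h1 ⟨le_rfl, hM.le⟩
  choose r hr hr' using hreal
  have hrc : Continuous r := by
    have h1 : Continuous fun θ => (Ψ 0 θ).re :=
      Complex.continuous_re.comp (hΨ.comp (continuous_const.prodMk continuous_id))
    simpa [hr'] using h1
  have hint0 : ∫ θ in (0 : ℝ)..2 * Real.pi, r θ = 0 := by
    simp only [hr'] at hzero0
    rw [intervalIntegral.integral_ofReal] at hzero0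
    exact_mod_cast hzero0
  have hsign : (∀ θ, 0 < r θ) ∨ ∀ θ, 0 < -r θ := by
    by_contra! h
    obtain ⟨⟨a, ha⟩, ⟨b, hb⟩⟩ := h
    obtain ⟨c, hc⟩ := mem_range_of_exists_le_of_exists_ge hrc ⟨a, ha⟩ ⟨b, by linarith⟩
    exact hr c hc
  rcases hsign with h | h
  · exact (intervalIntegral.intervalIntegral_pos_of_pos (hrc.intervalIntegrable _ _) h
      Real.two_pi_pos).ne' hint0
  · have := intervalIntegral.intervalIntegral_pos_of_pos (f := fun θ => -r θ)
      (hrc.neg.intervalIntegrable _ _) h Real.two_pi_pos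
    rw [intervalIntegral.integral_neg, hint0, neg_zero] at this
    exact this.false

/-- A period around a gap on which `q` has no zero does not vanish. -/
theorem circleIntegral_div_canonicalRoot_ne_zero (hN : 2 ≤ N) {x : Phase N}
    (hx : x ∈ phaseSpace N) {n : ℕ} (hn : 1 ≤ n) (hn' : n < N) {q : ℝ[X]}
    (hq : ∀ t ∈ Set.Icc (lam x (2 * n)) (lam x (2 * n + 1)), q.eval t ≠ 0) :
    (∮ z in C((contourCenter x n : ℂ), contourRadius x n),
      Polynomial.aeval z q / canonicalRoot x z) ≠ 0 := fun hJ =>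
  false_of_integral_eq_zero (continuous_confocalQuot hN hx hn hn' q) (confocalMax_pos hN hx hn hn')
    (fun _ hB => integral_confocalQuot_eq_zero hN hx hn hn' hJ hB)
    (confocalQuot_zero hN hx hn hn' hq)

/-! ### Smoothness of the actions -/

/-! ### Square roots in a commutative Banach algebra -/

section SquareRoot

variable {𝔸 : Type*} [NormedCommRing 𝔸] [NormedAlgebra ℝ 𝔸] [CompleteSpace 𝔸]

/-- Multiplication by twice a unit. -/
def twiceUnitEquiv (u : 𝔸ˣ) : 𝔸 ≃L[ℝ] 𝔸 :=
  ContinuousLinearEquiv.equivOfInverse (ContinuousLinearMap.mul ℝ 𝔸 ((2 : ℝ) • (u : 𝔸)))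
    (ContinuousLinearMap.mul ℝ 𝔸 ((2 : ℝ)⁻¹ • ((u⁻¹ : 𝔸ˣ) : 𝔸)))
    (fun v => by simp [← mul_assoc]) (fun v => by simp [← mul_assoc])

theorem hasFDerivAt_sq_unit (u : 𝔸ˣ) :
    HasFDerivAt (fun a : 𝔸 => a ^ 2) (twiceUnitEquiv u : 𝔸 →L[ℝ] 𝔸) (u : 𝔸) := by
  have h := (hasFDerivAt_id (𝕜 := ℝ) (u : 𝔸)).pow 2
  refine h.congr_fderiv ?_
  ext v
  simp [twiceUnitEquiv, add_mul, two_smul]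

/-- Units of a commutative Banach algebra have smooth local square roots. -/
theorem exists_contDiffAt_sqrt (u : 𝔸ˣ) : ∃ G : 𝔸 → 𝔸, ContDiffAt ℝ ∞ G ((u : 𝔸) ^ 2) ∧
    G ((u : 𝔸) ^ 2) = u ∧ ∀ᶠ a in nhds ((u : 𝔸) ^ 2), G a ^ 2 = a := by
  have hc : ContDiffAt ℝ ∞ (fun a : 𝔸 => a ^ 2) (u : 𝔸) := contDiffAt_id.pow 2
  have hd := hasFDerivAt_sq_unit u
  have hn : (∞ : WithTop ℕ∞) ≠ 0 := by simp
  exact ⟨hc.localInverse hd hn, hc.to_localInverse hd hn, hc.localInverse_apply_image hd hn,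
    (hc.hasStrictFDerivAt' hd hn).eventually_right_inverse⟩

theorem hasFDerivAt_sqrt_apply {u : 𝔸ˣ} {G : 𝔸 → 𝔸} (hG : ContDiffAt ℝ ∞ G ((u : 𝔸) ^ 2))
    (hu : G ((u : 𝔸) ^ 2) = u) (h : ∀ᶠ a in nhds ((u : 𝔸) ^ 2), G a ^ 2 = a) (v : 𝔸) :
    2 * u * fderiv ℝ G ((u : 𝔸) ^ 2) v = v := by
  have h1 := (hG.differentiableAt (by simp)).hasFDerivAt.pow 2
  have h2 : HasFDerivAt (fun a => G a ^ 2) (ContinuousLinearMap.id ℝ 𝔸) ((u : 𝔸) ^ 2) :=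
    (hasFDerivAt_id _).congr_of_eventuallyEq h
  have h3 := congrArg (fun l : 𝔸 →L[ℝ] 𝔸 => l v) (h1.unique h2)
  simpa [hu] using h3

theorem contDiffAt_inverse_sqrt {u : 𝔸ˣ} {G : 𝔸 → 𝔸} (hG : ContDiffAt ℝ ∞ G ((u : 𝔸) ^ 2))
    (hu : G ((u : 𝔸) ^ 2) = u) :
    ContDiffAt ℝ ∞ (fun a => Ring.inverse (G a)) ((u : 𝔸) ^ 2) :=
  ContDiffAt.comp (g := Ring.inverse) _ (by rw [hu]; exact contDiffAt_ringInverse ℝ u) hG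

/-- This is `d(a^(-1/2)) = -(1/2) a^(-3/2) da` at `a = u²`, cleared of denominators. -/
theorem fderiv_inverse_sqrt_apply {u : 𝔸ˣ} {G : 𝔸 → 𝔸} (hG : ContDiffAt ℝ ∞ G ((u : 𝔸) ^ 2))
    (hu : G ((u : 𝔸) ^ 2) = u) (h : ∀ᶠ a in nhds ((u : 𝔸) ^ 2), G a ^ 2 = a) (v : 𝔸) :
    2 * (u : 𝔸) ^ 3 * fderiv ℝ (fun a => Ring.inverse (G a)) ((u : 𝔸) ^ 2) v = -v := by
  have h1 : HasFDerivAt (Ring.inverse : 𝔸 → 𝔸) (-ContinuousLinearMap.mulLeftRight ℝ 𝔸 ↑u⁻¹ ↑u⁻¹)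
      (G ((u : 𝔸) ^ 2)) := by
    rw [hu]; exact hasFDerivAt_ringInverse (𝕜 := ℝ) u
  have h2 := (h1.comp _ (hG.differentiableAt (by simp)).hasFDerivAt).fderiv
  have h3 := hasFDerivAt_sqrt_apply hG hu h v
  have h4 : (u : 𝔸) * ((u⁻¹ : 𝔸ˣ) : 𝔸) = 1 := u.mul_inv
  change 2 * (u : 𝔸) ^ 3 * fderiv ℝ (Ring.inverse ∘ G) ((u : 𝔸) ^ 2) v = -v
  rw [h2]
  simp only [ContinuousLinearMap.comp_apply, neg_apply, ContinuousLinearMap.mulLeftRight_apply]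
  generalize ((u⁻¹ : 𝔸ˣ) : 𝔸) = w at *
  generalize fderiv ℝ G ((u : 𝔸) ^ 2) v = d at *
  linear_combination (-(u * w) - 1) * (2 * u * d) * h4 - h3

end SquareRoot

/-! ### The contour integral as a bounded functional -/

section Functional

/-- Integration along a circle as a functional on the continuous functions on the circle. -/
def circleFunctional (τ : ℂ) (R : ℝ) : C(Metric.sphere τ |R|, ℂ) →L[ℝ] ℂ :=
  LinearMap.mkContinuous
    { toFun := fun g => ∫ θ in (0 : ℝ)..2 * Real.pi,
        deriv (circleMap τ R) θ * g ⟨circleMap τ R θ, circleMap_mem_sphere' τ R θ⟩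
      map_add' := fun g h => by
        simp only [ContinuousMap.add_apply, mul_add]
        exact intervalIntegral.integral_add (Continuous.intervalIntegrable (by
          simp only [deriv_circleMap]; fun_prop) _ _) (Continuous.intervalIntegrable (by
          simp only [deriv_circleMap]; fun_prop) _ _)
      map_smul' := fun c g => by
        simp only [ContinuousMap.smul_apply, mul_smul_comm, RingHom.id_apply]
        exact intervalIntegral.integral_smul c _ }
    (|R| * (2 * Real.pi)) fun g => by
      have := intervalIntegral.norm_integral_le_of_norm_le_const (a := 0) (b := 2 * Real.pi)
        (f := fun θ => deriv (circleMap τ R) θ *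
          g ⟨circleMap τ R θ, circleMap_mem_sphere' τ R θ⟩) (C := |R| * ‖g‖) fun θ _ => by
          rw [norm_mul]
          refine mul_le_mul ?_ (g.norm_coe_le_norm _) (norm_nonneg _) (abs_nonneg _)
          simp [deriv_circleMap]
      rw [sub_zero, abs_of_pos Real.two_pi_pos] at this
      refine this.trans (le_of_eq (by ring))

theorem circleFunctional_apply {τ : ℂ} {R : ℝ} (g : C(Metric.sphere τ |R|, ℂ)) {f : ℂ → ℂ}
    (h : ∀ z : Metric.sphere τ |R|, g z = f z) :
    circleFunctional τ R g = ∮ z in C(τ, R), f z := by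
  rw [circleIntegral]
  exact intervalIntegral.integral_congr fun θ _ => by simp [h]

end Functional

/-- The differential of the discriminant, as a polynomial in the spectral parameter. -/
def variation (x v : Phase N) : ℝ[X] :=
  ∑ m ∈ Finset.range (N + 1), Polynomial.C (coeffDifferential x m v) * Polynomial.X ^ m

theorem discriminant_eq_sum (hN : 2 ≤ N) (x : Phase N) : discriminant x =
    ∑ m ∈ Finset.range (N + 1), (discriminant x).coeff m • (Polynomial.X ^ m : ℝ[X]) := by
  conv_lhs => rw [(discriminant x).as_sum_range_C_mul_X_pow' (n := N + 1)
    (Nat.lt_succ_of_le (natDegree_discriminant_le hN x))]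
  simp [Polynomial.smul_eq_C_mul]

theorem variation_eq_sum (x v : Phase N) : variation x v =
    ∑ m ∈ Finset.range (N + 1), coeffDifferential x m v • (Polynomial.X ^ m : ℝ[X]) := by
  simp [variation, Polynomial.smul_eq_C_mul]

section Linear

variable {V : Type*} [NormedAddCommGroup V] [NormedSpace ℝ V]

theorem contDiffAt_linear_discriminant (hN : 2 ≤ N) {x : Phase N} (hx : x ∈ phaseSpace N)
    (T : ℝ[X] →ₗ[ℝ] V) : ContDiffAt ℝ ∞ (fun y : Phase N => T (discriminant y)) x := by
  have : (fun y : Phase N => T (discriminant y)) = fun y => ∑ m ∈ Finset.range (N + 1),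
      (discriminant y).coeff m • T (Polynomial.X ^ m) := by
    funext y
    conv_lhs => rw [discriminant_eq_sum hN y]
    simp
  rw [this]
  exact ContDiffAt.sum fun m _ => (contDiffAt_discriminant_coeff hx ∞ m).smul contDiffAt_const

theorem fderiv_linear_discriminant (hN : 2 ≤ N) {x : Phase N} (hx : x ∈ phaseSpace N)
    (T : ℝ[X] →ₗ[ℝ] V) (v : Phase N) :
    fderiv ℝ (fun y : Phase N => T (discriminant y)) x v = T (variation x v) := by
  have : (fun y : Phase N => T (discriminant y)) = fun y => ∑ m ∈ Finset.range (N + 1),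
      (discriminant y).coeff m • T (Polynomial.X ^ m) := by
    funext y
    conv_lhs => rw [discriminant_eq_sum hN y]
    simp
  rw [this, (HasFDerivAt.fun_sum fun m _ =>
    (hasFDerivAt_discriminant_coeff hx m).smul_const (T (Polynomial.X ^ m))).fderiv,
    variation_eq_sum]
  simp

end Linear

/-- Restriction of polynomials to a compact set of complex numbers. -/
def polyRestrict (K : Set ℂ) : ℝ[X] →ₗ[ℝ] C(K, ℂ) where
  toFun p := ⟨fun z => Polynomial.aeval (z : ℂ) p, by fun_prop⟩
  map_add' p q := by ext z; simp
  map_smul' c p := by ext z; simp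

@[simp]
theorem polyRestrict_apply (K : Set ℂ) (p : ℝ[X]) (z : K) :
    polyRestrict K p z = Polynomial.aeval (z : ℂ) p := rfl

/-- Smooth dependence of the integrand of the action, with its derivative, for a smooth choice of the
root of `Δ² - 4`. -/
theorem integrand_deriv (hN : 2 ≤ N) {x : Phase N} (hx : x ∈ phaseSpace N) {K : Set ℂ}
    [CompactSpace K] (u : C(K, ℂ)ˣ)
    (hu : (u : C(K, ℂ)) ^ 2 = polyRestrict K (discriminant x) ^ 2 - 4) {G : C(K, ℂ) → C(K, ℂ)}
    (hG : ContDiffAt ℝ ∞ G ((u : C(K, ℂ)) ^ 2)) (hGu : G ((u : C(K, ℂ)) ^ 2) = u)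
    (hsq : ∀ᶠ a in nhds ((u : C(K, ℂ)) ^ 2), G a ^ 2 = a) :
    ContDiffAt ℝ ∞ (fun y : Phase N => polyRestrict K Polynomial.X *
      (polyRestrict K (discriminant y).derivative *
        Ring.inverse (G (polyRestrict K (discriminant y) ^ 2 - 4)))) x ∧
    ∀ (v : Phase N) (z : K), fderiv ℝ (fun y : Phase N => polyRestrict K Polynomial.X *
      (polyRestrict K (discriminant y).derivative *
        Ring.inverse (G (polyRestrict K (discriminant y) ^ 2 - 4)))) x v z =
      (z : ℂ) * (Polynomial.aeval (z : ℂ) (variation x v).derivative / (u : C(K, ℂ)) z -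
        Polynomial.aeval (z : ℂ) (discriminant x).derivative *
          (Polynomial.aeval (z : ℂ) (discriminant x) * Polynomial.aeval (z : ℂ) (variation x v)) /
          (u : C(K, ℂ)) z ^ 3) := by
  have hP := contDiffAt_linear_discriminant hN hx (polyRestrict K)
  have hD := contDiffAt_linear_discriminant hN hx
    ((polyRestrict K).comp (Polynomial.derivative (R := ℝ)))
  have hP' := fun v => fderiv_linear_discriminant hN hx (polyRestrict K) v
  have hD' := fun v => fderiv_linear_discriminant hN hx
    ((polyRestrict K).comp (Polynomial.derivative (R := ℝ))) v
  simp only [LinearMap.comp_apply] at hD hD'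
  have hE : ContDiffAt ℝ ∞ (fun y => polyRestrict K (discriminant y) ^ 2 - 4) x :=
    (hP.pow 2).sub contDiffAt_const
  have hW : ContDiffAt ℝ ∞ (fun a => Ring.inverse (G a))
      (polyRestrict K (discriminant x) ^ 2 - 4) := hu ▸ contDiffAt_inverse_sqrt hG hGu
  have hI := ContDiffAt.comp (g := fun a => Ring.inverse (G a)) x hW hE
  refine ⟨contDiffAt_const.mul (hD.mul hI), fun v z => ?_⟩
  have hE2 := (((hP.differentiableAt (by simp)).hasFDerivAt.pow 2).sub_const 4)
  have hI2 := (hW.differentiableAt (by simp)).hasFDerivAt.comp x hE2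
  have hF := ((hD.differentiableAt (by simp)).hasFDerivAt.mul hI2).const_mul
    (polyRestrict K Polynomial.X)
  have hF' := congrArg (fun l : Phase N →L[ℝ] C(K, ℂ) => l v z) hF.fderiv
  have hroot := fderiv_inverse_sqrt_apply hG hGu hsq
    (2 * polyRestrict K (discriminant x) * polyRestrict K (variation x v))
  have hz := congrArg (fun g : C(K, ℂ) => g z) hroot
  have hinv : ((u⁻¹ : C(K, ℂ)ˣ) : C(K, ℂ)) z * (u : C(K, ℂ)) z = 1 := by
    rw [← ContinuousMap.mul_apply, u.inv_mul, ContinuousMap.one_apply]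
  have hu0 : (u : C(K, ℂ)) z ≠ 0 := right_ne_zero_of_mul_eq_one hinv
  refine hF'.trans ?_
  rw [← hu]
  have hGE : G (polyRestrict K (discriminant x) ^ 2 - 4) = u := hu ▸ hGu
  have htwo : (2 : C(K, ℂ)) z = 2 := rfl
  have hui : ((u⁻¹ : C(K, ℂ)ˣ) : C(K, ℂ)) z = ((u : C(K, ℂ)) z)⁻¹ := eq_inv_of_mul_eq_one_left hinv
  simp [hP', hD', hGE, htwo, hui] at hz ⊢
  generalize (fderiv ℝ (fun a => Ring.inverse (G a)) ((u : C(K, ℂ)) ^ 2))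
    (2 * polyRestrict K (discriminant x) * polyRestrict K (variation x v)) z = d at *
  have hd : d = -(Polynomial.aeval (z : ℂ) (discriminant x) *
      Polynomial.aeval (z : ℂ) (variation x v)) / (u : C(K, ℂ)) z ^ 3 := by
    rw [eq_div_iff (pow_ne_zero _ hu0)]
    linear_combination hz / 2
  rw [hd]
  ring

theorem sphere_eq_ellipse {τ R : ℝ} {z : ℂ} (hz : z ∈ Metric.sphere (τ : ℂ) |R|) :
    ∃ θ, z = ellipse τ R R θ := by
  rw [← range_circleMap] at hz
  obtain ⟨θ, rfl⟩ := hz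
  exact ⟨θ, (ellipse_eq_circleMap τ R θ).symm⟩

/-- By continuity of the eigenvalues the contour can stay fixed while the point of phase space
moves. -/
theorem eventually_encloses (hN : 2 ≤ N) {x : Phase N} (hx : x ∈ phaseSpace N) {n : ℕ}
    (hn : 1 ≤ n) (hn' : n < N) {τ A B : ℝ} (h : Encloses x n τ A B) :
    ∀ᶠ y in nhds x, Encloses y n τ A B := by
  have hc := fun j (hj : 1 ≤ j) (hj' : j ≤ 2 * N) => continuousAt_lam hN hx hj hj'
  filter_upwards [(hc (2 * n - 1) (by omega) (by omega)).eventually_lt_const h.left_lt,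
    (hc (2 * n) (by omega) (by omega)).eventually_const_lt h.lt_left,
    (hc (2 * n + 1) (by omega) (by omega)).eventually_lt_const h.right_lt,
    (hc (2 * n + 2) (by omega) (by omega)).eventually_const_lt h.lt_right] with y h1 h2 h3 h4
  exact ⟨h.pos, h1, h2, h3, h4⟩

/-- The canonical root on a contour, as a unit of the algebra of continuous functions. -/
theorem exists_unit_canonicalRoot (hN : 2 ≤ N) {x : Phase N} (hx : x ∈ phaseSpace N) {n : ℕ}
    (hn : 1 ≤ n) (hn' : n < N) {τ R : ℝ} (h : Encloses x n τ R R) :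
    ∃ u : C(Metric.sphere (τ : ℂ) |R|, ℂ)ˣ, ∀ z, (u : C(Metric.sphere (τ : ℂ) |R|, ℂ)) z =
      canonicalRoot x z := by
  have hmem : ∀ z ∈ Metric.sphere (τ : ℂ) |R|, z ∈ bandDomain x := fun z hz => by
    obtain ⟨θ, rfl⟩ := sphere_eq_ellipse hz
    exact h.mem_bandDomain hn hn' θ
  have hc : ContinuousOn (canonicalRoot x) (Metric.sphere (τ : ℂ) |R|) :=
    (isCanonicalRoot_canonicalRoot hN hx).continuousOn.mono
      fun z hz => bandDomain_subset hN hx (hmem z hz)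
  have hu : IsUnit (⟨fun z => canonicalRoot x z, hc.domRestrict⟩ :
      C(Metric.sphere (τ : ℂ) |R|, ℂ)) :=
    ContinuousMap.isUnit_iff_forall_ne_zero _ |>.2
      fun z => canonicalRoot_ne_zero hN hx (hmem z z.2)
  obtain ⟨u, hu⟩ := hu
  exact ⟨u, fun z => by rw [hu]; rfl⟩

/-- On the connected circle two roots of the same nonvanishing function agree up to a global sign.
The sign is decided at one point, where `upperRoot` gives an expression continuous in `y`. -/
theorem eventually_eq_canonicalRoot (hN : 2 ≤ N) {x : Phase N} (hx : x ∈ phaseSpace N) {n : ℕ}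
    (hn : 1 ≤ n) (hn' : n < N) {τ R : ℝ} (h : Encloses x n τ R R)
    {F : Phase N → C(Metric.sphere (τ : ℂ) |R|, ℂ)} (hF : ContinuousAt F x)
    (hFx : ∀ z, F x z = canonicalRoot x z)
    (hsq : ∀ᶠ y in nhds x, F y ^ 2 = polyRestrict _ (discriminant y) ^ 2 - 4) :
    ∀ᶠ y in nhds x, ∀ z, F y z = canonicalRoot y z := by
  -- The top of the circle lies in the open upper half plane, where the canonical root is
  -- `upperRoot`.
  have hp : ellipse τ R R (Real.pi / 2) ∈ Metric.sphere (τ : ℂ) |R| := by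
    rw [ellipse_eq_circleMap]; exact circleMap_mem_sphere' _ _ _
  set p : Metric.sphere (τ : ℂ) |R| := ⟨_, hp⟩ with hpdef
  have hpim : 0 < (p : ℂ).im := by
    rw [hpdef, ellipse_im]; simpa using h.pos
  have hne : ∀ᶠ y in nhds x, F y p + upperRoot y p ≠ 0 := by
    have hc : ContinuousAt (fun y => F y p + upperRoot y p) x :=
      ((continuous_eval_const p).continuousAt.comp hF).add
        (continuousAt_upperRoot hN hx p)
    refine hc.eventually_ne ?_
    rw [hFx, ← canonicalRoot_eq_upperRoot hN hx hpim, ← two_mul]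
    exact mul_ne_zero two_ne_zero (canonicalRoot_ne_zero hN hx (Or.inl hpim.ne'))
  filter_upwards [hne, hsq, eventually_encloses hN hx hn hn' h, isOpen_phaseSpace.mem_nhds hx]
    with y h1 h2 h3 hy
  have hmem : ∀ z : Metric.sphere (τ : ℂ) |R|, (z : ℂ) ∈ bandDomain y := fun z => by
    obtain ⟨θ, hθ⟩ := sphere_eq_ellipse z.2
    rw [hθ]
    exact h3.mem_bandDomain hn hn' θ
  have hroot := isCanonicalRoot_canonicalRoot hN hy
  have hconn : PreconnectedSpace (Metric.sphere (τ : ℂ) |R|) :=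
    Subtype.preconnectedSpace (isPreconnected_sphere (by simp [Complex.rank_real_complex]) _ _)
  have hcr : Continuous fun z : Metric.sphere (τ : ℂ) |R| => canonicalRoot y z :=
    hroot.continuousOn.comp_continuous continuous_subtype_val
      fun z => bandDomain_subset hN hy (hmem z)
  rcases isPreconnected_univ.eq_or_eq_neg_of_sq_eq (f := F y)
    (g := fun z : Metric.sphere (τ : ℂ) |R| => canonicalRoot y z)
    (F y).continuous.continuousOn hcr.continuousOn
    (fun z _ => by
      have e := congrArg (fun g : C(Metric.sphere (τ : ℂ) |R|, ℂ) => g z) h2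
      exact e.trans (hroot.sq_eq z (bandDomain_subset hN hy (hmem z))).symm)
    (fun {z} _ => canonicalRoot_ne_zero hN hy (hmem z)) with h4 | h4
  · exact fun z => h4 (Set.mem_univ z)
  · refine absurd ?_ h1
    rw [h4 (Set.mem_univ p), ← canonicalRoot_eq_upperRoot hN hy hpim]
    simp

/-- The period of `-q dλ / √(Δ² - 4)` around the `n`-th gap, divided by `2π`. -/
def period (x : Phase N) (n : ℕ) (q : ℝ[X]) : ℝ :=
  -(1 / (2 * Real.pi)) * (∮ z in C((contourCenter x n : ℂ), contourRadius x n),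
    Polynomial.aeval z q / canonicalRoot x z).re

theorem contour_mem_bandDomain (hN : 2 ≤ N) {x : Phase N} (hx : x ∈ phaseSpace N) {n : ℕ}
    (hn : 1 ≤ n) (hn' : n < N) {z : ℂ}
    (hz : z ∈ Metric.sphere (contourCenter x n : ℂ) |contourRadius x n|) : z ∈ bandDomain x := by
  obtain ⟨θ, rfl⟩ := sphere_eq_ellipse hz
  exact (contour_encloses hN hx hn hn').mem_bandDomain hn hn' θ

/-- Integration by parts on a contour. -/
theorem circleIntegral_variation (hN : 2 ≤ N) {x : Phase N} (hx : x ∈ phaseSpace N) {n : ℕ}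
    (hn : 1 ≤ n) (hn' : n < N) (q : ℝ[X]) :
    (∮ z in C((contourCenter x n : ℂ), contourRadius x n),
      z * (Polynomial.aeval z q.derivative / canonicalRoot x z -
        Polynomial.aeval z (discriminant x).derivative *
          (Polynomial.aeval z (discriminant x) * Polynomial.aeval z q) /
          canonicalRoot x z ^ 3)) =
    -∮ z in C((contourCenter x n : ℂ), contourRadius x n),
      Polynomial.aeval z q / canonicalRoot x z := by
  have hR := (contour_encloses hN hx hn hn').pos
  have hmem : ∀ z ∈ Metric.sphere (contourCenter x n : ℂ) (contourRadius x n), z ∈ bandDomain x :=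
    fun z hz => contour_mem_bandDomain hN hx hn hn' (by rwa [abs_of_pos hR])
  have hcont : ContinuousOn (canonicalRoot x)
      (Metric.sphere (contourCenter x n : ℂ) (contourRadius x n)) :=
    (isCanonicalRoot_canonicalRoot hN hx).continuousOn.mono
      fun z hz => bandDomain_subset hN hx (hmem z hz)
  have hne : ∀ z ∈ Metric.sphere (contourCenter x n : ℂ) (contourRadius x n),
      canonicalRoot x z ≠ 0 := fun z hz => canonicalRoot_ne_zero hN hx (hmem z hz)
  have hpoly : ∀ (p : ℝ[X]) (S : Set ℂ), ContinuousOn (fun z : ℂ => Polynomial.aeval z p) S :=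
    fun p S => (Polynomial.continuous_aeval p).continuousOn
  rw [eq_neg_iff_add_eq_zero, ← circleIntegral.integral_add]
  -- The sum of the two integrands is the derivative of `λ q / √(Δ² - 4)`, which is single-valued on
  -- the contour.
  · refine circleIntegral.integral_eq_zero_of_hasDerivWithinAt hR.le
      (f := fun z => z * Polynomial.aeval z q / canonicalRoot x z) fun z hz => ?_
    have h1 := (((hasDerivAt_id z).mul (q.hasDerivAt_aeval z)).div
      (hasDerivAt_canonicalRoot hN hx (hmem z hz)) (hne z hz)).hasDerivWithinAt
      (s := Metric.sphere (contourCenter x n : ℂ) (contourRadius x n))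
    refine h1.congr_deriv ?_
    have := hne z hz
    simp only [id_eq, Pi.mul_apply]
    field_simp
    ring
  · refine ContinuousOn.circleIntegrable hR.le (continuousOn_id.mul
      (((hpoly _ _).div hcont hne).sub
        (((hpoly _ _).mul ((hpoly _ _).mul (hpoly _ _))).div (hcont.pow 3)
          fun z hz => pow_ne_zero _ (hne z hz))))
  · exact ContinuousOn.circleIntegrable hR.le ((hpoly _ _).div hcont hne)

theorem actionIntegral_eq_of_encloses (hN : 2 ≤ N) {y : Phase N} (hy : y ∈ phaseSpace N) {n : ℕ}
    (hn : 1 ≤ n) (hn' : n < N) {τ R : ℝ} (h : Encloses y n τ R R) :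
    actionIntegral y n = ((1 / (2 * Real.pi) : ℝ) : ℂ) * ∮ z in C((τ : ℂ), R),
      z * (Polynomial.aeval z (discriminant y).derivative / canonicalRoot y z) := by
  rw [actionIntegral, circleIntegral_eq_ellipse, circleIntegral_eq_ellipse,
    (contour_encloses hN hy hn hn').integral_eq hn hn' h
      (g := fun z => z * (Polynomial.aeval z (discriminant y).derivative / canonicalRoot y z))]
  · push_cast; rfl
  · have := differentiableOn_div_canonicalRoot hN hy
      (g := fun z => z * Polynomial.aeval z (discriminant y).derivative)
      (differentiable_id.mul (Polynomial.differentiable_aeval _))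
    simpa only [mul_div_assoc] using this

/-- The integrand of the action, with the root of `a` replaced by `G a`. -/
def actionIntegrand (K : Set ℂ) [CompactSpace K] (G : C(K, ℂ) → C(K, ℂ)) (y : Phase N) : C(K, ℂ) :=
  polyRestrict K Polynomial.X * (polyRestrict K (discriminant y).derivative *
    Ring.inverse (G (polyRestrict K (discriminant y) ^ 2 - 4)))

theorem circleFunctional_actionIntegrand (hN : 2 ≤ N) {y : Phase N} (hy : y ∈ phaseSpace N) {n : ℕ}
    (hn : 1 ≤ n) (hn' : n < N) {τ R : ℝ} (h : Encloses y n τ R R)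
    {G : C(Metric.sphere (τ : ℂ) |R|, ℂ) → C(Metric.sphere (τ : ℂ) |R|, ℂ)}
    (hG : ∀ z, G (polyRestrict _ (discriminant y) ^ 2 - 4) z = canonicalRoot y z) :
    circleFunctional τ R (actionIntegrand _ G y) = ∮ z in C((τ : ℂ), R),
      z * (Polynomial.aeval z (discriminant y).derivative / canonicalRoot y z) := by
  refine circleFunctional_apply _ fun z => ?_
  obtain ⟨w, hw⟩ := exists_unit_canonicalRoot hN hy hn hn' h
  have hGw : G (polyRestrict _ (discriminant y) ^ 2 - 4) = w := by
    ext z; rw [hG, hw]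
  have hinv : ((w⁻¹ : C(Metric.sphere (τ : ℂ) |R|, ℂ)ˣ) :
      C(Metric.sphere (τ : ℂ) |R|, ℂ)) z = (canonicalRoot y z)⁻¹ := by
    refine eq_inv_of_mul_eq_one_left ?_
    rw [← hw, ← ContinuousMap.mul_apply, w.inv_mul, ContinuousMap.one_apply]
  rw [actionIntegrand, hGw, Ring.inverse_unit]
  simp [hinv, div_eq_mul_inv]

theorem continuousAt_polyRestrict (hN : 2 ≤ N) {x : Phase N} (hx : x ∈ phaseSpace N) (K : Set ℂ)
    [CompactSpace K] :
    ContinuousAt (fun y => polyRestrict K (discriminant y) ^ 2 - 4) x :=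
  ((contDiffAt_linear_discriminant hN hx (polyRestrict K)).continuousAt.pow 2).sub
    continuousAt_const

/-- Near `x` the moving contour may be replaced by a fixed circle, and the canonical root by the
smooth local root `G`. -/
theorem eventually_action_eq (hN : 2 ≤ N) {x : Phase N} (hx : x ∈ phaseSpace N) {n : ℕ}
    (hn : 1 ≤ n) (hn' : n < N) {τ R : ℝ} (h : Encloses x n τ R R)
    {G : C(Metric.sphere (τ : ℂ) |R|, ℂ) → C(Metric.sphere (τ : ℂ) |R|, ℂ)}
    (hG : ContinuousAt G (polyRestrict _ (discriminant x) ^ 2 - 4))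
    (hGx : ∀ z, G (polyRestrict _ (discriminant x) ^ 2 - 4) z = canonicalRoot x z)
    (hsq : ∀ᶠ a in nhds (polyRestrict _ (discriminant x) ^ 2 - 4), G a ^ 2 = a) :
    action n =ᶠ[nhds x] fun y => 1 / (2 * Real.pi) *
      (Complex.reCLM ∘L circleFunctional τ R) (actionIntegrand _ G y) := by
  have hE := continuousAt_polyRestrict hN hx (Metric.sphere (τ : ℂ) |R|)
  have hev := eventually_eq_canonicalRoot hN hx hn hn' h
    (F := fun y => G (polyRestrict _ (discriminant y) ^ 2 - 4))
    (ContinuousAt.comp (g := G) hG hE) hGx (hE.tendsto.eventually hsq)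
  filter_upwards [hev, eventually_encloses hN hx hn hn' h, isOpen_phaseSpace.mem_nhds hx]
    with y h1 h2 hy
  rw [action, actionIntegral_eq_of_encloses hN hy hn hn' h2,
    ← circleFunctional_actionIntegrand hN hy hn hn' h2 h1, Complex.re_ofReal_mul]
  rfl

theorem unit_sq_eq (hN : 2 ≤ N) {x : Phase N} (hx : x ∈ phaseSpace N) {n : ℕ}
    (hn : 1 ≤ n) (hn' : n < N) {τ R : ℝ} (h : Encloses x n τ R R)
    {f : C(Metric.sphere (τ : ℂ) |R|, ℂ)} (hf : ∀ z, f z = canonicalRoot x z) :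
    f ^ 2 = polyRestrict _ (discriminant x) ^ 2 - 4 := by
  ext z
  obtain ⟨θ, hθ⟩ := sphere_eq_ellipse z.2
  have := (isCanonicalRoot_canonicalRoot hN hx).sq_eq z
    (bandDomain_subset hN hx (by rw [hθ]; exact h.mem_bandDomain hn hn' θ))
  rw [← hf] at this
  exact this

/-- The actions are smooth; their differentials are periods. -/
theorem contDiffAt_action (hN : 2 ≤ N) {x : Phase N} (hx : x ∈ phaseSpace N) {n : ℕ}
    (hn : 1 ≤ n) (hn' : n < N) :
    ContDiffAt ℝ ∞ (action n) x ∧ ∀ v, fderiv ℝ (action n) x v = period x n (variation x v) := by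
  have henc := contour_encloses hN hx hn hn'
  obtain ⟨u, hu⟩ := exists_unit_canonicalRoot hN hx hn hn' henc
  obtain ⟨G, hG, hGu, hsq⟩ := exists_contDiffAt_sqrt u
  have hu2 := unit_sq_eq hN hx hn hn' henc hu
  obtain ⟨hΦ, hΦ'⟩ := integrand_deriv hN hx u hu2 hG hGu hsq
  have hact := eventually_action_eq hN hx hn hn' henc (G := G) (by
    rw [← hu2]; exact hG.continuousAt) (by rw [← hu2, hGu]; exact hu) (by rw [← hu2]; exact hsq)
  change ContDiffAt ℝ ∞ (actionIntegrand _ G) x at hΦ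
  change ∀ v z, fderiv ℝ (actionIntegrand _ G) x v z = _ at hΦ'
  have h0 : ∀ v, circleFunctional (contourCenter x n) (contourRadius x n)
      (fderiv ℝ (actionIntegrand _ G) x v) =
      -∮ z in C((contourCenter x n : ℂ), contourRadius x n),
        Polynomial.aeval z (variation x v) / canonicalRoot x z := fun v => by
    rw [← circleIntegral_variation hN hx hn hn' (variation x v)]
    exact circleFunctional_apply _ fun z => (hΦ' v z).trans (by rw [hu])
  generalize actionIntegrand (N := N) _ G = Φ at *
  have hd := ((Complex.reCLM ∘L circleFunctional (contourCenter x n)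
    (contourRadius x n)).hasFDerivAt.comp x
      (hΦ.differentiableAt (by simp)).hasFDerivAt).const_mul (1 / (2 * Real.pi))
  refine ⟨(contDiffAt_const.mul ((Complex.reCLM ∘L circleFunctional (contourCenter x n)
    (contourRadius x n)).contDiff.contDiffAt.comp x hΦ)).congr_of_eventuallyEq hact, fun v => ?_⟩
  rw [hact.fderiv_eq, period]
  refine (congrArg (fun l : Phase N →L[ℝ] ℝ => l v) hd.fderiv).trans ?_
  simp [h0 v]

/-! ### Reality -/

theorem circleMap_contour_mem (hN : 2 ≤ N) {x : Phase N} (hx : x ∈ phaseSpace N) {n : ℕ}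
    (hn : 1 ≤ n) (hn' : n < N) (θ : ℝ) :
    circleMap (contourCenter x n) (contourRadius x n) θ ∈ bandDomain x :=
  contour_mem_bandDomain hN hx hn hn' (circleMap_mem_sphere' _ _ _)

theorem conj_circleIntegral_div (hN : 2 ≤ N) {x : Phase N} (hx : x ∈ phaseSpace N) {n : ℕ}
    (hn : 1 ≤ n) (hn' : n < N) (q : ℝ[X]) :
    starRingEnd ℂ (∮ z in C((contourCenter x n : ℂ), contourRadius x n),
      Polynomial.aeval z q / canonicalRoot x z) =
    ∮ z in C((contourCenter x n : ℂ), contourRadius x n),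
      Polynomial.aeval z q / canonicalRoot x z := by
  refine conj_circleIntegral fun θ => ?_
  rw [aeval_conj, canonicalRoot_conj hN hx (circleMap_contour_mem hN hx hn hn' θ), map_div₀,
    div_neg]

theorem actionIntegral_eq_aeval (x : Phase N) (n : ℕ) :
    actionIntegral x n = ((1 / (2 * Real.pi) : ℝ) : ℂ) *
      ∮ z in C((contourCenter x n : ℂ), contourRadius x n),
        Polynomial.aeval z (Polynomial.X * (discriminant x).derivative) / canonicalRoot x z := by
  simp [actionIntegral, mul_div_assoc]

theorem action_eq_actionIntegral (hN : 2 ≤ N) {x : Phase N} (hx : x ∈ phaseSpace N) {n : ℕ}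
    (hn : 1 ≤ n) (hn' : n < N) : (action n x : ℂ) = actionIntegral x n := by
  rw [action, ← Complex.conj_eq_iff_re, actionIntegral_eq_aeval, map_mul, Complex.conj_ofReal,
    conj_circleIntegral_div hN hx hn hn']

theorem ofReal_period (hN : 2 ≤ N) {x : Phase N} (hx : x ∈ phaseSpace N) {n : ℕ}
    (hn : 1 ≤ n) (hn' : n < N) (q : ℝ[X]) :
    (period x n q : ℂ) = ((-(1 / (2 * Real.pi)) : ℝ) : ℂ) *
      ∮ z in C((contourCenter x n : ℂ), contourRadius x n),
        Polynomial.aeval z q / canonicalRoot x z := by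
  rw [period, Complex.ofReal_mul,
    Complex.conj_eq_iff_re.1 (conj_circleIntegral_div hN hx hn hn' q)]

/-- A polynomial with vanishing period around a gap has a zero in the closed gap. -/
theorem exists_root_of_period_eq_zero (hN : 2 ≤ N) {x : Phase N} (hx : x ∈ phaseSpace N) {n : ℕ}
    (hn : 1 ≤ n) (hn' : n < N) {q : ℝ[X]} (hq : period x n q = 0) :
    ∃ t ∈ Set.Icc (lam x (2 * n)) (lam x (2 * n + 1)), q.eval t = 0 := by
  by_contra! h
  have h1 := ofReal_period hN hx hn hn' q
  rw [hq, Complex.ofReal_zero, eq_comm, mul_eq_zero] at h1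
  rcases h1 with h1 | h1
  · rw [Complex.ofReal_eq_zero] at h1
    simp [Real.pi_ne_zero] at h1
  · exact circleIntegral_div_canonicalRoot_ne_zero hN hx hn hn' h h1

theorem circleIntegrable_div (hN : 2 ≤ N) {x : Phase N} (hx : x ∈ phaseSpace N) {n : ℕ}
    (hn : 1 ≤ n) (hn' : n < N) (q : ℝ[X]) :
    CircleIntegrable (fun z : ℂ => Polynomial.aeval z q / canonicalRoot x z) (contourCenter x n)
      (contourRadius x n) := by
  have hR := (contour_encloses hN hx hn hn').pos
  have hmem : ∀ z ∈ Metric.sphere (contourCenter x n : ℂ) (contourRadius x n), z ∈ bandDomain x :=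
    fun z hz => contour_mem_bandDomain hN hx hn hn' (by rwa [abs_of_pos hR])
  exact ContinuousOn.circleIntegrable hR.le ((Polynomial.continuous_aeval q).continuousOn.div
    ((isCanonicalRoot_canonicalRoot hN hx).continuousOn.mono
      fun z hz => bandDomain_subset hN hx (hmem z hz))
    fun z hz => canonicalRoot_ne_zero hN hx (hmem z hz))

/-- The period as a linear functional on polynomials. -/
def periodMap (hN : 2 ≤ N) {x : Phase N} (hx : x ∈ phaseSpace N) {n : ℕ}
    (hn : 1 ≤ n) (hn' : n < N) : ℝ[X] →ₗ[ℝ] ℝ where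
  toFun := period x n
  map_add' p q := by
    have h := circleIntegral.integral_add (circleIntegrable_div hN hx hn hn' p)
      (circleIntegrable_div hN hx hn hn' q)
    simp only [period, map_add, add_div]
    rw [h, Complex.add_re]
    ring
  map_smul' c p := by
    have h := circleIntegral.integral_const_mul (c : ℂ)
      (fun z : ℂ => Polynomial.aeval z p / canonicalRoot x z) (contourCenter x n)
      (contourRadius x n)
    simp only [period, map_smul, Complex.real_smul, mul_div_assoc, RingHom.id_apply, smul_eq_mul]
    rw [h, Complex.re_ofReal_mul]
    ring

/-- The differential of an action, in terms of the differentials of the coefficients of `Δ`. -/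
theorem fderiv_action (hN : 2 ≤ N) {x : Phase N} (hx : x ∈ phaseSpace N) {n : ℕ}
    (hn : 1 ≤ n) (hn' : n < N) :
    fderiv ℝ (action n) x = ∑ m ∈ Finset.range (N + 1),
      period x n (Polynomial.X ^ m) • coeffDifferential x m := by
  ext v
  all_goals
    simp only [ContinuousLinearMap.comp_apply]
    rw [(contDiffAt_action hN hx hn hn').2, variation_eq_sum]
    change periodMap hN hx hn hn' _ = _
    rw [map_sum]
    simp [periodMap, mul_comm]

/-! ### Conservation along the Toda flow -/

/-- An action depends on the point only through `Δ`: the eigenvalues are the zeros of `Δ² - 4`, and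
the defining property of the canonical root involves nothing else. -/
theorem action_congr (hN : 2 ≤ N) {x y : Phase N} (hx : x ∈ phaseSpace N) (hy : y ∈ phaseSpace N)
    (h : discriminant x = discriminant y) (n : ℕ) : action n x = action n y := by
  have hl : lam x = lam y := by
    funext j
    rw [lam, lam, roots_charpoly_matQ hN hx, roots_charpoly_matQ hN hy, spectralPoly, spectralPoly, h]
  have hc : cuts x = cuts y := by simp only [cuts, hl]
  have hI : IsCanonicalRoot x = IsCanonicalRoot y := by
    funext f
    refine propext ⟨fun ⟨h1, h2, h3⟩ => ⟨hc ▸ h1, h ▸ hc ▸ h2, hl ▸ h3⟩,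
      fun ⟨h1, h2, h3⟩ => ⟨hc ▸ h1, h ▸ hc ▸ h2, hl ▸ h3⟩⟩
  simp only [action, actionIntegral, contourCenter, contourRadius, canonicalRoot, hl, hI, h]

theorem discriminant_const {γ : ℝ → Phase N} {t₀ t₁ : ℝ}
    (h : ∀ t ∈ Set.Ioo t₀ t₁, γ t ∈ phaseSpace N ∧ HasDerivAt γ (todaField (γ t)) t)
    {s t : ℝ} (hs : s ∈ Set.Ioo t₀ t₁) (ht : t ∈ Set.Ioo t₀ t₁) :
    discriminant (γ s) = discriminant (γ t) := by
  refine Polynomial.funext fun l => ?_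
  have hd : ∀ r ∈ Set.Ioo t₀ t₁, HasDerivAt (fun r => (discriminant (γ r)).eval l) 0 r := by
    intro r hr
    have h1 := hasDerivAt_discriminant (h r hr).2
      (Filter.eventually_of_mem (isOpen_Ioo.mem_nhds hr) fun r' hr' => (h r' hr').1) l
    rwa [discriminantDeriv_todaField (h r hr).1] at h1
  exact isOpen_Ioo.is_const_of_deriv_eq_zero isPreconnected_Ioo
    (fun r hr => (hd r hr).differentiableAt.differentiableWithinAt) (fun r hr => (hd r hr).deriv)
    hs ht

/-! ### Involution -/

theorem coeff_eq_zero_of_sum_pow {n : ℕ} {c : ℕ → ℝ} {μ : ℝ}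
    (h : ∀ l ≠ μ, ∑ k ∈ Finset.range n, c k * l ^ k = 0) {k : ℕ} (hk : k < n) : c k = 0 := by
  have hp : (∑ k ∈ Finset.range n, Polynomial.C (c k) * Polynomial.X ^ k : ℝ[X]) = 0 := by
    refine Polynomial.eq_zero_of_infinite_isRoot _ (Set.Infinite.mono (s := {μ}ᶜ) ?_
      (Set.finite_singleton μ).infinite_compl)
    intro l hl
    have := h l hl
    simpa [Polynomial.IsRoot, Polynomial.eval_finsetSum] using this
  have := congrArg (fun p : ℝ[X] => p.coeff k) hp
  simpa [Polynomial.finsetSum_coeff, Polynomial.coeff_X_pow, hk] using this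

theorem sharp_sum {ι : Type*} (x : Phase N) (s : Finset ι) (c : ι → ℝ)
    (φ : ι → Phase N →ₗ[ℝ] ℝ) : sharp x (∑ i ∈ s, c i • φ i) = ∑ i ∈ s, c i • sharp x (φ i) := by
  let L : (Phase N →ₗ[ℝ] ℝ) →ₗ[ℝ] Phase N :=
    { toFun := sharp x
      map_add' := fun φ ψ => by
        ext k <;> simp [sharp, Matrix.mulVec, dotProduct, mul_add, Finset.sum_add_distrib, add_comm]
      map_smul' := fun c φ => by
        ext k <;> simp [sharp, Matrix.mulVec, dotProduct, Finset.mul_sum, mul_left_comm] }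
  change L _ = ∑ i ∈ s, c i • L (φ i)
  simp

/-- The coefficients of the discriminant are in involution. -/
theorem coeffDifferential_sharp (hN : 2 ≤ N) {x : Phase N} (hx : x ∈ phaseSpace N) {k m : ℕ}
    (hk : k < N + 1) (hm : m < N + 1) :
    coeffDifferential x k (sharp x (coeffDifferential x m).toLinearMap) = 0 := by
  -- The bracket of `Δ(l)` and `Δ(μ)` vanishes for `l ≠ μ`. It is a polynomial in each variable, so
  -- comparing coefficients in `l` for fixed `μ`, and then in `μ`, reaches all pairs of
  -- coefficients.
  have h1 : ∀ μ : ℝ, coeffDifferential x k (sharp x (∑ m ∈ Finset.range (N + 1),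
      μ ^ m • (coeffDifferential x m).toLinearMap)) = 0 := by
    intro μ
    refine coeff_eq_zero_of_sum_pow (n := N + 1) (μ := μ) (c := fun k => coeffDifferential x k
      (sharp x (∑ m ∈ Finset.range (N + 1), μ ^ m • (coeffDifferential x m).toLinearMap)))
      (fun l hl => ?_) hk
    rw [sum_coeffDifferential hN hx]
    refine discriminantDeriv_sharp hx hl _ fun v => ?_
    rw [← sum_coeffDifferential hN hx]
    simp [mul_comm]
  refine coeff_eq_zero_of_sum_pow (n := N + 1) (μ := 0) (c := fun m => coeffDifferential x k
      (sharp x (coeffDifferential x m).toLinearMap)) (fun μ _ => ?_) hm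
  have h2 := h1 μ
  rw [sharp_sum] at h2
  simpa [mul_comm] using h2

theorem fderiv_action_hamiltonianField (hN : 2 ≤ N) {x : Phase N} (hx : x ∈ phaseSpace N) {n m : ℕ}
    (hn : 1 ≤ n) (hn' : n < N) (hm : 1 ≤ m) (hm' : m < N) :
    fderiv ℝ (action n) x (hamiltonianField (action m) x) = 0 := by
  have h : hamiltonianField (action m) x = sharp x (∑ k ∈ Finset.range (N + 1),
      period x m (Polynomial.X ^ k) • (coeffDifferential x k).toLinearMap) := by
    change sharp x (fderiv ℝ (action m) x).toLinearMap = _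
    rw [fderiv_action hN hx hm hm']
    simp
  rw [h, sharp_sum, fderiv_action hN hx hn hn', map_sum]
  refine Finset.sum_eq_zero fun k hk => ?_
  rw [map_smul]
  simp only [sum_apply, smul_apply]
  rw [Finset.sum_eq_zero fun j hj => ?_, smul_zero]
  rw [coeffDifferential_sharp hN hx (Finset.mem_range.1 hj) (Finset.mem_range.1 hk), smul_zero]

/-! ### Independence of the coefficients of the discriminant -/

/-- `u` times the transfer matrix at `(b + u⁻¹ e, a)` and `λ = u⁻¹ e_i`, as a polynomial in `u`. -/
def polyTransfer (x : Phase N) (e : ZMod N → ℝ) (i k : ZMod N) : Matrix (Fin 2) (Fin 2) ℝ[X] :=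
  !![Polynomial.C ((e i - e (k + 1)) / x.2 k) - Polynomial.X * Polynomial.C (x.1 (k + 1) / x.2 k),
    -(Polynomial.X * Polynomial.C (x.2 k)); Polynomial.X * Polynomial.C (1 / x.2 k), 0]

/-- The product of `n` consecutive polynomial transfer matrices. -/
def polyTransferProd (x : Phase N) (e : ZMod N → ℝ) (i j : ZMod N) :
    ℕ → Matrix (Fin 2) (Fin 2) ℝ[X]
  | 0 => 1
  | n + 1 => polyTransfer x e i (j + n) * polyTransferProd x e i j n

theorem eval_polyTransferProd (x : Phase N) (e : ZMod N → ℝ) (i j : ZMod N) {u : ℝ} (hu : u ≠ 0)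
    (n : ℕ) (p q : Fin 2) : (polyTransferProd x e i j n p q).eval u =
      u ^ n * transferProd (x.1 + u⁻¹ • e, x.2) (u⁻¹ * e i) j n p q := by
  induction n generalizing p with
  | zero => fin_cases p <;> fin_cases q <;> simp [polyTransferProd, transferProd]
  | succ n ih =>
    rw [polyTransferProd, transferProd, Matrix.mul_apply, Matrix.mul_apply, Fin.sum_univ_two,
      Fin.sum_univ_two, Polynomial.eval_add, Polynomial.eval_mul, Polynomial.eval_mul, ih, ih]
    fin_cases p
    · simp [polyTransfer, transfer, pow_succ]
      field_simp
      ring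
    · simp [polyTransfer, transfer, pow_succ]
      field_simp

theorem eval_zero_polyTransferProd (x : Phase N) (e : ZMod N → ℝ) (i j : ZMod N) (n : ℕ) :
    (polyTransferProd x e i j n 0 0).eval 0 =
      ∏ m ∈ Finset.range n, (e i - e (j + m + 1)) / x.2 (j + m) := by
  induction n with
  | zero => simp [polyTransferProd]
  | succ n ih =>
    rw [polyTransferProd, Matrix.mul_apply, Fin.sum_univ_two, Polynomial.eval_add,
      Polynomial.eval_mul, ih, Finset.prod_range_succ]
    simp [polyTransfer]
    ring

/-- The determinant of the polynomial matrix that controls the independence. -/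
def polyDet (x : Phase N) (e : ZMod N → ℝ) : ℝ[X] :=
  (Matrix.of fun i k : ZMod N => polyTransferProd x e i k (N - 1) 0 0).det

theorem eval_polyDet (x : Phase N) (e : ZMod N → ℝ) (u : ℝ) : (polyDet x e).eval u =
    (Matrix.of fun i k : ZMod N => (polyTransferProd x e i k (N - 1) 0 0).eval u).det := by
  rw [polyDet, ← Polynomial.coe_evalRingHom, RingHom.map_det]
  rfl

/-- At `u = 0` the entry `(i, k)` is, up to the factors `1 / a`, the product of `e_i - e_j` over all
`j ≠ k`. It contains the factor `j = i` unless `i = k`, so the matrix is diagonal, and its diagonal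
has no zero as `e` is injective. -/
theorem polyDet_ne_zero {x : Phase N} (hx : x ∈ phaseSpace N) {e : ZMod N → ℝ}
    (he : Function.Injective e) : polyDet x e ≠ 0 := by
  intro h
  have h1 := eval_polyDet x e 0
  have h2 : (Matrix.of fun i k : ZMod N => (polyTransferProd x e i k (N - 1) 0 0).eval 0) =
      Matrix.diagonal fun i => (polyTransferProd x e i i (N - 1) 0 0).eval 0 := by
    ext i k
    by_cases hik : i = k
    · subst hik; simp
    · rw [Matrix.diagonal_apply_ne _ hik, Matrix.of_apply, eval_zero_polyTransferProd]
      have hv : (i - k).val ≠ 0 := fun h0 => hik (sub_eq_zero.1 ((ZMod.val_eq_zero _).1 h0))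
      have hlt := ZMod.val_lt (i - k)
      refine Finset.prod_eq_zero (i := (i - k).val - 1) (Finset.mem_range.2 (by omega)) ?_
      have hc : (((i - k).val - 1 : ℕ) : ZMod N) + 1 = i - k := by
        rw [← Nat.cast_succ, Nat.succ_eq_add_one, Nat.sub_add_cancel (by omega),
          ZMod.natCast_zmod_val]
      rw [add_assoc, hc]
      simp
  rw [h, Polynomial.eval_zero, h2, Matrix.det_diagonal, eq_comm, Finset.prod_eq_zero_iff] at h1
  obtain ⟨i, -, hi⟩ := h1
  rw [eval_zero_polyTransferProd, Finset.prod_eq_zero_iff] at hi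
  obtain ⟨m, hm, h3⟩ := hi
  rw [div_eq_zero_iff, or_iff_left (hx _).ne', sub_eq_zero] at h3
  have h4 := he h3
  rw [add_assoc, left_eq_add, ← Nat.cast_succ, ZMod.natCast_eq_zero_iff] at h4
  have := Nat.le_of_dvd (by omega) h4
  have := Finset.mem_range.1 hm
  omega

theorem discriminantDeriv_single {x : Phase N} (hx : x ∈ phaseSpace N) (l : ℝ) (k : ZMod N) :
    discriminantDeriv x (Pi.single k 1, 0) l =
      -(x.2 (k - 1))⁻¹ * transferProd x l k (N - 1) 0 0 := by
  have h := discriminantDeriv_single_fst x l (k - 1)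
  have ha := (hx (k - 1)).ne'
  have hN : N = 1 + (N - 1) := by have := NeZero.pos N; omega
  have h2 := transferProd_add x l (k - 1) 1 (N - 1)
  rw [← hN] at h2
  rw [sub_add_cancel] at h
  rw [h, monodromy, h2, Matrix.mul_apply, Fin.sum_univ_two]
  simp [transferProd, transfer]
  field_simp

/-- If the differentials of `Δ(λ_i)` with respect to `b` are independent for some `λ_i`, then so are
the differentials of the coefficients. -/
theorem coeff_independent_of_det_ne_zero (hN : 2 ≤ N) {x : Phase N} (hx : x ∈ phaseSpace N)
    {l : ZMod N → ℝ} (hdet : (Matrix.of fun i k : ZMod N =>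
      discriminantDeriv x (Pi.single k 1, 0) (l i)).det ≠ 0) {c : Fin N → ℝ}
    (hc : ∀ k, ∑ m : Fin N, c m * coeffDifferential x m (Pi.single k 1, 0) = 0) : c = 0 := by
  set M := Matrix.of fun i k : ZMod N => discriminantDeriv x (Pi.single k 1, 0) (l i)
  set V : Matrix (ZMod N) (Fin N) ℝ := Matrix.of fun i m => l i ^ (m : ℕ)
  set Φ : Matrix (Fin N) (ZMod N) ℝ :=
    Matrix.of fun m k => coeffDifferential x m (Pi.single k 1, 0)
  have hM : M = V * Φ := by
    ext i k
    simp only [M, V, Φ, Matrix.mul_apply, Matrix.of_apply]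
    -- The coefficient of degree `N` depends on `a` only; dropping it makes both factors square.
    rw [← sum_coeffDifferential hN hx, Finset.sum_range_succ,
      coeffDifferential_top_eq_zero hN hx (by simp), zero_mul, add_zero, Finset.sum_range]
    exact Finset.sum_congr rfl fun m _ => mul_comm _ _
  have h1 : V * (Φ * M⁻¹) = 1 := by
    rw [← Matrix.mul_assoc, ← hM, Matrix.mul_nonsing_inv _ (isUnit_iff_ne_zero.2 hdet)]
  have h2 : Φ * M⁻¹ * V = 1 :=
    (Matrix.mul_eq_one_comm_of_card_eq (ZMod N) (Fin N) ℝ (by simp [ZMod.card])).1 h1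
  have h3 : c ᵥ* Φ = 0 := by
    ext k
    exact hc k
  rw [← Matrix.vecMul_one c, ← h2, Matrix.mul_assoc, ← Matrix.vecMul_vecMul, h3, Matrix.zero_vecMul]

theorem coeff_independent_of_polyDet_ne_zero (hN : 2 ≤ N) {x : Phase N} (hx : x ∈ phaseSpace N)
    {e : ZMod N → ℝ} {u : ℝ} (hu : u ≠ 0) (h : (polyDet x e).eval u ≠ 0) {c : Fin N → ℝ}
    (hc : ∀ k, ∑ m : Fin N,
      c m * coeffDifferential (x.1 + u⁻¹ • e, x.2) m (Pi.single k 1, 0) = 0) : c = 0 := by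
  have hy : ((x.1 + u⁻¹ • e, x.2) : Phase N) ∈ phaseSpace N := hx
  refine coeff_independent_of_det_ne_zero hN hy (l := fun i => u⁻¹ * e i) ?_ hc
  -- The polynomial matrix is the matrix of the `b`-derivatives of `Δ(λ_i)` up to a scaling of its
  -- columns.
  have h1 : (Matrix.of fun i k : ZMod N => (polyTransferProd x e i k (N - 1) 0 0).eval u) =
      (Matrix.of fun i k : ZMod N => discriminantDeriv (x.1 + u⁻¹ • e, x.2)
        (Pi.single k 1, 0) (u⁻¹ * e i)) *
        Matrix.diagonal fun k => -(u ^ (N - 1) * x.2 (k - 1)) := by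
    ext i k
    have := (hx (k - 1)).ne'
    rw [Matrix.mul_diagonal, Matrix.of_apply, Matrix.of_apply, eval_polyTransferProd x e i k hu,
      discriminantDeriv_single hy]
    field_simp
  rw [eval_polyDet, h1, Matrix.det_mul] at h
  exact left_ne_zero_of_mul h

/-! ### Independence of the actions -/

/-- Each of the `N - 1` gaps contains a zero of `q`. The zeros are distinct because nondegenerate
bands separate the gaps, and there are too many of them for the degree. -/
theorem eq_zero_of_period_eq_zero (hN : 2 ≤ N) {x : Phase N} (hx : x ∈ phaseSpace N) {q : ℝ[X]}
    (hq : q.natDegree < N - 1) (h : ∀ n, 1 ≤ n → n < N → period x n q = 0) : q = 0 := by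
  choose t ht ht0 using fun i : Fin (N - 1) => exists_root_of_period_eq_zero hN hx
    (n := i + 1) (by omega) (by omega) (h (i + 1) (by omega) (by omega))
  have hmono : StrictMono t := by
    intro i j hij
    have hij : (i : ℕ) < j := hij
    have h1 := lam_strict hN hx (m := i + 1) (by omega)
    have h2 := lam_mono hN hx (i := 2 * (i + 1) + 2) (j := 2 * (j + 1)) (by omega) (by omega)
      (by omega)
    linarith [(ht i).2, (ht j).1]
  exact Polynomial.eq_zero_of_natDegree_lt_card_of_eval_eq_zero q hmono.injective ht0
    (by simpa using hq)

/-- The matrix of the periods of the monomials. -/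
def periodMatrix (x : Phase N) : Matrix (Fin (N - 1)) (Fin (N - 1)) ℝ :=
  Matrix.of fun n m => period x (n + 1) (Polynomial.X ^ (m : ℕ))

theorem isUnit_periodMatrix (hN : 2 ≤ N) {x : Phase N} (hx : x ∈ phaseSpace N) :
    IsUnit (periodMatrix x) := by
  rw [← Matrix.mulVec_injective_iff_isUnit, ← Matrix.coe_mulVecLin, ← LinearMap.ker_eq_bot,
    LinearMap.ker_eq_bot']
  intro c hc
  have hq : (∑ m : Fin (N - 1), c m • (Polynomial.X ^ (m : ℕ) : ℝ[X])) = 0 := by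
    refine eq_zero_of_period_eq_zero hN hx ?_ fun n hn hn' => ?_
    · refine lt_of_le_of_lt (Polynomial.natDegree_sum_le_of_forall_le (n := N - 2) _ _
        fun m _ => ?_) (by omega)
      refine (Polynomial.natDegree_smul_le _ _).trans ?_
      rw [Polynomial.natDegree_X_pow]
      omega
    · have h1 := congrFun hc ⟨n - 1, by omega⟩
      change periodMap hN hx hn hn' _ = 0
      rw [map_sum]
      simp only [Matrix.mulVecLin_apply, Matrix.mulVec, dotProduct, periodMatrix, Matrix.of_apply,
        Nat.sub_add_cancel hn, Pi.zero_apply] at h1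
      simpa [periodMap, mul_comm] using h1
  funext m
  have := congrArg (fun p : ℝ[X] => p.coeff m) hq
  simpa [Polynomial.finsetSum_coeff, Polynomial.coeff_X_pow, Fin.val_inj] using this

theorem fderiv_action_of_mem_leafTangent (hN : 2 ≤ N) {x : Phase N} (hx : x ∈ phaseSpace N) {n : ℕ}
    (hn : 1 ≤ n) (hn' : n < N) {v : Phase N} (hv : v ∈ leafTangent x) :
    fderiv ℝ (action n) x v = ∑ m : Fin (N - 1),
      period x n (Polynomial.X ^ (m : ℕ)) * coeffDifferential x m v := by
  obtain ⟨h1, h2⟩ := (mem_leafTangent_iff hx).1 hv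
  obtain ⟨r, hr⟩ : ∃ r, N = r + 1 := ⟨N - 1, by omega⟩
  have h3 := coeffDifferential_top_sub_one hN hx h2
  have h4 := coeffDifferential_top_eq_zero hN hx h2
  rw [h1, neg_zero, zero_mul] at h3
  rw [fderiv_action hN hx hn hn', Finset.sum_range_succ,
    show Finset.range N = Finset.range (N - 1 + 1) by rw [Nat.sub_add_cancel (by omega)],
    Finset.sum_range_succ, Finset.sum_range]
  simp [h3, h4]

/-- Independence of the coefficients of `Δ` in the `b`-directions entails that of the actions. -/
theorem linearIndependent_action (hN : 2 ≤ N) {x : Phase N} (hx : x ∈ phaseSpace N)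
    (h : ∀ c : Fin N → ℝ,
      (∀ k, ∑ m : Fin N, c m * coeffDifferential x m (Pi.single k 1, 0) = 0) → c = 0) :
    LinearIndependent ℝ fun n : Fin (N - 1) => leafDifferential (action (n.val + 1)) x := by
  rw [Fintype.linearIndependent_iff]
  intro g hg
  set d : Fin (N - 1) → ℝ := g ᵥ* periodMatrix x with hd
  have hdv : ∀ v ∈ leafTangent x, ∑ m : Fin (N - 1), d m * coeffDifferential x m v = 0 := by
    intro v hv
    have h1 := LinearMap.congr_fun hg ⟨v, hv⟩
    simp only [LinearMap.sum_apply, LinearMap.smul_apply, LinearMap.zero_apply, smul_eq_mul] at h1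
    rw [← h1]
    simp only [hd, Matrix.vecMul, dotProduct, periodMatrix, Matrix.of_apply, Finset.sum_mul]
    rw [Finset.sum_comm]
    refine Finset.sum_congr rfl fun i _ => ?_
    change _ = g i * fderiv ℝ (action (i.val + 1)) x v
    rw [fderiv_action_of_mem_leafTangent hN hx (by omega) (by omega) hv, Finset.mul_sum]
    exact Finset.sum_congr rfl fun m _ => mul_assoc _ _ _
  -- Differences of unit vectors in the `b`-directions are tangent to the leaf, so on the unit
  -- vectors themselves the relation has a common value `κ`.
  have hk : ∀ k, ∑ m : Fin (N - 1), d m * coeffDifferential x m (Pi.single k 1, 0) =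
      ∑ m : Fin (N - 1), d m * coeffDifferential x m (Pi.single 0 1, 0) := by
    intro k
    have h1 := hdv ((Pi.single k 1, 0) - (Pi.single 0 1, 0)) ((mem_leafTangent_iff hx).2 (by
      simp [Finset.sum_sub_distrib]))
    simpa only [map_sub, mul_sub, Finset.sum_sub_distrib, sub_eq_zero] using h1
  set κ := ∑ m : Fin (N - 1), d m * coeffDifferential x m (Pi.single 0 1, 0)
  set P := ∏ n, x.2 n with hP
  have hP0 : P ≠ 0 := (Finset.prod_pos fun n _ => hx n).ne'
  -- In the `b`-directions the coefficient of degree `N - 1` has constant derivative `-1 / P`; the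
  -- weight `κ P` on it therefore cancels `κ`.
  have hc := h (fun m => if hm : (m : ℕ) < N - 1 then d ⟨m, hm⟩ else κ * P) fun k => by
    have h1 := coeffDifferential_top_sub_one hN hx (v := (Pi.single k 1, 0)) (by simp)
    rw [Finset.sum_fin_eq_sum_range,
      show Finset.range N = Finset.range (N - 1 + 1) by rw [Nat.sub_add_cancel (by omega)],
      Finset.sum_range_succ]
    have h2 := hk k
    rw [Finset.sum_fin_eq_sum_range] at h2
    rw [dif_pos (by omega), dif_neg (by simp), h1]
    have h3 : ∀ m ∈ Finset.range (N - 1), (if hm : m < N then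
        (if hm : m < N - 1 then d ⟨m, hm⟩ else κ * P) *
          coeffDifferential x m (Pi.single k 1, 0) else 0) =
        if hm : m < N - 1 then d ⟨m, hm⟩ * coeffDifferential x m (Pi.single k 1, 0) else 0 := by
      intro m hm
      have := Finset.mem_range.1 hm
      rw [dif_pos (by omega), dif_pos this, dif_pos this]
    rw [Finset.sum_congr rfl h3, h2]
    simp [← hP]
    field_simp
    ring
  have hd0 : d = 0 := by
    funext m
    have h1 := congrFun hc ⟨m, by omega⟩
    simpa using h1
  have := Matrix.vecMul_injective_iff_isUnit.2 (isUnit_periodMatrix hN hx)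
    (hd0.trans (Matrix.zero_vecMul _).symm)
  exact fun i => congrFun this i

/-! ### Density -/

/-- Move `b` along the line `b + s e`. For `u = 1/s` the determinant that controls independence is a
nonzero polynomial in `u`, so only finitely many `s ≠ 0` are excluded, and `s` can tend to `0`. -/
theorem leaf_subset_closure (hN : 2 ≤ N) (β α : ℝ) : leaf N β α ⊆ closure {x | x ∈ leaf N β α ∧
    LinearIndependent ℝ fun n : Fin (N - 1) => leafDifferential (action (n.val + 1)) x} := by
  intro x hx
  -- Subtracting the mean gives `e` sum zero, which keeps the line on the leaf; its entries remain
  -- distinct.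
  set μ : ℝ := (∑ k : ZMod N, (k.val : ℝ)) / N
  set e : ZMod N → ℝ := fun k => k.val - μ
  have hN0 : (N : ℝ) ≠ 0 := Nat.cast_ne_zero.2 (NeZero.ne N)
  have he : Function.Injective e := fun i j hij =>
    ZMod.val_injective N (by exact_mod_cast sub_left_injective hij)
  have hsum : ∑ k, e k = 0 := by
    simp only [e, Finset.sum_sub_distrib, Finset.sum_const, Finset.card_univ, ZMod.card,
      nsmul_eq_mul, μ]
    field_simp
    simp
  have hfin : {s : ℝ | (polyDet x e).eval s⁻¹ = 0}.Finite :=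
    (Polynomial.finite_setOfPred_isRoot (polyDet_ne_zero hx.1 he)).preimage
      inv_injective.injOn
  have hev : ∀ᶠ s in nhdsWithin (0 : ℝ) {0}ᶜ, (polyDet x e).eval s⁻¹ ≠ 0 :=
    nhdsNE_le_cofinite 0 hfin.compl_mem_cofinite
  have hlim : Filter.Tendsto (fun s : ℝ => ((x.1 + s • e, x.2) : Phase N))
      (nhdsWithin (0 : ℝ) {0}ᶜ) (nhds x) := by
    have hc : Continuous fun s : ℝ => ((x.1 + s • e, x.2) : Phase N) := by fun_prop
    simpa using (hc.tendsto 0).mono_left nhdsWithin_le_nhds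
  refine mem_closure_of_tendsto hlim ?_
  filter_upwards [hev, self_mem_nhdsWithin] with s h1 h2
  have h2 : s ≠ 0 := h2
  refine ⟨⟨hx.1, ?_, hx.2.2⟩, ?_⟩
  · rw [← hx.2.1, casimir₁, casimir₁]
    simp [Finset.sum_add_distrib, ← Finset.mul_sum, hsum]
  · refine linearIndependent_action hN hx.1 fun c hc => ?_
    refine coeff_independent_of_polyDet_ne_zero hN hx.1 (inv_ne_zero h2) h1 ?_
    simpa using hc

/-! ### Maximality -/

theorem leaf_nonempty (β : ℝ) {α : ℝ} (hα : 0 < α) : (leaf N β α).Nonempty := by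
  refine ⟨(fun _ => -β, fun _ => α), fun _ => hα, ?_, ?_⟩
  · have : (N : ℝ) ≠ 0 := Nat.cast_ne_zero.2 (NeZero.ne N)
    simp [casimir₁, ZMod.card]
    field_simp
  · simp [casimir₂, ZMod.card, Real.pow_rpow_inv_natCast hα.le (NeZero.ne N)]

theorem eq_apply_zero_of_succ {f : ZMod N → ℝ} (h : ∀ k, f (k + 1) = f k) (k : ZMod N) :
    f k = f 0 := by
  have h1 : ∀ m : ℕ, f m = f 0 := fun m => by
    induction m with
    | zero => simp
    | succ m ih => rw [Nat.cast_succ, h, ih]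
  simpa using h1 k.val

/-- The Poisson structure is nondegenerate on the leaves. -/
theorem eq_zero_of_sharp_eq_zero {x : Phase N} (hx : x ∈ phaseSpace N) {φ : Phase N →ₗ[ℝ] ℝ}
    (h : sharp x φ = 0) {v : Phase N} (hv : v ∈ leafTangent x) : φ v = 0 := by
  obtain ⟨h1, h2⟩ := (mem_leafTangent_iff hx).1 hv
  have ha := eq_apply_zero_of_succ (f := fun k => x.2 k * φ (0, Pi.single k 1)) fun k => by
    have := sharp_fst x φ k
    rw [h] at this
    simp only [Prod.fst_zero, Pi.zero_apply] at this
    linarith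
  have hb := eq_apply_zero_of_succ (f := fun k => φ (Pi.single k 1, 0)) fun k => by
    have := sharp_snd x φ k
    rw [h] at this
    simp only [Prod.snd_zero, Pi.zero_apply] at this
    have h3 := (hx k).ne'
    have : x.2 k * (φ (Pi.single (k + 1) 1, 0) - φ (Pi.single k 1, 0)) = 0 := by linarith
    exact sub_eq_zero.1 ((mul_eq_zero.1 this).resolve_left h3)
  have hsum : v = (∑ n, v.1 n • ((Pi.single n 1, 0) : Phase N)) +
      ∑ n, v.2 n • ((0, Pi.single n 1) : Phase N) := by
    ext n <;> simp [Prod.fst_sum, Prod.snd_sum, Finset.sum_apply, Pi.single_apply]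
  rw [hsum]
  simp only [map_add, map_sum, map_smul, smul_eq_mul]
  have e1 : ∑ n, v.1 n * φ (Pi.single n 1, 0) = 0 := by
    simp only [hb, ← Finset.sum_mul, h1, zero_mul]
  have e2 : ∑ n, v.2 n * φ (0, Pi.single n 1) = 0 := by
    have : ∀ n, v.2 n * φ (0, Pi.single n 1) =
        v.2 n / x.2 n * (x.2 0 * φ (0, Pi.single 0 1)) := fun n => by
      have h3 := (hx n).ne'
      rw [← ha n]
      field_simp
    simp only [this, ← Finset.sum_mul, h2, zero_mul]
  rw [e1, e2, add_zero]

theorem finrank_leafTangent {x : Phase N} (hx : x ∈ phaseSpace N) :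
    Module.finrank ℝ (leafTangent x) + 2 = 2 * N := by
  let L : Phase N →ₗ[ℝ] ℝ × ℝ :=
    { toFun := fun v => (∑ n, v.1 n, ∑ n, v.2 n / x.2 n)
      map_add' := fun v w => by simp [Finset.sum_add_distrib, add_div]
      map_smul' := fun c v => by simp [Finset.mul_sum, mul_div_assoc] }
  have hL : LinearMap.ker L = leafTangent x := by
    ext v
    rw [mem_leafTangent_iff hx, LinearMap.mem_ker]
    exact Prod.ext_iff
  have hsurj : LinearMap.range L = ⊤ := LinearMap.range_eq_top.2 fun p => by
    refine ⟨(Pi.single 0 p.1, Pi.single 0 (p.2 * x.2 0)), ?_⟩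
    have h0 := (hx 0).ne'
    have : ∀ n, (Pi.single 0 (p.2 * x.2 0) : ZMod N → ℝ) n / x.2 n = if n = 0 then p.2 else 0 := by
      intro n
      by_cases hn : n = 0
      · subst hn; simp [h0]
      · simp [hn]
    ext <;> simp [L, this]
  have h := LinearMap.finrank_range_add_finrank_ker L
  rw [hsurj, hL, finrank_top, Module.finrank_prod, Module.finrank_prod, Module.finrank_fintype_fun_eq_card,
    ZMod.card] at h
  simp at h
  omega

/-- An isotropic family of independent covectors on a leaf has at most `N - 1` members. -/
theorem card_le_of_isotropic {x : Phase N} (hx : x ∈ phaseSpace N) {k : ℕ}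
    {F : Fin k → Phase N → ℝ} (hli : LinearIndependent ℝ fun i => leafDifferential (F i) x)
    (hinv : ∀ i j, fderiv ℝ (F i) x (hamiltonianField (F j) x) = 0) : k ≤ N - 1 := by
  let w : Fin k → leafTangent x := fun j => ⟨hamiltonianField (F j) x, hamiltonianField_mem _ hx⟩
  -- A relation among the Hamiltonian vectors is a covector killed by `J`; by nondegeneracy it
  -- vanishes on the leaf.
  have hw : LinearIndependent ℝ w := by
    rw [Fintype.linearIndependent_iff] at hli ⊢
    intro g hg
    refine hli g ?_
    ext v
    have h1 : sharp x (∑ i, g i • (fderiv ℝ (F i) x).toLinearMap) = 0 := by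
      rw [sharp_sum]
      have h2 := congrArg Subtype.val hg
      simp only [w, Submodule.coe_sum, Submodule.coe_smul, ZeroMemClass.coe_zero] at h2
      exact h2
    have h2 := eq_zero_of_sharp_eq_zero hx h1 v.2
    simpa [leafDifferential] using h2
  let S := Submodule.span ℝ (Set.range fun i => leafDifferential (F i) x)
  have hS : Module.finrank ℝ S = k := by
    rw [finrank_span_eq_card hli, Fintype.card_fin]
  have hW : Module.finrank ℝ (Submodule.span ℝ (Set.range w)) = k := by
    rw [finrank_span_eq_card hw, Fintype.card_fin]
  -- Involution places the `k` independent Hamiltonian vectors in the common kernel of the `k`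
  -- independent differentials, so `k ≤ (2N - 2) - k`.
  have hle : Submodule.span ℝ (Set.range w) ≤ S.dualCoannihilator := by
    rw [Submodule.span_le]
    rintro _ ⟨j, rfl⟩
    rw [SetLike.mem_coe, Submodule.mem_dualCoannihilator]
    intro φ hφ
    have hker : S ≤ LinearMap.ker (LinearMap.applyₗ (R := ℝ) (M₂ := ℝ) (w j)) := by
      rw [Submodule.span_le]
      rintro _ ⟨i, rfl⟩
      exact hinv i j
    exact hker hφ
  have h1 := Submodule.finrank_mono hle
  have h2 := Subspace.finrank_add_finrank_dualCoannihilator_eq S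
  have h3 := finrank_leafTangent hx
  rw [hW] at h1
  rw [hS] at h2
  have := NeZero.pos N
  omega

end PeriodicToda

end

theorem corollary1p2 (N : ℕ) [NeZero N] (hN : 2 ≤ N) (β α : ℝ) (hα : 0 < α) :
    (∀ n : Fin (N - 1), ∀ x ∈ PeriodicToda.leaf N β α,
      (PeriodicToda.action (n.val + 1) x : ℂ) = PeriodicToda.actionIntegral x (n.val + 1)) ∧
    PeriodicToda.MaximalIndependentIntegralsInInvolution (N := N) β α
      (fun n : Fin (N - 1) => PeriodicToda.action (n.val + 1)) := by
  refine ⟨fun n x hx => PeriodicToda.action_eq_actionIntegral hN hx.1 (by omega) (by omega),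
    ⟨fun n x hx => (PeriodicToda.contDiffAt_action hN hx.1 (by omega) (by omega)).1,
      fun n γ t₀ t₁ h s hs t ht => PeriodicToda.action_congr hN (h s hs).1.1 (h t ht).1.1
        (PeriodicToda.discriminant_const (fun r hr => ⟨(h r hr).1.1, (h r hr).2⟩) hs ht) _,
      fun n m x => PeriodicToda.fderiv_action_hamiltonianField hN x.2.1 (by omega) (by omega)
        (by omega) (by omega),
      PeriodicToda.leaf_subset_closure hN β α⟩, fun k G hG => ?_⟩
  -- The leaf is nonempty because `α > 0`, so density yields at least one point with independent
  -- differentials.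
  obtain ⟨x, hx, hli⟩ := closure_nonempty_iff.1
    ((PeriodicToda.leaf_nonempty β hα).mono hG.independent)
  exact PeriodicToda.card_le_of_isotropic hx.1 hli fun i j => hG.involution i j ⟨x, hx⟩
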